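/- **Setting.** Let $\mathbb{T}^2 = \mathbb{R}^2/\mathbb{Z}^2$ and, for $\alpha \in \mathbb{R}$, let $\mathcal{C}^{\alpha} = B^{\alpha}_{\infty,\infty}(\mathbb{T}^2)$ be the Besov space of complex-valued distributions $f$ on $\mathbb{T}^2$ with $\|f\|_{\mathcal{C}^\alpha} = \sup_{k \ge -1} 2^{\alpha k}\|\delta_k f\|_{L^\infty} < \infty$, where $(\delta_k)_{k\ge -1}$ are the Littlewood–Paley blocks of a fixed smooth radial dyadic partition of unity. Fix $\mu > 0$ and $\nu, \lambda \in \mathbb{C}$, and let $A = (i+\mu)\Delta - 1$. Let $\mathfrak{Z}$ be the set of quadruples of paths $\underline{Z} = (Z, Z^2, |Z|^2, |Z|^2Z)$ (the last three are independent data, not functions of $Z$) that lie in $C([0,\infty);\mathcal{C}^{-\alpha}) \times C((0,\infty);\mathcal{C}^{-\alpha})^3$ and satisfy $\sup_{0<t\le T}\|\underline{Z}_t\|_{\mathfrak{Z}_\alpha} < \infty$ for all $\alpha, T \in (0,\infty)$, where $$\|\underline{Z}_t\|_{\mathfrak{Z}_\alpha} = \max\{\|Z_t\|_{\mathcal{C}^{-\alpha}},\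 t^\alpha\|Z^2_t\|_{\mathcal{C}^{-\alpha}},\ t^\alpha\||Z|^2_t\|_{\mathcal{C}^{-\alpha}},\ t^\alpha\|(|Z|^2Z)_t\|_{\mathcal{C}^{-\alpha}}\}.$$ Put $$\Psi(Y_t,\underline{Z}_t) = (1+\lambda)(Z_t+Y_t) - \nu\big(|Y_t|^2Y_t + 2Z_t|Y_t|^2 + \overline{Z_t}\,Y_t^2 + 2|Z|^2_tY_t + Z^2_t\,\overline{Y_t} + (|Z|^2Z)_t\big).$$ For $Y_0 \in \mathcal{C}^{-\alpha_0}$, $\underline{Z} \in \mathfrak{Z}$ and $T > 0$, let $S^T(Y_0,\underline{Z})$ be the set of solutions over $[0,T]$ of the remainder equation $\partial_tY = AY + \Psi(Y,\underline{Z})$, $Y(0)=Y_0$, that is, of those $Y$ on $(0,T]$ such that 1. there are $\alpha_1 \in (0,\infty)$ and $\gamma \in (0,\tfrac13)$ with $Y \in C((0,T];\mathcal{C}^{\alpha_1})$ and $\sup_{0<t\le T}t^\gamma\|Y_t\|_{\mathcal{C}^{\alpha_1}} < \infty$; 2. $Y_t = e^{tA}Y_0 + \int_0^t e^{(t-s)A}\Psi(Y_s,\underline{Z}_s)\,ds$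 for all $t \in (0,T]$. **Theorem.** Let $\alpha_0 \in (0,\tfrac23)$. There exist $\alpha, \theta \in (0,\infty)$, depending only on $\alpha_0$, and a constant $C \in (0,\infty)$, depending only on $\alpha_0$, on $\mu,\nu,\lambda$ and on the chosen partition of unity, such that for every $K \in [1,\infty)$, with $T^* = C K^{-\theta}$, the following holds: for every $Y_0 \in \mathcal{C}^{-\alpha_0}$ and $\underline{Z} \in \mathfrak{Z}$ with $$\|Y_0\|_{\mathcal{C}^{-\alpha_0}} + \sup_{0<t\le T^*}\|\underline{Z}_t\|_{\mathfrak{Z}_\alpha} \le K,$$ the set $S^{T^*}(Y_0,\underline{Z})$ is a singleton. -/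

import Mathlib

open scoped ENNReal Topology ContDiff

noncomputable section

namespace CGL

/-- Distributions on the torus `(ℝ/ℤ)²` are written through their Fourier coefficients:
`f m` is the coefficient of `e_m(x) = exp (2πi m·x)`, for `m ∈ ℤ²`. -/
abbrev FormalFourierSeries : Type := (Fin 2 → ℤ) → ℂ

/-- A formal Fourier series is (the series of) a distribution on the torus if and only if its
coefficients grow at most polynomially. -/
def IsDistribution (f : FormalFourierSeries) : Prop :=
  ∃ (C : ℝ) (N : ℕ), ∀ m, ‖f m‖ ≤ C * (1 + ‖m‖) ^ N

/-- A smooth radial dyadic partition of unity on `ℝ²`: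
`low ξ + ∑_{k ≥ 0} high (ξ / 2^k) = 1`, with `low` supported in the ball of radius `4/3` and `high`
in the annulus with radii `3/4` and `8/3`. -/
structure DyadicPartition where
  low : EuclideanSpace ℝ (Fin 2) → ℝ
  high : EuclideanSpace ℝ (Fin 2) → ℝ
  contDiff_low : ContDiff ℝ ∞ low
  contDiff_high : ContDiff ℝ ∞ high
  low_mem : ∀ ξ, low ξ ∈ Set.Icc (0 : ℝ) 1
  high_mem : ∀ ξ, high ξ ∈ Set.Icc (0 : ℝ) 1
  low_radial : ∀ ξ η, ‖ξ‖ = ‖η‖ → low ξ = low η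
  high_radial : ∀ ξ η, ‖ξ‖ = ‖η‖ → high ξ = high η
  low_support : ∀ ξ, low ξ ≠ 0 → ‖ξ‖ ≤ 4 / 3
  high_support : ∀ ξ, high ξ ≠ 0 → 3 / 4 ≤ ‖ξ‖ ∧ ‖ξ‖ ≤ 8 / 3
  hasSum_high : ∀ ξ, HasSum (fun k : ℕ => high (((2 : ℝ) ^ k)⁻¹ • ξ)) (1 - low ξ)

/-- The lattice point `m ∈ ℤ²` as a point of `ℝ²`. -/
def freq (m : Fin 2 → ℤ) : EuclideanSpace ℝ (Fin 2) := WithLp.toLp 2 fun i => (m i : ℝ)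

/-- The cut-offs `χ_k`, `k ≥ -1`, indexed by `j = k + 1`. -/
def DyadicPartition.cutoff (P : DyadicPartition) : ℕ → EuclideanSpace ℝ (Fin 2) → ℝ
  | 0, ξ => P.low ξ
  | k + 1, ξ => P.high (((2 : ℝ) ^ k)⁻¹ • ξ)

/-- The Littlewood-Paley block `δ_k f`, `k = j - 1`, as a function on the torus
(only finitely many terms of the sum are nonzero). -/
def block (P : DyadicPartition) (j : ℕ) (f : FormalFourierSeries)
    (x : UnitAddTorus (Fin 2)) : ℂ :=
  ∑' m : Fin 2 → ℤ, (P.cutoff j (freq m) : ℂ) * f m * UnitAddTorus.mFourier m x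

/-- The norm of `𝒞^α = B^α_{∞,∞}`: `sup_{k ≥ -1} 2^{αk} ‖δ_k f‖_{L^∞}`, with values in `[0, ∞]`. -/
def holderNorm (P : DyadicPartition) (α : ℝ) (f : FormalFourierSeries) : ℝ≥0∞ :=
  ⨆ j : ℕ, ENNReal.ofReal ((2 : ℝ) ^ (α * ((j : ℝ) - 1))) * ⨆ x, ‖block P j f x‖ₑ

/-- `f ∈ 𝒞^α = B^α_{∞,∞}` on the torus. -/
def MemHolder (P : DyadicPartition) (α : ℝ) (f : FormalFourierSeries) : Prop :=
  IsDistribution f ∧ holderNorm P α f < ⊤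

/-- `F ∈ C(I; 𝒞^α)`. Only the values of `F` on `I` matter. -/
def ContinuousInto (P : DyadicPartition) (α : ℝ) (I : Set ℝ)
    (F : ℝ → FormalFourierSeries) : Prop :=
  ∀ t ∈ I, MemHolder P α (F t) ∧
    Filter.Tendsto (fun s => holderNorm P α (F s - F t)) (𝓝[I] t) (𝓝 0)

/-- Complex conjugation: the `m`-th coefficient of `conj f` is `conj (f_{-m})`. -/
def conj (f : FormalFourierSeries) : FormalFourierSeries :=
  fun m => starRingEnd ℂ (f (-m))

/-- The product of two distributions: the convolution of their Fourier coefficients. The series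
converges absolutely if `f ∈ 𝒞^α`, `g ∈ 𝒞^β` with `α + β > 0` (as then `f ∈ H^s`, `g ∈ H^{-s}` for
some `s`), and then this is the continuous extension of the product of smooth functions. -/
def mul (f g : FormalFourierSeries) : FormalFourierSeries :=
  fun m => ∑' l : Fin 2 → ℤ, f l * g (m - l)

/-- The semigroup `e^{tA}` generated by `A = (i + μ)Δ - 1`; note `Δ e_m = -4π²|m|² e_m`. -/
def semigroup (μ : ℝ) (t : ℝ) (f : FormalFourierSeries) : FormalFourierSeries :=
  fun m => Complex.exp
    (-(t : ℂ) * ((Complex.I + μ) * (4 * Real.pi ^ 2 * ‖freq m‖ ^ 2 : ℝ) + 1)) * f m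

/-- A quadruple of paths standing for `(Z, Z², |Z|², |Z|²Z)`; the last three are data of their own,
not functions of `Z`. -/
structure Quadruple where
  Z : ℝ → FormalFourierSeries
  sq : ℝ → FormalFourierSeries
  absSq : ℝ → FormalFourierSeries
  cub : ℝ → FormalFourierSeries

/-- The weighted norm
`max {‖Z_t‖, t^α ‖Z²_t‖, t^α ‖|Z|²_t‖, t^α ‖(|Z|²Z)_t‖}` with all norms those of `𝒞^{-α}`. -/
def Quadruple.norm (P : DyadicPartition) (α : ℝ) (W : Quadruple) (t : ℝ) : ℝ≥0∞ :=
  max (holderNorm P (-α) (W.Z t))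
    (max (ENNReal.ofReal (t ^ α) * holderNorm P (-α) (W.sq t))
      (max (ENNReal.ofReal (t ^ α) * holderNorm P (-α) (W.absSq t))
        (ENNReal.ofReal (t ^ α) * holderNorm P (-α) (W.cub t))))

/-- The set of driving data: for every `α > 0`, the first path is in `C([0,∞); 𝒞^{-α})`, the other
three are in `C((0,∞); 𝒞^{-α})`, and the weighted norm is bounded on every `(0, T]`. -/
def drivers (P : DyadicPartition) : Set Quadruple :=
  {W | ∀ α : ℝ, 0 < α →
    ContinuousInto P (-α) (Set.Ici 0) W.Z ∧
    ContinuousInto P (-α) (Set.Ioi 0) W.sq ∧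
    ContinuousInto P (-α) (Set.Ioi 0) W.absSq ∧
    ContinuousInto P (-α) (Set.Ioi 0) W.cub ∧
    ∀ T : ℝ, 0 < T → (⨆ t ∈ Set.Ioc 0 T, W.norm P α t) < ⊤}

/-- `Ψ(Y, Z) = (1+λ)(Z+Y) - ν(|Y|²Y + 2Z|Y|² + Z̄Y² + 2|Z|²Y + Z²Ȳ + |Z|²Z)` at time `t`. -/
def nonlinearity (ν lam : ℂ) (y : FormalFourierSeries) (W : Quadruple) (t : ℝ) :
    FormalFourierSeries :=
  (1 + lam) • (W.Z t + y) -
    ν • (mul (mul y (conj y)) y + (2 : ℂ) • mul (W.Z t) (mul y (conj y)) +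
      mul (conj (W.Z t)) (mul y y) + (2 : ℂ) • mul (W.absSq t) y +
      mul (W.sq t) (conj y) + W.cub t)

/-- `Y` is a solution over `[0, T]` of `∂_t Y = AY + Ψ(Y, Z)`, `Y(0) = Y₀`. The mild equation is
an identity of distributions on the torus, that is, of all their Fourier coefficients. -/
def IsSolution (P : DyadicPartition) (μ : ℝ) (ν lam : ℂ) (Y₀ : FormalFourierSeries)
    (W : Quadruple) (T : ℝ) (Y : ℝ → FormalFourierSeries) : Prop :=
  (∃ α₁ γ : ℝ, 0 < α₁ ∧ 0 < γ ∧ γ < 1 / 3 ∧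
    ContinuousInto P α₁ (Set.Ioc 0 T) Y ∧
    (⨆ t ∈ Set.Ioc 0 T, ENNReal.ofReal (t ^ γ) * holderNorm P α₁ (Y t)) < ⊤) ∧
  ∀ t ∈ Set.Ioc 0 T, ∀ m : Fin 2 → ℤ,
    IntervalIntegrable (fun s => semigroup μ (t - s) (nonlinearity ν lam (Y s) W s) m)
      MeasureTheory.volume 0 t ∧
    Y t m = semigroup μ t Y₀ m +
      ∫ s in (0 : ℝ)..t, semigroup μ (t - s) (nonlinearity ν lam (Y s) W s) m

/-- The set `S^T(Y₀, Z)` of solutions over `[0, T]`, as functions on `(0, T]`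
(`IsSolution` does not see the values of `Y` outside `(0, T]`). -/
def solutionSet (P : DyadicPartition) (μ : ℝ) (ν lam : ℂ) (Y₀ : FormalFourierSeries)
    (W : Quadruple) (T : ℝ) : Set (Set.Ioc (0 : ℝ) T → FormalFourierSeries) :=
  {y | ∃ Y : ℝ → FormalFourierSeries,
    IsSolution P μ ν lam Y₀ W T Y ∧ ∀ t : Set.Ioc (0 : ℝ) T, Y t = y t}

/-- A concrete low-frequency cut-off: `1` for `‖ξ‖ ≤ 3/4` and `0` for `‖ξ‖ ≥ 4/3`. -/
def lowCutoff (ξ : EuclideanSpace ℝ (Fin 2)) : ℝ :=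
  Real.smoothTransition ((16 / 9 - ‖ξ‖ ^ 2) / (175 / 144))

theorem lowCutoff_eq_one {ξ : EuclideanSpace ℝ (Fin 2)} (h : ‖ξ‖ ≤ 3 / 4) : lowCutoff ξ = 1 := by
  apply Real.smoothTransition.one_of_one_le
  rw [le_div_iff₀ (by norm_num)]
  nlinarith [norm_nonneg ξ]

theorem lowCutoff_eq_zero {ξ : EuclideanSpace ℝ (Fin 2)} (h : 4 / 3 ≤ ‖ξ‖) : lowCutoff ξ = 0 := by
  apply Real.smoothTransition.zero_of_nonpos
  apply div_nonpos_of_nonpos_of_nonneg _ (by norm_num)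
  nlinarith [norm_nonneg ξ]

theorem contDiff_lowCutoff : ContDiff ℝ ∞ lowCutoff := by
  unfold lowCutoff
  apply Real.smoothTransition.contDiff.comp
  exact (contDiff_const.sub (contDiff_norm_sq ℝ)).div_const _

theorem norm_half (ξ : EuclideanSpace ℝ (Fin 2)) : ‖(2 : ℝ)⁻¹ • ξ‖ = ‖ξ‖ / 2 := by
  rw [norm_smul]; norm_num; ring

theorem lowCutoff_le (ξ : EuclideanSpace ℝ (Fin 2)) :
    lowCutoff ξ ≤ lowCutoff ((2 : ℝ)⁻¹ • ξ) := by
  apply Real.smoothTransition.monotone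
  rw [norm_half]
  gcongr
  linarith [norm_nonneg ξ]

/-- Dyadic partitions of unity exist. -/
theorem nonempty_dyadicPartition : Nonempty DyadicPartition := by
  refine ⟨{ low := lowCutoff
            high := fun ξ => lowCutoff ((2 : ℝ)⁻¹ • ξ) - lowCutoff ξ
            contDiff_low := contDiff_lowCutoff
            contDiff_high := ?_
            low_mem := fun ξ => ⟨Real.smoothTransition.nonneg _, Real.smoothTransition.le_one _⟩
            high_mem := fun ξ => ⟨sub_nonneg.2 (lowCutoff_le ξ), ?_⟩
            low_radial := fun ξ η h => by simp only [lowCutoff, h]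
            high_radial := fun ξ η h => by simp only [lowCutoff, norm_half, h]
            low_support := ?_
            high_support := ?_
            hasSum_high := ?_ }⟩
  · exact (contDiff_lowCutoff.comp (contDiff_const_smul _)).sub contDiff_lowCutoff
  · have h1 : lowCutoff ((2 : ℝ)⁻¹ • ξ) ≤ 1 := Real.smoothTransition.le_one _
    have h2 : 0 ≤ lowCutoff ξ := Real.smoothTransition.nonneg _
    linarith
  · intro ξ h
    by_contra hc
    exact h (lowCutoff_eq_zero (not_le.1 hc).le)
  · intro ξ h
    constructor
    · by_contra hc
      apply h
      rw [lowCutoff_eq_one (not_le.1 hc).le, lowCutoff_eq_one, sub_self]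
      rw [norm_half]; linarith [norm_nonneg ξ]
    · by_contra hc
      apply h
      rw [lowCutoff_eq_zero, lowCutoff_eq_zero, sub_self]
      · linarith
      · rw [norm_half]; linarith
  · intro ξ
    rw [hasSum_iff_tendsto_nat_of_nonneg (fun k => sub_nonneg.2 (lowCutoff_le _))]
    have hs : ∀ n : ℕ, ∑ k ∈ Finset.range n,
        (lowCutoff ((2 : ℝ)⁻¹ • ((2 : ℝ) ^ k)⁻¹ • ξ) - lowCutoff (((2 : ℝ) ^ k)⁻¹ • ξ)) =
        lowCutoff (((2 : ℝ) ^ n)⁻¹ • ξ) - lowCutoff ξ := by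
      intro n
      have h := Finset.sum_range_sub (fun k : ℕ => lowCutoff (((2 : ℝ) ^ k)⁻¹ • ξ)) n
      simp only [pow_zero, inv_one, one_smul] at h
      rw [← h]
      refine Finset.sum_congr rfl fun k _ => ?_
      rw [smul_smul, pow_succ, mul_inv, mul_comm]
    simp only [hs]
    refine Filter.Tendsto.sub_const ?_ _
    have hlim : Filter.Tendsto (fun n : ℕ => ‖((2 : ℝ) ^ n)⁻¹ • ξ‖) Filter.atTop (𝓝 0) := by
      have h := (tendsto_pow_atTop_nhds_zero_of_lt_one (r := (2 : ℝ)⁻¹)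
        (by norm_num) (by norm_num)).mul_const ‖ξ‖
      rw [zero_mul] at h
      refine h.congr fun n => ?_
      rw [norm_smul, norm_inv, norm_pow, Real.norm_ofNat, inv_pow]
    refine tendsto_const_nhds.congr' ?_
    filter_upwards [hlim.eventually_le_const (show (0 : ℝ) < 3 / 4 by norm_num)] with n hn
    rw [lowCutoff_eq_one hn]

end CGL

end

/-! The remainder equation is solved in the class of paths with norm at most `R t^{-g}` in `𝒞^a`,
where `a > 0` is small and `g = (α₀ + a)/2`. Three facts fix this choice. The semigroup carries
`𝒞^{-α₀}` into `𝒞^a` at the price `t^{-g}`. Since `α₀ < 2/3`, there is room for `3g < 1`, so a cubic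
expression in `t^{-g}` is integrable at zero. If the driving data are measured in `𝒞^{-a/8}`, their
weight `t^{-a/8}` is at most `t^{-2g}`, so a datum of degree `k` is bounded by `(R t^{-g})^k`, and
`Ψ` is of size `R³ t^{-3g}` in `𝒞^{-a/4}`.

Returning from `𝒞^{-a/4}` to `𝒞^a` costs `(t-s)^{-5a/8}` in the Duhamel integral. With `a ≤ 1/3` and
`g < 1/3` one has `1 - 5a/8 - 2g ≥ 1/8`, so the integral is at most a constant times `R³ T^{1/8}
t^{-g}`, and its Lipschitz constant is of order `R² T^{1/8}`. With `R` proportional to `K`, both are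
small enough once `T` is a small multiple of `K^{-16}`, and Picard iteration gives a solution
(`exists_mildMap_bounds`, `exists_fixedPoint_of_halving`).

Uniqueness cannot use this contraction, because a competing solution brings its own exponents and an
uncontrolled norm. Two solutions are placed in a common class with some large `R`, and their
difference is measured with the extra weight `e^{-λt}`; a large `λ` replaces the smallness of `T`
(`eqOn_of_mild`).

The harmonic analysis rests on two estimates. Kernels of localised heat multipliers are bounded in
`L¹` through second differences of their symbols (`integral_norm_trig_le`), which yields smoothing
by the semigroup. Products are expanded into blocks; only resonant triples of dyadic indices
contribute, and a majorant of product form sums them at the price of a little regularity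
(`exists_norm_block_mul_le`). -/

noncomputable section

namespace CGL

open MeasureTheory UnitAddTorus

/-! ### Trigonometric polynomials -/

/-- The function on the torus with Fourier coefficients `f`. -/
def trig (f : FormalFourierSeries) (x : UnitAddTorus (Fin 2)) : ℂ :=
  ∑' m : Fin 2 → ℤ, f m * mFourier m x

theorem trig_eq_sum {f : FormalFourierSeries} {s : Finset (Fin 2 → ℤ)}
    (hs : ∀ m, f m ≠ 0 → m ∈ s) (x : UnitAddTorus (Fin 2)) :
    trig f x = ∑ m ∈ s, f m * mFourier m x := by
  refine tsum_eq_sum fun m hm => ?_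
  rw [not_imp_comm.1 (hs m) hm, zero_mul]

theorem mem_toFinset_support {f : FormalFourierSeries} (hf : f.support.Finite) (m : Fin 2 → ℤ)
    (hm : f m ≠ 0) : m ∈ hf.toFinset := by
  simpa using hm

theorem norm_mFourier_apply (m : Fin 2 → ℤ) (x : UnitAddTorus (Fin 2)) : ‖mFourier m x‖ = 1 := by
  simp [mFourier, fourier_apply, -Fin.prod_univ_two, norm_prod, Circle.norm_coe]

theorem mFourier_add_apply (m : Fin 2 → ℤ) (x y : UnitAddTorus (Fin 2)) :
    mFourier m (x + y) = mFourier m x * mFourier m y := by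
  simp [mFourier, fourier_apply, smul_add, AddCircle.toCircle_add]
  ring

theorem mFourier_neg_apply (m : Fin 2 → ℤ) (x : UnitAddTorus (Fin 2)) :
    mFourier m (-x) = mFourier (-m) x := by
  simp [mFourier, fourier_apply, AddCircle.toCircle_neg, mul_comm]

theorem continuous_trig {f : FormalFourierSeries} (hf : f.support.Finite) :
    Continuous (trig f) := by
  rw [funext (trig_eq_sum (mem_toFinset_support hf))]
  fun_prop

theorem integral_fourier (n : ℤ) :
    ∫ x : UnitAddCircle, (fourier n x : ℂ) = if n = 0 then 1 else 0 := by
  have h := fourierCoeff_fourier (T := 1) n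
  have h2 := congrFun h 0
  simp only [fourierCoeff, neg_zero, fourier_zero, one_smul] at h2
  rw [AddCircle.integral_haarAddCircle] at h2
  simp only [inv_one, one_smul] at h2
  rw [h2, Pi.single_apply]
  simp [eq_comm]

theorem integral_mFourier (m : Fin 2 → ℤ) :
    ∫ x : UnitAddTorus (Fin 2), mFourier m x = if m = 0 then 1 else 0 := by
  simp only [mFourier, ContinuousMap.coe_mk]
  rw [integral_fintype_prod_volume_eq_prod (fun i => fun x : UnitAddCircle => fourier (m i) x)]
  simp only [integral_fourier, Fin.prod_univ_two]
  by_cases h : m = 0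
  · simp [h]
  · have : ¬ (m 0 = 0 ∧ m 1 = 0) := by
      rintro ⟨h0, h1⟩
      exact h (by ext i; fin_cases i <;> simp [h0, h1])
    rw [if_neg h]
    by_cases h0 : m 0 = 0
    · rw [if_neg (fun h1 => this ⟨h0, h1⟩), mul_zero]
    · rw [if_neg h0, zero_mul]

theorem integral_mFourier_mul_conj (m n : Fin 2 → ℤ) :
    ∫ x : UnitAddTorus (Fin 2), mFourier m x * starRingEnd ℂ (mFourier n x) =
      if m = n then 1 else 0 := by
  simp only [← mFourier_neg, ← mFourier_add, integral_mFourier, ← sub_eq_add_neg, sub_eq_zero]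

theorem integrable_of_continuous {E : Type*} [NormedAddCommGroup E] {F : UnitAddTorus (Fin 2) → E}
    (hF : Continuous F) : Integrable F :=
  hF.integrable_of_hasCompactSupport (HasCompactSupport.of_compactSpace F)

theorem integral_normSq_trig {f : FormalFourierSeries} {s : Finset (Fin 2 → ℤ)}
    (hs : ∀ m, f m ≠ 0 → m ∈ s) :
    ∫ x, ‖trig f x‖ ^ 2 = ∑ m ∈ s, ‖f m‖ ^ 2 := by
  have h : ∀ x, ((‖trig f x‖ ^ 2 : ℝ) : ℂ) = ∑ m ∈ s, ∑ n ∈ s,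
      (f m * starRingEnd ℂ (f n)) * (mFourier m x * starRingEnd ℂ (mFourier n x)) := by
    intro x
    rw [Complex.ofReal_pow, ← Complex.mul_conj', trig_eq_sum hs, map_sum, Finset.sum_mul_sum]
    refine Finset.sum_congr rfl fun m _ => Finset.sum_congr rfl fun n _ => ?_
    rw [map_mul]; ring
  apply Complex.ofReal_injective
  rw [← integral_complex_ofReal]
  simp only [h]
  have hint : ∀ m n : Fin 2 → ℤ, Integrable (fun x : UnitAddTorus (Fin 2) =>
      (f m * starRingEnd ℂ (f n)) * (mFourier m x * starRingEnd ℂ (mFourier n x))) := fun m n =>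
    integrable_of_continuous (by fun_prop)
  rw [integral_finsetSum _ fun m _ => integrable_finsetSum _ fun n _ => hint m n]
  simp only [Complex.ofReal_sum]
  refine Finset.sum_congr rfl fun m hm => ?_
  rw [integral_finsetSum _ fun n _ => hint m n]
  simp only [integral_const_mul, integral_mFourier_mul_conj]
  simp [hm, Complex.mul_conj']

theorem sum_normSq_le_of_norm_trig_le {f : FormalFourierSeries} {s : Finset (Fin 2 → ℤ)}
    (hs : ∀ m, f m ≠ 0 → m ∈ s) {M : ℝ} (hM : ∀ x, ‖trig f x‖ ≤ M) :
    ∑ m ∈ s, ‖f m‖ ^ 2 ≤ M ^ 2 := by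
  rw [← integral_normSq_trig hs]
  have hc : Continuous (trig f) := continuous_trig (s.finite_toSet.subset fun m hm => hs m hm)
  calc ∫ x, ‖trig f x‖ ^ 2 ≤ ∫ _ : UnitAddTorus (Fin 2), M ^ 2 :=
        integral_mono (integrable_of_continuous (by fun_prop))
          (integrable_of_continuous (by fun_prop))
          fun x => pow_le_pow_left₀ (norm_nonneg _) (hM x) 2
    _ = M ^ 2 := by simp [volume_pi, measureReal_def, Measure.pi_univ]

theorem norm_coeff_le_of_norm_trig_le {f : FormalFourierSeries} (hf : f.support.Finite) {M : ℝ}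
    (hM : ∀ x, ‖trig f x‖ ≤ M) (m : Fin 2 → ℤ) : ‖f m‖ ≤ M := by
  have hM0 : 0 ≤ M := (norm_nonneg _).trans (hM 0)
  by_cases hm : f m = 0
  · simpa [hm] using hM0
  have h := sum_normSq_le_of_norm_trig_le (mem_toFinset_support hf) hM
  have h1 := Finset.single_le_sum (f := fun m => ‖f m‖ ^ 2) (fun _ _ => sq_nonneg _)
    (mem_toFinset_support hf m hm)
  exact le_of_sq_le_sq (h1.trans h) hM0

theorem trig_mul_coeff {a f : FormalFourierSeries} (ha : a.support.Finite) (hf : f.support.Finite)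
    (x : UnitAddTorus (Fin 2)) :
    trig (fun m => a m * f m) x = ∫ y, trig a y * trig f (x - y) := by
  set s := ha.toFinset ∪ hf.toFinset with hs
  have h1 : ∀ m, a m ≠ 0 → m ∈ s := fun m hm =>
    Finset.mem_union_left _ (mem_toFinset_support ha m hm)
  have h2 : ∀ m, f m ≠ 0 → m ∈ s := fun m hm =>
    Finset.mem_union_right _ (mem_toFinset_support hf m hm)
  have h : ∀ y, trig a y * trig f (x - y) = ∑ m ∈ s, ∑ n ∈ s,
      (a m * f n * mFourier n x) * (mFourier m y * starRingEnd ℂ (mFourier n y)) := by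
    intro y
    rw [trig_eq_sum h1, trig_eq_sum h2, Finset.sum_mul_sum]
    refine Finset.sum_congr rfl fun m _ => Finset.sum_congr rfl fun n _ => ?_
    rw [sub_eq_add_neg, mFourier_add_apply, mFourier_neg_apply, mFourier_neg]; ring
  simp only [h]
  have hint : ∀ m n : Fin 2 → ℤ, Integrable (fun y : UnitAddTorus (Fin 2) =>
      (a m * f n * mFourier n x) * (mFourier m y * starRingEnd ℂ (mFourier n y))) := fun m n =>
    integrable_of_continuous (by fun_prop)
  rw [integral_finsetSum _ fun m _ => integrable_finsetSum _ fun n _ => hint m n,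
    trig_eq_sum (fun m hm => h1 m (left_ne_zero_of_mul hm))]
  refine Finset.sum_congr rfl fun m hm => ?_
  rw [integral_finsetSum _ fun n _ => hint m n]
  simp only [integral_const_mul, integral_mFourier_mul_conj]
  simp [hm]

/-- Young's inequality `L¹ * L^∞ ⊆ L^∞`: a Fourier multiplier is a convolution with its kernel. -/
theorem norm_trig_mul_coeff_le {a f : FormalFourierSeries} (ha : a.support.Finite)
    (hf : f.support.Finite) {A M : ℝ} (hA : ∫ y, ‖trig a y‖ ≤ A) (hM : ∀ x, ‖trig f x‖ ≤ M)
    (x : UnitAddTorus (Fin 2)) : ‖trig (fun m => a m * f m) x‖ ≤ A * M := by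
  have hM0 : 0 ≤ M := (norm_nonneg _).trans (hM 0)
  have hca := continuous_trig ha
  rw [trig_mul_coeff ha hf]
  calc ‖∫ y, trig a y * trig f (x - y)‖ ≤ ∫ y, ‖trig a y‖ * M := by
        refine norm_integral_le_of_norm_le (integrable_of_continuous (by fun_prop))
          (Filter.Eventually.of_forall fun y => ?_)
        rw [norm_mul]
        gcongr
        exact hM _
    _ = (∫ y, ‖trig a y‖) * M := integral_mul_const _ _
    _ ≤ A * M := by gcongr

theorem support_mul_coeff_finite {a : FormalFourierSeries} (ha : a.support.Finite)
    (f : FormalFourierSeries) : (Function.support fun m => a m * f m).Finite :=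
  ha.subset fun _ hm => left_ne_zero_of_mul hm

theorem mul_eq_sum {f : FormalFourierSeries} (hf : f.support.Finite) (g : FormalFourierSeries)
    (m : Fin 2 → ℤ) : mul f g m = ∑ l ∈ hf.toFinset, f l * g (m - l) := by
  refine tsum_eq_sum fun l hl => ?_
  rw [not_imp_comm.1 (mem_toFinset_support hf l) hl, zero_mul]

theorem support_mul_finite {f g : FormalFourierSeries} (hf : f.support.Finite)
    (hg : g.support.Finite) : (mul f g).support.Finite := by
  refine (Set.Finite.image2 (· + ·) hf hg).subset fun m hm => ?_
  rw [Function.mem_support, mul_eq_sum hf] at hm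
  obtain ⟨l, -, hl⟩ := Finset.exists_ne_zero_of_sum_ne_zero hm
  exact ⟨l, left_ne_zero_of_mul hl, m - l, right_ne_zero_of_mul hl, by simp⟩

theorem trig_mul {f g : FormalFourierSeries} (hf : f.support.Finite) (hg : g.support.Finite)
    (x : UnitAddTorus (Fin 2)) : trig (mul f g) x = trig f x * trig g x := by
  classical
  rw [trig_eq_sum (mem_toFinset_support hf), trig_eq_sum (mem_toFinset_support hg),
    Finset.sum_mul_sum]
  set s := hf.toFinset
  set u := Finset.image₂ (· + ·) hf.toFinset hg.toFinset
  have hu : ∀ m, mul f g m ≠ 0 → m ∈ u := by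
    intro m hm
    rw [mul_eq_sum hf] at hm
    obtain ⟨l, hl', hl⟩ := Finset.exists_ne_zero_of_sum_ne_zero hm
    exact Finset.mem_image₂.2 ⟨l, hl', m - l,
      mem_toFinset_support hg _ (right_ne_zero_of_mul hl), by simp⟩
  rw [trig_eq_sum hu]
  simp only [mul_eq_sum hf, Finset.sum_mul]
  rw [Finset.sum_comm]
  refine Finset.sum_congr rfl fun l hl => ?_
  symm
  refine Finset.sum_of_injOn (fun n => l + n) (fun a _ b _ h => add_left_cancel h) ?_ ?_ ?_
  · intro n hn
    exact Finset.mem_coe.2 (Finset.mem_image₂.2 ⟨l, hl, n, hn, rfl⟩)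
  · intro m _ hm
    have : g (m - l) = 0 := by
      by_contra hne
      exact hm ⟨m - l, mem_toFinset_support hg _ hne, by simp⟩
    rw [this, mul_zero, zero_mul]
  · intro n _
    rw [mFourier_add, add_sub_cancel_left]
    ring

theorem trig_add {f g : FormalFourierSeries} (hf : f.support.Finite) (hg : g.support.Finite)
    (x : UnitAddTorus (Fin 2)) : trig (fun m => f m + g m) x = trig f x + trig g x := by
  classical
  have h1 : ∀ m, f m ≠ 0 → m ∈ hf.toFinset ∪ hg.toFinset := fun m hm =>
    Finset.mem_union_left _ (mem_toFinset_support hf m hm)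
  have h2 : ∀ m, g m ≠ 0 → m ∈ hf.toFinset ∪ hg.toFinset := fun m hm =>
    Finset.mem_union_right _ (mem_toFinset_support hg m hm)
  rw [trig_eq_sum h1, trig_eq_sum h2, trig_eq_sum (s := hf.toFinset ∪ hg.toFinset),
    ← Finset.sum_add_distrib]
  · exact Finset.sum_congr rfl fun m _ => add_mul _ _ _
  · intro m hm
    by_cases h : f m = 0
    · exact h2 m (by simpa [h] using hm)
    · exact h1 m h

theorem trig_finsetSum {ι : Type*} (s : Finset ι) (f : ι → FormalFourierSeries)
    (hf : ∀ i ∈ s, (f i).support.Finite) (x : UnitAddTorus (Fin 2)) :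
    trig (fun m => ∑ i ∈ s, f i m) x = ∑ i ∈ s, trig (f i) x := by
  have hfin : ∀ i ∈ s, Summable fun m => f i m * mFourier m x := fun i hi =>
    summable_of_hasFiniteSupport ((hf i hi).subset fun m hm => left_ne_zero_of_mul hm)
  simp only [trig, Finset.sum_mul]
  exact Summable.tsum_finsetSum hfin

theorem trig_const_mul (c : ℂ) (f : FormalFourierSeries) (x : UnitAddTorus (Fin 2)) :
    trig (fun m => c * f m) x = c * trig f x := by
  simp only [trig, mul_assoc, tsum_mul_left]

theorem trig_conj (f : FormalFourierSeries) (x : UnitAddTorus (Fin 2)) :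
    trig (conj f) x = starRingEnd ℂ (trig f x) := by
  rw [trig, trig, Complex.conj_tsum, ← (Equiv.neg (Fin 2 → ℤ)).tsum_eq]
  refine tsum_congr fun m => ?_
  simp [conj, mFourier_neg]

/-! ### An `L¹` bound for kernels with regular symbols -/

/-- The chord has length `2 |sin πx|`, and Jordan's inequality bounds the sine from below. -/
theorem four_mul_abs_le_norm_fourier_sub_one {x : ℝ} (hx : |x| ≤ 1 / 2) :
    4 * |x| ≤ ‖(fourier 1 (x : UnitAddCircle) : ℂ) - 1‖ := by
  have h : (fourier 1 (x : UnitAddCircle) : ℂ) =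
      Complex.exp (Complex.I * ((2 * Real.pi * x : ℝ) : ℂ)) := by
    rw [fourier_coe_apply]; congr 1; push_cast; ring
  rw [h, Complex.norm_exp_I_mul_ofReal_sub_one, norm_mul, Real.norm_eq_abs, Real.norm_eq_abs]
  have hpi := Real.pi_pos
  have h2 := Real.mul_abs_le_abs_sin (x := Real.pi * x) (by
    rw [abs_mul, abs_of_pos hpi]; nlinarith)
  rw [abs_mul, abs_of_pos hpi] at h2
  have h3 : 2 / Real.pi * (Real.pi * |x|) = 2 * |x| := by field_simp
  rw [show 2 * Real.pi * x / 2 = Real.pi * x by ring, abs_two]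
  linarith

theorem integral_inv_one_add_normSq_le {N : ℝ} (hN : 0 < N) :
    ∫ x : UnitAddCircle, (1 + N ^ 2 * ‖(fourier 1 x : ℂ) - 1‖ ^ 2)⁻¹ ≤ 1 / N := by
  rw [← UnitAddCircle.integral_preimage (-(1 / 2))]
  have hint : Integrable fun x : ℝ => (1 + (4 * N * x) ^ 2)⁻¹ :=
    integrable_inv_one_add_sq.comp_mul_left' (by positivity)
  calc ∫ x in Set.Ioc (-(1 / 2) : ℝ) (-(1 / 2) + 1),
          (1 + N ^ 2 * ‖(fourier 1 (x : UnitAddCircle) : ℂ) - 1‖ ^ 2)⁻¹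
      ≤ ∫ x in Set.Ioc (-(1 / 2) : ℝ) (-(1 / 2) + 1), (1 + (4 * N * x) ^ 2)⁻¹ := by
        refine integral_mono_of_nonneg (Filter.Eventually.of_forall fun x => by positivity)
          hint.integrableOn ?_
        filter_upwards [ae_restrict_mem measurableSet_Ioc] with x hx
        have h := four_mul_abs_le_norm_fourier_sub_one (x := x)
          (abs_le.2 ⟨hx.1.le, by linarith [hx.2]⟩)
        have h2 : (4 * N * x) ^ 2 = N ^ 2 * (4 * |x|) ^ 2 := by
          rw [mul_pow, mul_pow, mul_pow, sq_abs]; ring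
        rw [h2]
        gcongr
    _ ≤ ∫ x : ℝ, (1 + (4 * N * x) ^ 2)⁻¹ :=
        setIntegral_le_integral hint (Filter.Eventually.of_forall fun x => by positivity)
    _ = (4 * N)⁻¹ * Real.pi := by
        rw [Measure.integral_comp_mul_left (fun x : ℝ => (1 + x ^ 2)⁻¹),
          integral_univ_inv_one_add_sq, abs_of_pos (by positivity), smul_eq_mul]
    _ ≤ 1 / N := by
        rw [mul_inv, mul_right_comm, one_div]
        have := Real.pi_le_four
        have h3 : 0 < N⁻¹ := by positivity
        nlinarith

/-- A weight on the torus comparable to `1 + N² |x|²`. -/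
def kernelWeight (N : ℝ) (x : UnitAddTorus (Fin 2)) : ℝ :=
  1 + N ^ 2 * ∑ i, ‖(fourier 1 (x i) : ℂ) - 1‖ ^ 2

theorem one_le_kernelWeight (N : ℝ) (x : UnitAddTorus (Fin 2)) : 1 ≤ kernelWeight N x :=
  le_add_of_nonneg_right (by positivity)

theorem continuous_kernelWeight (N : ℝ) : Continuous (kernelWeight N) := by
  unfold kernelWeight; fun_prop

/-- The inequality `(1 + A + B)² ≥ (1 + A)(1 + B)` splits the weight into one-dimensional factors.
-/
theorem integral_inv_kernelWeight_sq_le {N : ℝ} (hN : 0 < N) :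
    ∫ x, (kernelWeight N x ^ 2)⁻¹ ≤ 1 / N ^ 2 := by
  calc ∫ x, (kernelWeight N x ^ 2)⁻¹
      ≤ ∫ x : UnitAddTorus (Fin 2), ∏ i, (1 + N ^ 2 * ‖(fourier 1 (x i) : ℂ) - 1‖ ^ 2)⁻¹ := by
        refine integral_mono (integrable_of_continuous ?_) (integrable_of_continuous ?_) fun x => ?_
        · exact ((continuous_kernelWeight N).pow 2).inv₀ fun x =>
            (pow_pos (one_pos.trans_le (one_le_kernelWeight N x)) 2).ne'
        · refine continuous_finsetProd _ fun i _ => Continuous.inv₀ (by fun_prop) fun x => ?_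
          positivity
        · simp only [Fin.prod_univ_two, kernelWeight, Fin.sum_univ_two, ← mul_inv]
          gcongr
          set A := ‖(fourier 1 (x 0) : ℂ) - 1‖ ^ 2
          set B := ‖(fourier 1 (x 1) : ℂ) - 1‖ ^ 2
          have hA : 0 ≤ N ^ 2 * A := by positivity
          have hB : 0 ≤ N ^ 2 * B := by positivity
          nlinarith
    _ = ∏ _i : Fin 2, ∫ x : UnitAddCircle, (1 + N ^ 2 * ‖(fourier 1 x : ℂ) - 1‖ ^ 2)⁻¹ :=
        integral_fintype_prod_volume_eq_prod
          (fun _ : Fin 2 => fun x : UnitAddCircle => (1 + N ^ 2 * ‖(fourier 1 x : ℂ) - 1‖ ^ 2)⁻¹)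
    _ ≤ ∏ _i : Fin 2, 1 / N := by
        refine Finset.prod_le_prod (fun _ _ => integral_nonneg fun x => by positivity) fun _ _ =>
          integral_inv_one_add_normSq_le hN
    _ = 1 / N ^ 2 := by simp [sq]

theorem trig_shift (a : FormalFourierSeries) (l : Fin 2 → ℤ) (x : UnitAddTorus (Fin 2)) :
    trig (fun m => a (m - l)) x = mFourier l x * trig a x := by
  rw [trig, trig, ← tsum_mul_left, ← (Equiv.addRight l).tsum_eq]
  refine tsum_congr fun m => ?_
  simp only [Equiv.coe_addRight, add_sub_cancel_right, mFourier_add]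
  ring

/-- The second difference of `a` in direction `i`, with the opposite sign. -/
def secondDiff (a : FormalFourierSeries) (i : Fin 2) (m : Fin 2 → ℤ) : ℂ :=
  2 * a m - a (m - Pi.single i 1) - a (m - -Pi.single i 1)

theorem support_shift_finite {a : FormalFourierSeries} (ha : a.support.Finite) (l : Fin 2 → ℤ) :
    (Function.support fun m => a (m - l)).Finite :=
  (ha.image (· + l)).subset fun m hm => ⟨m - l, hm, by simp⟩

/-- Shifting the coefficients multiplies the function by a character, and `2 - z - z̄ = |z - 1|²` on
the unit circle. -/
theorem trig_secondDiff {a : FormalFourierSeries} (ha : a.support.Finite) (i : Fin 2)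
    (x : UnitAddTorus (Fin 2)) :
    trig (secondDiff a i) x = (‖(fourier 1 (x i) : ℂ) - 1‖ ^ 2 : ℝ) * trig a x := by
  have h1 := support_shift_finite ha (Pi.single i 1)
  have h2 := support_shift_finite ha (-Pi.single i 1)
  have hsupp : ∀ (c : ℂ) {g : FormalFourierSeries}, g.support.Finite →
      (Function.support fun m => c * g m).Finite := fun c g hg =>
    hg.subset fun _ hm => right_ne_zero_of_mul hm
  have hz : ‖(fourier 1 (x i) : ℂ)‖ = 1 := by simp [fourier_apply, Circle.norm_coe]
  have hd : secondDiff a i = fun m => 2 * a m +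
      ((-1) * a (m - Pi.single i 1) + (-1) * a (m - -Pi.single i 1)) := by
    ext m; rw [secondDiff]; ring
  rw [hd, trig_add (hsupp _ ha)
    (((hsupp (-1) h1).union (hsupp (-1) h2)).subset fun m hm => ?_),
    trig_add (hsupp _ h1) (hsupp _ h2), trig_const_mul, trig_const_mul, trig_const_mul,
    trig_shift, trig_shift, mFourier_neg, mFourier_single]
  · set z : ℂ := fourier 1 (x i)
    have h3 : z * starRingEnd ℂ z = 1 := by rw [Complex.mul_conj', hz]; simp
    rw [Complex.ofReal_pow, ← Complex.mul_conj', map_sub, map_one]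
    linear_combination (-trig a x) * h3
  · by_contra hc
    simp only [Set.mem_union, Function.mem_support, not_or, not_not] at hc
    exact hm (by simp only [hc.1, hc.2, add_zero])

/-- Bernstein's argument: the kernel times `kernelWeight N` has coefficients `b`, bounded by `3M` on
a box of at most `81 N²` points, so Parseval controls it in `L²`. The inverse weight has `L²` norm
at most `1/N`. Cauchy-Schwarz makes the powers of `N` cancel. -/
theorem integral_norm_trig_le {a : FormalFourierSeries} {N : ℕ} {M : ℝ} (hN : 1 ≤ N) (hM : 0 < M)
    (hsupp : ∀ m, a m ≠ 0 → ∀ i, |m i| ≤ 3 * N) (ha : ∀ m, ‖a m‖ ≤ M)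
    (hdiff : ∀ m i, ‖secondDiff a i m‖ ≤ M / N ^ 2) :
    ∫ x, ‖trig a x‖ ≤ 365 * M := by
  have hN' : (1 : ℝ) ≤ N := by exact_mod_cast hN
  have hN0 : (0 : ℝ) < N := by linarith
  set box : Finset (Fin 2 → ℤ) := Finset.Icc (fun _ => -(4 * N : ℤ)) (fun _ => (4 * N : ℤ))
    with hbox
  have hmem : ∀ m : Fin 2 → ℤ, (∀ i, |m i| ≤ 3 * N + 1) → m ∈ box := by
    intro m hm
    rw [hbox, Finset.mem_Icc]
    constructor <;> intro i <;> have := abs_le.1 (hm i)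
    · simp only; omega
    · simp only; omega
  have hfin : a.support.Finite := box.finite_toSet.subset fun m hm =>
    hmem m fun i => (hsupp m hm i).trans (by omega)
  set b : FormalFourierSeries := fun m => a m + (N : ℂ) ^ 2 * ∑ i, secondDiff a i m with hb
  have hnear : ∀ (m l : Fin 2 → ℤ), (∀ i, |l i| ≤ 1) → a (m - l) ≠ 0 → m ∈ box := by
    intro m l hl hm
    refine hmem m fun i => ?_
    have h1 := abs_le.1 (hsupp _ hm i)
    have h2 := abs_le.1 (hl i)
    simp only [Pi.sub_apply] at h1
    rw [abs_le]; omega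
  have hsingle : ∀ i k : Fin 2, |(Pi.single i 1 : Fin 2 → ℤ) k| ≤ 1 := by
    intro i k; by_cases h : k = i <;> simp [h]
  have hd : ∀ i m, secondDiff a i m ≠ 0 → m ∈ box := by
    intro i m hm
    by_contra hc
    have h0 : a m = 0 := by
      by_contra h; exact hc (hnear m 0 (by simp) (by simpa using h))
    have h1 : a (m - Pi.single i 1) = 0 := by
      by_contra h; exact hc (hnear m _ (hsingle i) h)
    have h2 : a (m - -Pi.single i 1) = 0 := by
      by_contra h; exact hc (hnear m _ (fun k => by simpa using hsingle i k) h)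
    exact hm (by rw [secondDiff, h0, h1, h2]; simp)
  have hdfin : ∀ i, (secondDiff a i).support.Finite := fun i =>
    box.finite_toSet.subset fun m hm => hd i m hm
  have hbs : ∀ m, b m ≠ 0 → m ∈ box := by
    intro m hm
    by_contra hc
    have h0 : a m = 0 := by
      by_contra h; exact hc (hnear m 0 (by simp) (by simpa using h))
    have h1 : ∀ i, secondDiff a i m = 0 := fun i => by
      by_contra h; exact hc (hd i m h)
    exact hm (by simp [hb, h0, h1])
  have htb : ∀ x, trig b x = kernelWeight N x * trig a x := by
    intro x
    rw [hb, trig_add hfin, trig_const_mul, trig_finsetSum _ _ fun i _ => hdfin i]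
    · simp only [trig_secondDiff hfin, kernelWeight]
      push_cast
      rw [← Finset.sum_mul]
      ring
    · refine box.finite_toSet.subset fun m hm => ?_
      obtain ⟨i, -, hi⟩ := Finset.exists_ne_zero_of_sum_ne_zero (right_ne_zero_of_mul hm)
      exact hd i m hi
  have hbM : ∀ m, ‖b m‖ ≤ 3 * M := by
    intro m
    have h1 : ‖∑ i, secondDiff a i m‖ ≤ 2 * (M / N ^ 2) := by
      rw [Fin.sum_univ_two]
      exact (norm_add_le _ _).trans (by linarith [hdiff m 0, hdiff m 1])
    calc ‖b m‖ ≤ ‖a m‖ + (N : ℝ) ^ 2 * ‖∑ i, secondDiff a i m‖ := by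
          refine (norm_add_le _ _).trans_eq ?_
          rw [norm_mul, norm_pow, Complex.norm_natCast]
      _ ≤ M + (N : ℝ) ^ 2 * (2 * (M / N ^ 2)) := by gcongr; exact ha m
      _ = 3 * M := by field_simp; ring
  have hcard : (box.card : ℝ) ≤ 81 * (N : ℝ) ^ 2 := by
    have h1 : box.card = (8 * N + 1) ^ 2 := by
      rw [hbox, Pi.card_Icc]
      simp only [Int.card_Icc, Fin.prod_univ_two, sq]
      congr 1 <;> omega
    have h2 : (8 * N + 1) ^ 2 ≤ 81 * N ^ 2 := by nlinarith
    rw [h1]; exact_mod_cast h2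
  have hL2 : ∫ x, ‖trig b x‖ ^ 2 ≤ 729 * M ^ 2 * (N : ℝ) ^ 2 := by
    rw [integral_normSq_trig hbs]
    calc ∑ m ∈ box, ‖b m‖ ^ 2 ≤ ∑ _m ∈ box, (3 * M) ^ 2 := by
          gcongr with m _; exact hbM m
      _ = box.card * (3 * M) ^ 2 := by rw [Finset.sum_const, nsmul_eq_mul]
      _ ≤ 81 * (N : ℝ) ^ 2 * (3 * M) ^ 2 := by gcongr
      _ = 729 * M ^ 2 * (N : ℝ) ^ 2 := by ring
  have hw0 : ∀ x, 0 < kernelWeight N x := fun x => one_pos.trans_le (one_le_kernelWeight N x)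
  have hcb : Continuous (trig b) := continuous_trig (box.finite_toSet.subset fun m hm => hbs m hm)
  have hcw : Continuous fun x => (kernelWeight N x ^ 2)⁻¹ :=
    ((continuous_kernelWeight N).pow 2).inv₀ fun x => (pow_pos (hw0 x) 2).ne'
  -- Cauchy-Schwarz is used as `k ≤ ρ/2 (wk)² + 1/(2ρw²)`; this `ρ` turns the two terms into
  -- `729M/2` and `M/2`.
  set ρ : ℝ := 1 / (M * (N : ℝ) ^ 2) with hρ
  have hρ0 : 0 < ρ := by positivity
  calc ∫ x, ‖trig a x‖
      ≤ ∫ x, (ρ / 2 * ‖trig b x‖ ^ 2 + 1 / (2 * ρ) * (kernelWeight N x ^ 2)⁻¹) := by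
        refine integral_mono (integrable_of_continuous (continuous_trig hfin).norm)
          (integrable_of_continuous (by fun_prop)) fun x => ?_
        simp only
        rw [htb, norm_mul, Complex.norm_real, Real.norm_of_nonneg (hw0 x).le]
        have hw := hw0 x
        set w := kernelWeight N x
        set k := ‖trig a x‖
        have key : ρ / 2 * (w * k) ^ 2 + 1 / (2 * ρ) * (w ^ 2)⁻¹ - k =
            (ρ * w * (w * k) - 1) ^ 2 / (2 * ρ * w ^ 2) := by field_simp; ring
        have : 0 ≤ (ρ * w * (w * k) - 1) ^ 2 / (2 * ρ * w ^ 2) := by positivity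
        linarith
    _ = ρ / 2 * (∫ x, ‖trig b x‖ ^ 2) + 1 / (2 * ρ) * ∫ x, (kernelWeight N x ^ 2)⁻¹ := by
        rw [integral_add (integrable_of_continuous (by fun_prop))
          (integrable_of_continuous (by fun_prop)), integral_const_mul, integral_const_mul]
    _ ≤ ρ / 2 * (729 * M ^ 2 * (N : ℝ) ^ 2) + 1 / (2 * ρ) * (1 / (N : ℝ) ^ 2) := by
        gcongr; exact integral_inv_kernelWeight_sq_le hN0
    _ = 365 * M := by rw [hρ]; field_simp; ring

/-! ### The symbols of the localised semigroup -/

/-- The mean value inequality is applied twice, the second time to `φ(s) + φ(-s)`, whose derivative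
is at most `2M|s|`. Twice the optimal constant is harmless. -/
theorem norm_second_difference_le {φ φ' φ'' : ℝ → ℂ} {M : ℝ} (h1 : ∀ s, HasDerivAt φ (φ' s) s)
    (h2 : ∀ s, HasDerivAt φ' (φ'' s) s) (hM : ∀ s, ‖φ'' s‖ ≤ M) (h : ℝ) :
    ‖2 * φ 0 - φ (-h) - φ h‖ ≤ 2 * M * h ^ 2 := by
  have hd : ∀ s, HasDerivAt (fun s => φ s + φ (-s)) (φ' s - φ' (-s)) s := by
    intro s
    have := (h1 s).add ((h1 (-s)).scomp s (hasDerivAt_neg s))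
    simpa [sub_eq_add_neg] using! this
  have hL : ∀ s r, ‖φ' s - φ' r‖ ≤ M * ‖s - r‖ := fun s r =>
    Convex.norm_image_sub_le_of_norm_hasDerivWithin_le (s := Set.univ)
      (fun x _ => (h2 x).hasDerivWithinAt) (fun x _ => hM x) convex_univ trivial trivial
  have hM0 : 0 ≤ M := (norm_nonneg _).trans (hM 0)
  have key := Convex.norm_image_sub_le_of_norm_hasDerivWithin_le (s := Set.Icc (-|h|) |h|)
    (C := 2 * M * |h|) (x := 0) (y := h) (fun x _ => (hd x).hasDerivWithinAt)
    (fun x hx => (hL x (-x)).trans ?_) (convex_Icc _ _) (by simp) ⟨neg_abs_le h, le_abs_self h⟩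
  · simp only [neg_zero, sub_zero, Real.norm_eq_abs] at key
    rw [← norm_neg]
    calc _ = ‖φ h + φ (-h) - (φ 0 + φ 0)‖ := by congr 1; ring
      _ ≤ _ := key
      _ = 2 * M * h ^ 2 := by rw [← sq_abs h]; ring
  · rw [sub_neg_eq_add, ← two_mul, norm_mul, Real.norm_eq_abs, Real.norm_eq_abs, abs_two]
    have : |x| ≤ |h| := abs_le.2 hx
    nlinarith

/-- Exponential decay beats three powers of `1 + τ`: two pay for two derivatives of the Gaussian,
and the third is the gain kept on the right. -/
theorem exists_pow_mul_exp_neg_le {κ : ℝ} (hκ : 0 < κ) :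
    ∃ C : ℝ, 0 < C ∧ ∀ τ : ℝ, 0 ≤ τ → Real.exp (-(κ * τ)) * (1 + τ) ^ 2 ≤ C / (1 + τ) := by
  refine ⟨6 * Real.exp κ / κ ^ 3, by positivity, fun τ hτ => ?_⟩
  have h := Real.pow_div_factorial_le_exp (κ * (1 + τ)) (by positivity) 3
  rw [le_div_iff₀ (by positivity), le_div_iff₀ (by positivity)]
  have h2 : Real.exp (κ * (1 + τ)) = Real.exp κ * Real.exp (κ * τ) := by
    rw [← Real.exp_add]; ring_nf
  have h3 : Real.exp (-(κ * τ)) * Real.exp (κ * τ) = 1 := by rw [← Real.exp_add]; simp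
  rw [h2] at h
  norm_num [Nat.factorial] at h
  have h4 : (κ * (1 + τ)) ^ 3 ≤ 6 * (Real.exp κ * Real.exp (κ * τ)) := by linarith
  calc _ = Real.exp (-(κ * τ)) * (κ * (1 + τ)) ^ 3 := by ring
    _ ≤ Real.exp (-(κ * τ)) * (6 * (Real.exp κ * Real.exp (κ * τ))) := by gcongr
    _ = 6 * Real.exp κ * (Real.exp (-(κ * τ)) * Real.exp (κ * τ)) := by ring
    _ = _ := by rw [h3, mul_one]

section

variable (P : DyadicPartition)

theorem DyadicPartition.tsupport_high_subset :
    tsupport P.high ⊆ {ξ | 3 / 4 ≤ ‖ξ‖ ∧ ‖ξ‖ ≤ 8 / 3} :=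
  closure_minimal (fun ξ h => P.high_support ξ h)
    ((isClosed_le continuous_const continuous_norm).inter
      (isClosed_le continuous_norm continuous_const))

/-- The complex Gaussian of parameter `τ c`, localised to the dyadic annulus. -/
def gaussHigh (c : ℂ) (τ : ℝ) (ξ : EuclideanSpace ℝ (Fin 2)) : ℂ :=
  Complex.exp (-(τ * c) * (‖ξ‖ ^ 2 : ℝ)) * (P.high ξ : ℂ)

theorem norm_gauss_le {c : ℂ} (hc : 0 < c.re) {τ : ℝ} (hτ : 0 ≤ τ)
    {ξ : EuclideanSpace ℝ (Fin 2)} (h : 3 / 4 ≤ ‖ξ‖) :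
    ‖Complex.exp (-(τ * c) * (‖ξ‖ ^ 2 : ℝ))‖ ≤ Real.exp (-(c.re / 2 * τ)) := by
  rw [Complex.norm_exp, Complex.re_mul_ofReal]
  simp only [Complex.neg_re, Complex.re_ofReal_mul]
  gcongr
  have : 1 / 2 ≤ ‖ξ‖ ^ 2 := by nlinarith
  have h2 : 0 ≤ τ * c.re := by positivity
  nlinarith

/-- Vanishing off the annulus matters as much as the bound `B`: the Gaussian factor then has to be
estimated only where `‖ξ‖ ≥ 3/4`. -/
theorem exists_bound_derivatives (e : EuclideanSpace ℝ (Fin 2)) :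
    ∃ (H1 H2 : EuclideanSpace ℝ (Fin 2) → ℝ) (B : ℝ), 0 < B ∧
      (∀ ξ s, HasDerivAt (fun s : ℝ => P.high (ξ + s • e)) (H1 (ξ + s • e)) s) ∧
      (∀ ξ s, HasDerivAt (fun s : ℝ => H1 (ξ + s • e)) (H2 (ξ + s • e)) s) ∧
      (∀ ξ, |P.high ξ| ≤ B) ∧ (∀ ξ, |H1 ξ| ≤ B) ∧ (∀ ξ, |H2 ξ| ≤ B) ∧
      (∀ ξ, ¬ (3 / 4 ≤ ‖ξ‖ ∧ ‖ξ‖ ≤ 8 / 3) → P.high ξ = 0 ∧ H1 ξ = 0 ∧ H2 ξ = 0) := by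
  set H1 : EuclideanSpace ℝ (Fin 2) → ℝ := fun ξ => fderiv ℝ P.high ξ e with hH1
  have hline : ∀ (ξ : EuclideanSpace ℝ (Fin 2)) (s : ℝ),
      HasDerivAt (fun s : ℝ => ξ + s • e) e s := by
    intro ξ s
    simpa using ((hasDerivAt_id s).smul_const e).const_add ξ
  have hc1 : ContDiff ℝ ∞ H1 := (P.contDiff_high.fderiv_right (m := ∞) le_rfl).clm_apply
    contDiff_const
  set H2 : EuclideanSpace ℝ (Fin 2) → ℝ := fun ξ => fderiv ℝ H1 ξ e with hH2
  have hc2 : ContDiff ℝ ∞ H2 := (hc1.fderiv_right (m := ∞) le_rfl).clm_apply contDiff_const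
  have hcpt : HasCompactSupport P.high := by
    refine HasCompactSupport.of_support_subset_isCompact
      (isCompact_closedBall (0 : EuclideanSpace ℝ (Fin 2)) (8 / 3)) fun ξ h => ?_
    simpa using (P.high_support ξ h).2
  have hs1 : tsupport H1 ⊆ tsupport P.high := tsupport_fderiv_apply_subset ℝ e
  have hs2 : tsupport H2 ⊆ tsupport P.high := (tsupport_fderiv_apply_subset ℝ e).trans hs1
  have hcpt1 : HasCompactSupport H1 := hcpt.of_isClosed_subset (isClosed_tsupport _) hs1
  have hcpt2 : HasCompactSupport H2 := hcpt.of_isClosed_subset (isClosed_tsupport _) hs2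
  obtain ⟨B0, hB0⟩ := hcpt.exists_bound_of_continuous P.contDiff_high.continuous
  obtain ⟨B1, hB1⟩ := hcpt1.exists_bound_of_continuous hc1.continuous
  obtain ⟨B2, hB2⟩ := hcpt2.exists_bound_of_continuous hc2.continuous
  refine ⟨H1, H2, 1 + max B0 (max B1 B2), ?_, fun ξ s => ?_, fun ξ s => ?_, fun ξ => ?_,
    fun ξ => ?_, fun ξ => ?_, fun ξ h => ?_⟩
  · have : 0 ≤ B0 := (norm_nonneg _).trans (hB0 0)
    have := this.trans (le_max_left B0 (max B1 B2))
    linarith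
  · exact ((P.contDiff_high.differentiable (by simp) _).hasFDerivAt).comp_hasDerivAt s (hline ξ s)
  · exact ((hc1.differentiable (by simp) _).hasFDerivAt).comp_hasDerivAt s (hline ξ s)
  · have := (hB0 ξ).trans (le_max_left B0 (max B1 B2))
    rw [Real.norm_eq_abs] at this; linarith
  · have := (hB1 ξ).trans ((le_max_left B1 B2).trans (le_max_right B0 _))
    rw [Real.norm_eq_abs] at this; linarith
  · have := (hB2 ξ).trans ((le_max_right B1 B2).trans (le_max_right B0 _))
    rw [Real.norm_eq_abs] at this; linarith
  · have h0 : ξ ∉ tsupport P.high := fun hξ => h (P.tsupport_high_subset hξ)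
    exact ⟨image_eq_zero_of_notMem_tsupport h0,
      image_eq_zero_of_notMem_tsupport fun hξ => h0 (hs1 hξ),
      image_eq_zero_of_notMem_tsupport fun hξ => h0 (hs2 hξ)⟩

/-- Along a line each derivative of the Gaussian produces a factor of size at most a multiple of
`τ‖c‖`, so the second derivative is quadratic in `τ`, and the decay on the annulus absorbs it. -/
theorem exists_gaussHigh_second_difference_le {c : ℂ} (hc : 0 < c.re)
    {e : EuclideanSpace ℝ (Fin 2)} (he : ‖e‖ = 1) :
    ∃ C : ℝ, 0 < C ∧ ∀ τ : ℝ, 0 ≤ τ → ∀ ξ, ∀ h : ℝ,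
      ‖gaussHigh P c τ ξ‖ ≤ C / (1 + τ) ∧
      ‖2 * gaussHigh P c τ ξ - gaussHigh P c τ (ξ + (-h) • e) - gaussHigh P c τ (ξ + h • e)‖ ≤
        C / (1 + τ) * h ^ 2 := by
  obtain ⟨H1, H2, B, hB, hd1, hd2, hb0, hb1, hb2, hz⟩ := exists_bound_derivatives P e
  obtain ⟨C, hC, hexp⟩ := exists_pow_mul_exp_neg_le (half_pos hc)
  -- With `x = τ‖c‖` and `|p| ≤ 3` on the annulus, the second derivative has polynomial factor
  -- `B(36x² + 14x + 1) ≤ 36B(1 + x)²`; the second difference doubles it.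
  refine ⟨72 * B * (1 + ‖c‖) ^ 2 * C, by positivity, fun τ hτ ξ h => ⟨?_, ?_⟩⟩
  · by_cases hξ : 3 / 4 ≤ ‖ξ‖ ∧ ‖ξ‖ ≤ 8 / 3
    · rw [gaussHigh, norm_mul, Complex.norm_real, Real.norm_eq_abs]
      calc _ ≤ Real.exp (-(c.re / 2 * τ)) * B := by
            gcongr
            · exact norm_gauss_le hc hτ hξ.1
            · exact hb0 ξ
        _ = B * 1 * (Real.exp (-(c.re / 2 * τ)) * 1) := by ring
        _ ≤ B * (72 * (1 + ‖c‖) ^ 2) * (Real.exp (-(c.re / 2 * τ)) * (1 + τ) ^ 2) := by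
            gcongr
            · nlinarith [norm_nonneg c]
            · nlinarith
        _ ≤ B * (72 * (1 + ‖c‖) ^ 2) * (C / (1 + τ)) := by gcongr; exact hexp τ hτ
        _ = _ := by ring
    · rw [gaussHigh, (hz ξ hξ).1]
      simp only [Complex.ofReal_zero, mul_zero, norm_zero]
      positivity
  set E : ℝ → ℂ := fun s => Complex.exp (-(τ * c) * (‖ξ + s • e‖ ^ 2 : ℝ)) with hE
  set p : ℝ → ℝ := fun s => inner ℝ (ξ + s • e) e with hp
  have hline : ∀ s : ℝ, HasDerivAt (fun s : ℝ => ξ + s • e) e s := fun s => by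
    simpa using ((hasDerivAt_id s).smul_const e).const_add ξ
  have hp' : ∀ s, HasDerivAt (fun s => (p s : ℂ)) 1 s := by
    intro s
    have := (hline s).inner ℝ (hasDerivAt_const s e)
    simp only [inner_zero_right, real_inner_self_eq_norm_sq, he, one_pow, zero_add] at this
    exact_mod_cast this.ofReal_comp
  have hE' : ∀ s, HasDerivAt E (-(2 * (τ * c)) * p s * E s) s := by
    intro s
    have := (((hline s).norm_sq.ofReal_comp).const_mul (-(τ * c))).cexp
    refine this.congr_deriv ?_
    simp only [hE, hp]
    push_cast
    ring
  have hh0 : ∀ s, HasDerivAt (fun s : ℝ => (P.high (ξ + s • e) : ℂ)) (H1 (ξ + s • e) : ℂ) s :=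
    fun s => (hd1 ξ s).ofReal_comp
  have hh1 : ∀ s, HasDerivAt (fun s : ℝ => (H1 (ξ + s • e) : ℂ)) (H2 (ξ + s • e) : ℂ) s :=
    fun s => (hd2 ξ s).ofReal_comp
  have key := norm_second_difference_le (φ := fun s => E s * (P.high (ξ + s • e) : ℂ))
    (φ' := fun s => E s * (-(2 * (τ * c)) * (p s * (P.high (ξ + s • e) : ℂ)) +
      (H1 (ξ + s • e) : ℂ)))
    (φ'' := fun s => E s * (-(2 * (τ * c)) * p s * (-(2 * (τ * c)) *
      (p s * (P.high (ξ + s • e) : ℂ)) + (H1 (ξ + s • e) : ℂ)) + (-(2 * (τ * c)) *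
      ((P.high (ξ + s • e) : ℂ) + p s * (H1 (ξ + s • e) : ℂ)) + (H2 (ξ + s • e) : ℂ))))
    (M := 36 * B * (1 + ‖c‖) ^ 2 * (C / (1 + τ)))
    (fun s => ((hE' s).mul (hh0 s)).congr_deriv (by ring))
    (fun s => ((hE' s).mul ((((hp' s).mul (hh0 s)).const_mul (-(2 * (τ * c)))).add
      (hh1 s))).congr_deriv (by simp only [Pi.mul_apply, Pi.add_apply]; ring)) ?_ h
  · simp only [hE, zero_smul, add_zero] at key
    refine key.trans_eq ?_
    ring
  · intro s
    by_cases hξ : 3 / 4 ≤ ‖ξ + s • e‖ ∧ ‖ξ + s • e‖ ≤ 8 / 3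
    · have hps : ‖(p s : ℂ)‖ ≤ 3 := by
        rw [Complex.norm_real]
        refine (norm_inner_le_norm _ _).trans ?_
        rw [he]; linarith [hξ.2]
      have hn0 : ‖(P.high (ξ + s • e) : ℂ)‖ ≤ B := by
        rw [Complex.norm_real]; exact hb0 _
      have hn1 : ‖(H1 (ξ + s • e) : ℂ)‖ ≤ B := by
        rw [Complex.norm_real]; exact hb1 _
      have hn2 : ‖(H2 (ξ + s • e) : ℂ)‖ ≤ B := by
        rw [Complex.norm_real]; exact hb2 _
      have hEs : ‖E s‖ ≤ Real.exp (-(c.re / 2 * τ)) := norm_gauss_le hc hτ hξ.1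
      have hx : ‖-(2 * ((τ : ℂ) * c))‖ = 2 * (τ * ‖c‖) := by
        rw [norm_neg, norm_mul, norm_mul, Complex.norm_real, Real.norm_of_nonneg hτ]; simp
      set x := τ * ‖c‖ with hxdef
      have hx0 : 0 ≤ x := by positivity
      have hx1 : 1 + x ≤ (1 + τ) * (1 + ‖c‖) := by nlinarith [norm_nonneg c]
      rw [norm_mul]
      calc _ ≤ Real.exp (-(c.re / 2 * τ)) * (2 * x * 3 * (2 * x * (3 * B) + B) +
            (2 * x * (B + 3 * B) + B)) := by
            gcongr
            refine (norm_add_le _ _).trans (add_le_add ?_ ?_)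
            · rw [norm_mul, norm_mul, hx]
              gcongr
              refine (norm_add_le _ _).trans (add_le_add ?_ hn1)
              rw [norm_mul, norm_mul, hx]
              gcongr
            · refine (norm_add_le _ _).trans (add_le_add ?_ hn2)
              rw [norm_mul, hx]
              gcongr
              refine (norm_add_le _ _).trans (add_le_add hn0 ?_)
              rw [norm_mul]
              gcongr
        _ ≤ Real.exp (-(c.re / 2 * τ)) * (36 * B * (1 + x) ^ 2) := by
            gcongr
            have : 0 ≤ B * x := by positivity
            nlinarith
        _ ≤ Real.exp (-(c.re / 2 * τ)) * (36 * B * ((1 + τ) * (1 + ‖c‖)) ^ 2) := by gcongr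
        _ = 36 * B * (1 + ‖c‖) ^ 2 * (Real.exp (-(c.re / 2 * τ)) * (1 + τ) ^ 2) := by ring
        _ ≤ 36 * B * (1 + ‖c‖) ^ 2 * (C / (1 + τ)) := by gcongr; exact hexp τ hτ
    · obtain ⟨h0, h1, h2⟩ := hz _ hξ
      simp only [h0, h1, h2, Complex.ofReal_zero, mul_zero, add_zero, norm_zero]
      positivity

end

/-! ### Lattice frequencies, and kernels of the heat semigroup on a dyadic block. -/

theorem freq_sub (m l : Fin 2 → ℤ) : freq (m - l) = freq m - freq l := by
  ext i; simp [freq]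

theorem freq_neg (m : Fin 2 → ℤ) : freq (-m) = -freq m := by
  ext i; simp [freq]

theorem freq_single (i : Fin 2) : freq (Pi.single i 1) = EuclideanSpace.single i 1 := by
  ext k; by_cases h : k = i <;> simp [freq, Pi.single_apply, h]

theorem abs_coord_le_norm_freq (m : Fin 2 → ℤ) (i : Fin 2) : (|m i| : ℝ) ≤ ‖freq m‖ := by
  simpa [freq] using PiLp.norm_apply_le (freq m) i

/-- The symbol of `e^{tA}`. -/
def heatSymbol (μ t : ℝ) (m : Fin 2 → ℤ) : ℂ :=
  Complex.exp (-(t : ℂ) * ((Complex.I + μ) * (4 * Real.pi ^ 2 * ‖freq m‖ ^ 2 : ℝ) + 1))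

theorem norm_heatSymbol_le_one {μ t : ℝ} (hμ : 0 < μ) (ht : 0 ≤ t) (m : Fin 2 → ℤ) :
    ‖heatSymbol μ t m‖ ≤ 1 := by
  rw [heatSymbol, Complex.norm_exp, Real.exp_le_one_iff]
  simp only [neg_mul, Complex.neg_re, Complex.re_ofReal_mul, Complex.add_re, Complex.re_mul_ofReal,
    Complex.I_re, Complex.ofReal_re, Complex.one_re]
  have : 0 ≤ t * ((0 + μ) * (4 * Real.pi ^ 2 * ‖freq m‖ ^ 2) + 1) := by positivity
  linarith

theorem DyadicPartition.cutoff_mem (P : DyadicPartition) (j : ℕ) (ξ : EuclideanSpace ℝ (Fin 2)) :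
    P.cutoff j ξ ∈ Set.Icc (0 : ℝ) 1 := by
  cases j with
  | zero => exact P.low_mem ξ
  | succ k => exact P.high_mem _

theorem norm_smul_inv_two_pow (k : ℕ) (ξ : EuclideanSpace ℝ (Fin 2)) :
    ‖((2 : ℝ) ^ k)⁻¹ • ξ‖ = ‖ξ‖ / 2 ^ k := by
  rw [norm_smul, norm_inv, norm_pow, Real.norm_ofNat, div_eq_inv_mul]

/-- The index `j` belongs to the scale `2^{j-1}`, so the outer radius `8/3 · 2^{j-1}` equals `4/3 ·
2^j`, which also fits the ball at `j = 0`. -/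
theorem DyadicPartition.norm_le_of_cutoff_ne_zero (P : DyadicPartition) {j : ℕ}
    {ξ : EuclideanSpace ℝ (Fin 2)} (h : P.cutoff j ξ ≠ 0) : ‖ξ‖ ≤ 4 / 3 * 2 ^ j := by
  cases j with
  | zero => simpa using P.low_support ξ h
  | succ k =>
    have h2 := (P.high_support _ h).2
    rw [norm_smul_inv_two_pow, div_le_iff₀ (by positivity)] at h2
    rw [pow_succ]; linarith

theorem DyadicPartition.le_norm_of_cutoff_ne_zero (P : DyadicPartition) {j : ℕ} (hj : j ≠ 0)
    {ξ : EuclideanSpace ℝ (Fin 2)} (h : P.cutoff j ξ ≠ 0) : 3 / 8 * 2 ^ j ≤ ‖ξ‖ := by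
  obtain ⟨k, rfl⟩ := Nat.exists_eq_succ_of_ne_zero hj
  have h2 := (P.high_support _ h).1
  rw [norm_smul_inv_two_pow, le_div_iff₀ (by positivity)] at h2
  rw [pow_succ]; linarith

theorem support_cutoff_finite (P : DyadicPartition) (j : ℕ) :
    (Function.support fun m => (P.cutoff j (freq m) : ℂ)).Finite := by
  refine (Finset.Icc (fun _ => -(4 * 2 ^ j : ℤ)) (fun _ => (4 * 2 ^ j : ℤ))).finite_toSet.subset
    fun m hm => ?_
  have h := P.norm_le_of_cutoff_ne_zero (Complex.ofReal_ne_zero.1 hm)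
  have h2 : ∀ i, |m i| ≤ 4 * 2 ^ j := by
    intro i
    have h3 : (|m i| : ℝ) ≤ 4 * 2 ^ j :=
      ((abs_coord_le_norm_freq m i).trans h).trans (by gcongr; norm_num)
    exact_mod_cast h3
  rw [Finset.mem_coe, Finset.mem_Icc]
  exact ⟨fun i => (abs_le.1 (h2 i)).1, fun i => (abs_le.1 (h2 i)).2⟩

/-- For `j = k + 1`, rescaling by `2^k` turns the symbol into `e^{-t}` times one fixed family with
`τ = t 4^k`. A lattice step becomes a step `2^{-k}`, so second differences gain exactly the factor
`N^{-2}` with `N = 2^k`. The block `j = 0` needs no decay, since `t ≤ 1`. -/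
theorem exists_integral_norm_heat_block_kernel_le (P : DyadicPartition) {μ : ℝ} (hμ : 0 < μ) :
    ∃ C : ℝ, 0 < C ∧ ∀ t ∈ Set.Icc (0 : ℝ) 1, ∀ j : ℕ,
      ∫ x, ‖trig (fun m => heatSymbol μ t m * P.cutoff j (freq m)) x‖ ≤ C / (1 + t * 4 ^ j) := by
  set c : ℂ := (Complex.I + μ) * (4 * Real.pi ^ 2 : ℝ) with hc
  have hcre : 0 < c.re := by
    simp only [hc, Complex.re_mul_ofReal, Complex.add_re, Complex.I_re, Complex.ofReal_re]
    have := Real.pi_pos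
    positivity
  have hsym : ∀ t k m, heatSymbol μ t m * P.cutoff (k + 1) (freq m) =
      Complex.exp (-t) * gaussHigh P c (t * 4 ^ k) (((2 : ℝ) ^ k)⁻¹ • freq m) := by
    intro t k m
    rw [gaussHigh, norm_smul_inv_two_pow, ← mul_assoc, ← Complex.exp_add, heatSymbol]
    congr 2
    rw [hc]
    push_cast
    have : ((2 : ℂ) ^ k) ^ 2 = 4 ^ k := by rw [← pow_mul, mul_comm, pow_mul]; norm_num
    rw [div_pow, this]
    field_simp
    ring
  have hex : ∀ i : Fin 2, _ := fun i => exists_gaussHigh_second_difference_le P hcre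
    (e := EuclideanSpace.single i 1) (by simp)
  choose C hC hbound using hex
  have hC01 : ∀ i, C i ≤ C 0 + C 1 := by
    intro i; fin_cases i
    · simpa using (hC 1).le
    · simpa using (hC 0).le
  have hC0 := hC 0
  have hC1 := hC 1
  -- The first 4 converts `4^k` into `4^j`. For `j = 0`, the bound `M = 4` comes from `2 + 1 + 1` in
  -- the second difference, and the 2 from `1 + t ≤ 2`.
  refine ⟨365 * (C 0 + C 1) * 4 + 365 * 4 * 2, by positivity, fun t ht j => ?_⟩
  have ht0 := ht.1
  cases j with
  | zero =>
    have hb : ∀ m, ‖heatSymbol μ t m * P.cutoff 0 (freq m)‖ ≤ 1 := by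
      intro m
      rw [norm_mul, Complex.norm_real, Real.norm_of_nonneg (P.cutoff_mem _ _).1]
      exact mul_le_one₀ (norm_heatSymbol_le_one hμ ht0 m) (P.cutoff_mem _ _).1
        (P.cutoff_mem _ _).2
    refine (integral_norm_trig_le (N := 1) (M := 4) le_rfl (by norm_num) (fun m hm i => ?_)
      (fun m => (hb m).trans (by norm_num)) fun m i => ?_).trans ?_
    · have h := P.norm_le_of_cutoff_ne_zero (Complex.ofReal_ne_zero.1 (right_ne_zero_of_mul hm))
      have h2 : (|m i| : ℝ) ≤ 3 :=
        ((abs_coord_le_norm_freq m i).trans h).trans (by norm_num)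
      exact_mod_cast h2
    · rw [secondDiff]
      refine ((norm_sub_le _ _).trans (add_le_add (norm_sub_le _ _) le_rfl)).trans ?_
      rw [norm_mul, Complex.norm_ofNat]
      have h1 := hb m
      have h2 := hb (m - Pi.single i 1)
      have h3 := hb (m - -Pi.single i 1)
      rw [Nat.cast_one, one_pow, div_one]
      linarith
    · rw [le_div_iff₀ (by positivity)]
      have := ht.2
      have : 0 ≤ 365 * (C 0 + C 1) * 4 := by positivity
      nlinarith
  | succ k =>
    have hτ : 0 ≤ t * 4 ^ k := by positivity
    have hexp : ‖Complex.exp (-(t : ℂ))‖ ≤ 1 := by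
      rw [Complex.norm_exp]; simpa using ht0
    have hle : ∀ i, C i / (1 + t * 4 ^ k) ≤ (C 0 + C 1) / (1 + t * 4 ^ k) := fun i => by
      gcongr; exact hC01 i
    refine (integral_norm_trig_le (N := 2 ^ k) (M := (C 0 + C 1) / (1 + t * 4 ^ k))
      Nat.one_le_two_pow (by positivity) (fun m hm i => ?_) (fun m => ?_) fun m i => ?_).trans ?_
    · have h := (P.high_support _ (Complex.ofReal_ne_zero.1 (right_ne_zero_of_mul hm))).2
      rw [norm_smul_inv_two_pow, div_le_iff₀ (by positivity)] at h
      have h2 : (|m i| : ℝ) ≤ 3 * 2 ^ k :=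
        ((abs_coord_le_norm_freq m i).trans h).trans (by gcongr; norm_num)
      exact_mod_cast h2
    · rw [hsym, norm_mul]
      exact (mul_le_of_le_one_left (norm_nonneg _) hexp).trans
        (((hbound 0 _ hτ _ 0).1).trans (hle 0))
    · have h := (hbound i _ hτ (((2 : ℝ) ^ k)⁻¹ • freq m) ((2 : ℝ) ^ k)⁻¹).2
      have e1 : ((2 : ℝ) ^ k)⁻¹ • freq (m - Pi.single i 1) = ((2 : ℝ) ^ k)⁻¹ • freq m +
          (-((2 : ℝ) ^ k)⁻¹) • EuclideanSpace.single i (1 : ℝ) := by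
        rw [freq_sub, freq_single, smul_sub, neg_smul, sub_eq_add_neg]
      have e2 : ((2 : ℝ) ^ k)⁻¹ • freq (m - -Pi.single i 1) = ((2 : ℝ) ^ k)⁻¹ • freq m +
          ((2 : ℝ) ^ k)⁻¹ • EuclideanSpace.single i (1 : ℝ) := by
        rw [freq_sub, freq_neg, freq_single, smul_sub, smul_neg, sub_neg_eq_add]
      rw [← e1, ← e2] at h
      have hs : secondDiff (fun m => heatSymbol μ t m * P.cutoff (k + 1) (freq m)) i m =
          Complex.exp (-t) * (2 * gaussHigh P c (t * 4 ^ k) (((2 : ℝ) ^ k)⁻¹ • freq m) -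
            gaussHigh P c (t * 4 ^ k) (((2 : ℝ) ^ k)⁻¹ • freq (m - Pi.single i 1)) -
            gaussHigh P c (t * 4 ^ k) (((2 : ℝ) ^ k)⁻¹ • freq (m - -Pi.single i 1))) := by
        rw [secondDiff, hsym, hsym, hsym]; ring
      rw [hs, norm_mul]
      refine (mul_le_of_le_one_left (norm_nonneg _) hexp).trans (h.trans ?_)
      rw [inv_pow, ← div_eq_mul_inv]
      push_cast
      gcongr
      exact hC01 i
    · rw [← mul_div_assoc, div_le_div_iff₀ (by positivity) (by positivity)]
      have h4 : 0 ≤ t * 4 ^ k := hτ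
      have hS : 0 ≤ C 0 + C 1 := by positivity
      rw [pow_succ]
      nlinarith [mul_nonneg hS h4]

/-! ### Littlewood-Paley blocks -/

section

variable {P : DyadicPartition}

theorem DyadicPartition.hasSum_cutoff (P : DyadicPartition) (ξ : EuclideanSpace ℝ (Fin 2)) :
    HasSum (fun j => P.cutoff j ξ) 1 := by
  rw [← hasSum_nat_add_iff' 1]
  simpa [DyadicPartition.cutoff] using P.hasSum_high ξ

/-- Overlapping supports force `2^i ≤ (32/9) 2^j < 2^{j+2}`. -/
theorem DyadicPartition.le_add_one_of_cutoff_ne_zero {i j : ℕ} {ξ : EuclideanSpace ℝ (Fin 2)}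
    (hi : P.cutoff i ξ ≠ 0) (hj : P.cutoff j ξ ≠ 0) : i ≤ j + 1 := by
  rcases eq_or_ne i 0 with rfl | h0
  · exact Nat.zero_le _
  have h := (P.le_norm_of_cutoff_ne_zero h0 hi).trans (P.norm_le_of_cutoff_ne_zero hj)
  have h2 : (2 : ℝ) ^ i < 2 ^ (j + 2) := by
    rw [pow_add]
    have : (0 : ℝ) < 2 ^ j := by positivity
    linarith
  have := (pow_lt_pow_iff_right₀ (one_lt_two (α := ℝ))).1 h2
  omega

theorem DyadicPartition.sum_cutoff_near {j : ℕ} {ξ : EuclideanSpace ℝ (Fin 2)}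
    (hj : P.cutoff j ξ ≠ 0) : ∑ i ∈ Finset.Icc (j - 1) (j + 1), P.cutoff i ξ = 1 := by
  refine (hasSum_sum_of_ne_finset_zero fun i hi => ?_).unique (P.hasSum_cutoff ξ)
  by_contra h
  have h1 := le_add_one_of_cutoff_ne_zero h hj
  have h2 := le_add_one_of_cutoff_ne_zero hj h
  exact hi (Finset.mem_Icc.2 ⟨by omega, h1⟩)

theorem DyadicPartition.exists_cutoff_ne_zero (P : DyadicPartition)
    (ξ : EuclideanSpace ℝ (Fin 2)) : ∃ j, P.cutoff j ξ ≠ 0 := by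
  by_contra! h
  have := (P.hasSum_cutoff ξ).tsum_eq
  simp [h] at this

theorem DyadicPartition.cutoff_neg (P : DyadicPartition) (j : ℕ) (ξ : EuclideanSpace ℝ (Fin 2)) :
    P.cutoff j (-ξ) = P.cutoff j ξ := by
  cases j with
  | zero => exact P.low_radial _ _ (norm_neg ξ)
  | succ k => exact P.high_radial _ _ (by rw [smul_neg, norm_neg])

theorem card_Icc_near_le (j : ℕ) : ((Finset.Icc (j - 1) (j + 1)).card : ℝ) ≤ 3 := by
  have : (Finset.Icc (j - 1) (j + 1)).card ≤ 3 := by rw [Nat.card_Icc]; omega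
  exact_mod_cast this

theorem support_block_finite (P : DyadicPartition) (j : ℕ) (f : FormalFourierSeries) :
    (Function.support fun m => (P.cutoff j (freq m) : ℂ) * f m).Finite :=
  support_mul_coeff_finite (support_cutoff_finite P j) f

theorem block_eq_sum (P : DyadicPartition) (j : ℕ) (f : FormalFourierSeries)
    (x : UnitAddTorus (Fin 2)) :
    block P j f x = ∑ m ∈ (support_cutoff_finite P j).toFinset,
      (P.cutoff j (freq m) : ℂ) * f m * mFourier m x :=
  trig_eq_sum (f := fun m => (P.cutoff j (freq m) : ℂ) * f m)
    (fun m hm => mem_toFinset_support _ m (left_ne_zero_of_mul hm)) x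

theorem block_add (j : ℕ) (f g : FormalFourierSeries) (x : UnitAddTorus (Fin 2)) :
    block P j (f + g) x = block P j f x + block P j g x := by
  simp only [block_eq_sum, ← Finset.sum_add_distrib, Pi.add_apply]
  exact Finset.sum_congr rfl fun m _ => by ring

theorem block_smul (j : ℕ) (c : ℂ) (f : FormalFourierSeries) (x : UnitAddTorus (Fin 2)) :
    block P j (c • f) x = c * block P j f x := by
  simp only [block_eq_sum, Finset.mul_sum, Pi.smul_apply, smul_eq_mul]
  exact Finset.sum_congr rfl fun m _ => by ring

theorem block_conj (j : ℕ) (f : FormalFourierSeries) (x : UnitAddTorus (Fin 2)) :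
    block P j (conj f) x = starRingEnd ℂ (block P j f x) := by
  have h : (fun m => (P.cutoff j (freq m) : ℂ) * conj f m) =
      conj fun m => (P.cutoff j (freq m) : ℂ) * f m := by
    ext m
    simp [conj, freq_neg, P.cutoff_neg]
  exact (congrArg (fun F => trig F x) h).trans (trig_conj _ x)

theorem exists_norm_trig_heat_block_le (P : DyadicPartition) {μ : ℝ} (hμ : 0 < μ) :
    ∃ C : ℝ, 0 < C ∧ ∀ t ∈ Set.Icc (0 : ℝ) 1, ∀ (j : ℕ) (f : FormalFourierSeries) (M : ℝ),
      f.support.Finite → (∀ x, ‖trig f x‖ ≤ M) →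
      ∀ x, ‖trig (fun m => heatSymbol μ t m * P.cutoff j (freq m) * f m) x‖ ≤
        C / (1 + t * 4 ^ j) * M := by
  obtain ⟨C, hC, h⟩ := exists_integral_norm_heat_block_kernel_le P hμ
  exact ⟨C, hC, fun t ht j f M hf hM x => norm_trig_mul_coeff_le
    ((support_cutoff_finite P j).subset fun m hm => right_ne_zero_of_mul hm) hf (h t ht j) hM x⟩

/-- The blocks are bounded on `L^∞`, uniformly. -/
theorem exists_norm_block_le_of_norm_trig_le (P : DyadicPartition) :
    ∃ C : ℝ, 0 < C ∧ ∀ (j : ℕ) (f : FormalFourierSeries) (M : ℝ), f.support.Finite →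
      (∀ x, ‖trig f x‖ ≤ M) → ∀ x, ‖block P j f x‖ ≤ C * M := by
  -- The estimate is used at `t = 0`, where the heat symbol is 1 and the value of `μ` is immaterial.
  obtain ⟨C, hC, h⟩ := exists_norm_trig_heat_block_le P one_pos
  refine ⟨C, hC, fun j f M hf hM x => ?_⟩
  have := h 0 (by simp) j f M hf hM x
  simpa [heatSymbol] using! this

/-- Only `δ_j f` is bounded, so the kernel estimate needs a second cut-off: the neighbouring
cut-offs sum to 1 on the support of the `j`-th and may be inserted for free. The 12 is three
neighbours times `4^j ≤ 4 · 4^i`. -/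
theorem exists_norm_block_semigroup_le (P : DyadicPartition) {μ : ℝ} (hμ : 0 < μ) :
    ∃ C : ℝ, 0 < C ∧ ∀ t ∈ Set.Icc (0 : ℝ) 1, ∀ (j : ℕ) (f : FormalFourierSeries) (M : ℝ),
      (∀ x, ‖block P j f x‖ ≤ M) →
      ∀ x, ‖block P j (semigroup μ t f) x‖ ≤ C / (1 + t * 4 ^ j) * M := by
  obtain ⟨C, hC, h⟩ := exists_norm_trig_heat_block_le P hμ
  refine ⟨12 * C, by positivity, fun t ht j f M hM x => ?_⟩
  have ht0 := ht.1
  have hM0 : 0 ≤ M := (norm_nonneg _).trans (hM x)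
  set g : FormalFourierSeries := fun m => (P.cutoff j (freq m) : ℂ) * f m with hg
  have hgf : g.support.Finite := support_block_finite P j f
  have hsplit : block P j (semigroup μ t f) x = ∑ i ∈ Finset.Icc (j - 1) (j + 1),
      trig (fun m => heatSymbol μ t m * P.cutoff i (freq m) * g m) x := by
    rw [← trig_finsetSum _ _ fun i _ => hgf.subset fun m hm => right_ne_zero_of_mul hm]
    change trig _ x = _
    congr 1
    ext m
    rw [← Finset.sum_mul, ← Finset.mul_sum]
    by_cases hc : P.cutoff j (freq m) = 0
    · simp [hg, hc]
    · have := DyadicPartition.sum_cutoff_near hc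
      rw [← Complex.ofReal_sum, this]
      simp only [hg, semigroup, heatSymbol]
      push_cast
      ring
  rw [hsplit]
  calc ‖∑ i ∈ Finset.Icc (j - 1) (j + 1),
        trig (fun m => heatSymbol μ t m * P.cutoff i (freq m) * g m) x‖
      ≤ ∑ _i ∈ Finset.Icc (j - 1) (j + 1), 4 * C / (1 + t * 4 ^ j) * M := by
        refine norm_sum_le_of_le _ fun i hi => (h t ht i g M hgf hM x).trans ?_
        refine mul_le_mul_of_nonneg_right ?_ hM0
        rw [div_le_div_iff₀ (by positivity) (by positivity)]
        have h4 : (4 : ℝ) ^ j ≤ 4 * 4 ^ i := by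
          rw [← pow_succ']
          have := (Finset.mem_Icc.1 hi).1
          exact pow_le_pow_right₀ (by norm_num) (by omega)
        have h5 := mul_le_mul_of_nonneg_left h4 ht0
        nlinarith
    _ = (Finset.Icc (j - 1) (j + 1)).card * (4 * C / (1 + t * 4 ^ j) * M) := by
        rw [Finset.sum_const, nsmul_eq_mul]
    _ ≤ 3 * (4 * C / (1 + t * 4 ^ j) * M) := by gcongr; exact card_Icc_near_le j
    _ = 12 * C / (1 + t * 4 ^ j) * M := by ring

/-! ### Quantitative bounds in Hölder-Besov spaces -/

/-- The norm of `f` in `𝒞^α` is at most `M`. -/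
def HolderBound (P : DyadicPartition) (α M : ℝ) (f : FormalFourierSeries) : Prop :=
  ∀ (j : ℕ) (x : UnitAddTorus (Fin 2)), ‖block P j f x‖ ≤ M * (2 : ℝ) ^ (-(α * ((j : ℝ) - 1)))

theorem holderNorm_le_ofReal_iff {α M : ℝ} (hM : 0 ≤ M) {f : FormalFourierSeries} :
    holderNorm P α f ≤ ENNReal.ofReal M ↔ HolderBound P α M f := by
  simp only [holderNorm, iSup_le_iff, ENNReal.mul_iSup]
  refine forall_congr' fun j => forall_congr' fun x => ?_
  rw [← ofReal_norm, ← ENNReal.ofReal_mul (by positivity), ENNReal.ofReal_le_ofReal_iff hM,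
    Real.rpow_neg zero_le_two, ← div_eq_mul_inv, le_div_iff₀ (by positivity), mul_comm]

theorem HolderBound.nonneg {α M : ℝ} {f : FormalFourierSeries} (h : HolderBound P α M f) :
    0 ≤ M := by
  -- The index 1 is the block `k = 0`, whose weight is 1.
  have := (norm_nonneg _).trans (h 1 0)
  simpa using this

theorem HolderBound.mono {α M M' : ℝ} {f : FormalFourierSeries} (h : HolderBound P α M f)
    (hM : M ≤ M') : HolderBound P α M' f := fun j x =>
  (h j x).trans (by gcongr)

theorem HolderBound.add {α M M' : ℝ} {f g : FormalFourierSeries} (hf : HolderBound P α M f)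
    (hg : HolderBound P α M' g) : HolderBound P α (M + M') (f + g) := fun j x => by
  rw [block_add, add_mul]
  exact (norm_add_le _ _).trans (add_le_add (hf j x) (hg j x))

theorem HolderBound.smul {α M : ℝ} {f : FormalFourierSeries} (hf : HolderBound P α M f) (c : ℂ) :
    HolderBound P α (‖c‖ * M) (c • f) := fun j x => by
  rw [block_smul, norm_mul, mul_assoc]
  exact mul_le_mul_of_nonneg_left (hf j x) (norm_nonneg c)

theorem HolderBound.sub {α M M' : ℝ} {f g : FormalFourierSeries} (hf : HolderBound P α M f)
    (hg : HolderBound P α M' g) : HolderBound P α (M + M') (f - g) := by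
  have := hf.add (hg.smul (-1))
  simpa [sub_eq_add_neg] using this

theorem HolderBound.conj {α M : ℝ} {f : FormalFourierSeries} (hf : HolderBound P α M f) :
    HolderBound P α M (conj f) := fun j x => by
  rw [block_conj, RCLike.norm_conj]
  exact hf j x

theorem holderBound_zero (α : ℝ) : HolderBound P α 0 0 := fun j x => by
  simp [block]

/-- The factor `2^(α - α')` is forced by the block `k = -1`, where the weights are ordered the other
way. -/
theorem HolderBound.mono_exponent {α α' M : ℝ} {f : FormalFourierSeries}
    (hf : HolderBound P α M f) (h : α' ≤ α) : HolderBound P α' (2 ^ (α - α') * M) f := fun j x => by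
  refine (hf j x).trans ?_
  have hM := hf.nonneg
  rw [mul_comm _ M, mul_assoc, ← Real.rpow_add zero_lt_two]
  gcongr
  · exact one_le_two
  · have : 0 ≤ (α - α') * (j : ℝ) := mul_nonneg (sub_nonneg.2 h) (Nat.cast_nonneg j)
    linarith

theorem HolderBound.norm_coeff_le_sum {α M : ℝ} {f : FormalFourierSeries}
    (hf : HolderBound P α M f) {m : Fin 2 → ℤ} {j : ℕ} (hj : P.cutoff j (freq m) ≠ 0) :
    ‖f m‖ ≤ 3 * (2 : ℝ) ^ (|α| * (j + 1)) * M := by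
  have hM := hf.nonneg
  have h1 : f m = ∑ i ∈ Finset.Icc (j - 1) (j + 1), (P.cutoff i (freq m) : ℂ) * f m := by
    rw [← Finset.sum_mul, ← Complex.ofReal_sum, DyadicPartition.sum_cutoff_near hj,
      Complex.ofReal_one, one_mul]
  rw [h1]
  calc ‖∑ i ∈ Finset.Icc (j - 1) (j + 1), (P.cutoff i (freq m) : ℂ) * f m‖
      ≤ ∑ _i ∈ Finset.Icc (j - 1) (j + 1), M * (2 : ℝ) ^ (|α| * (j + 1)) := by
        refine norm_sum_le_of_le _ fun i hi => ?_
        refine (norm_coeff_le_of_norm_trig_le (support_block_finite P i f) (hf i) m).trans ?_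
        gcongr
        · exact one_le_two
        · rw [Finset.mem_Icc] at hi
          have h2 : |(i : ℝ) - 1| ≤ j + 1 := by
            have : (i : ℝ) ≤ j + 1 := by exact_mod_cast hi.2
            have : (0 : ℝ) ≤ i := Nat.cast_nonneg i
            rw [abs_le]; constructor <;> linarith
          calc -(α * ((i : ℝ) - 1)) ≤ |α * ((i : ℝ) - 1)| := neg_le_abs _
            _ = |α| * |(i : ℝ) - 1| := abs_mul _ _
            _ ≤ _ := by gcongr
    _ = (Finset.Icc (j - 1) (j + 1)).card * (M * (2 : ℝ) ^ (|α| * (j + 1))) := by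
        rw [Finset.sum_const, nsmul_eq_mul]
    _ ≤ 3 * (M * (2 : ℝ) ^ (|α| * (j + 1))) := by gcongr; exact card_Icc_near_le j
    _ = _ := by ring

theorem norm_freq_le (m : Fin 2 → ℤ) : ‖freq m‖ ≤ 2 * ‖m‖ := by
  have h : ∀ i, (m i : ℝ) ^ 2 ≤ ‖m‖ ^ 2 := by
    intro i
    have := norm_le_pi_norm m i
    rw [Int.norm_eq_abs] at this
    rw [← sq_abs]
    gcongr
  refine abs_le_of_sq_le_sq' ?_ (by positivity) |>.2
  rw [EuclideanSpace.norm_sq_eq]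
  simp only [freq, Fin.sum_univ_two, Real.norm_eq_abs, sq_abs]
  nlinarith [h 0, h 1, sq_nonneg ‖m‖]

/-- The frequency `m` is seen by at most three blocks, at scales bounded by a multiple of `1 + ‖m‖`.
This makes norm bounds imply coefficient bounds, and so reduces limits, measurability and time
continuity to single coefficients. -/
theorem exists_norm_coeff_le (P : DyadicPartition) (α : ℝ) :
    ∃ (C : ℝ) (N : ℕ), 0 ≤ C ∧ ∀ (f : FormalFourierSeries) (M : ℝ), HolderBound P α M f →
      ∀ m, ‖f m‖ ≤ C * (1 + ‖m‖) ^ N * M := by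
  refine ⟨3 * 12 ^ ⌈|α|⌉₊, ⌈|α|⌉₊, by positivity, fun f M hf m => ?_⟩
  have hM := hf.nonneg
  obtain ⟨j, hj⟩ := P.exists_cutoff_ne_zero (freq m)
  refine (hf.norm_coeff_le_sum hj).trans ?_
  rw [mul_assoc 3 (12 ^ _), ← mul_pow]
  gcongr
  have h2 : (2 : ℝ) ^ (j + 1) ≤ 12 * (1 + ‖m‖) := by
    rcases eq_or_ne j 0 with rfl | h0
    · norm_num; nlinarith [norm_nonneg m]
    · have h3 := (P.le_norm_of_cutoff_ne_zero h0 hj).trans (norm_freq_le m)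
      rw [pow_succ]; linarith [norm_nonneg m]
  calc (2 : ℝ) ^ (|α| * (j + 1)) = ((2 : ℝ) ^ (j + 1)) ^ |α| := by
        rw [← Real.rpow_natCast, ← Real.rpow_mul zero_le_two]
        congr 1; push_cast; ring
    _ ≤ ((2 : ℝ) ^ (j + 1)) ^ (⌈|α|⌉₊ : ℝ) :=
        Real.rpow_le_rpow_of_exponent_le (one_le_pow₀ one_le_two) (Nat.le_ceil _)
    _ = ((2 : ℝ) ^ (j + 1)) ^ ⌈|α|⌉₊ := Real.rpow_natCast _ _
    _ ≤ _ := by gcongr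

theorem HolderBound.memHolder {α M : ℝ} {f : FormalFourierSeries} (hf : HolderBound P α M f) :
    MemHolder P α f := by
  obtain ⟨C, N, -, h⟩ := exists_norm_coeff_le P α
  exact ⟨⟨C * M, N, fun m => (h f M hf m).trans_eq (by ring)⟩,
    ((holderNorm_le_ofReal_iff hf.nonneg).2 hf).trans_lt ENNReal.ofReal_lt_top⟩

theorem HolderBound.eq_zero {α : ℝ} {f : FormalFourierSeries} (hf : HolderBound P α 0 f) :
    f = 0 := by
  obtain ⟨C, N, -, h⟩ := exists_norm_coeff_le P α
  ext m
  simpa using h f 0 hf m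

/-- Smoothing by the semigroup. -/
theorem exists_holderBound_semigroup (P : DyadicPartition) {μ : ℝ} (hμ : 0 < μ) :
    ∃ C : ℝ, 0 < C ∧ ∀ t ∈ Set.Ioc (0 : ℝ) 1, ∀ p ∈ Set.Icc (0 : ℝ) 1,
      ∀ (α M : ℝ) (f : FormalFourierSeries), HolderBound P α M f →
        HolderBound P (α + 2 * p) (C * t ^ (-p) * M) (semigroup μ t f) := by
  obtain ⟨C, hC, h⟩ := exists_norm_block_semigroup_le P hμ
  refine ⟨C, hC, fun t ht p hp α M f hf j x => ?_⟩
  have ht0 := ht.1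
  have hM := hf.nonneg
  refine (h t ⟨ht.1.le, ht.2⟩ j f _ (hf j) x).trans ?_
  set y : ℝ := t * 4 ^ j with hy
  have hy0 : 0 < y := by positivity
  -- For `p` in `[0,1]` the decay `1/(1 + t4^j)` is at most `(t4^j)^{-p}`, which exchanges `t^{-p}`
  -- for `2p` derivatives.
  have h1 : y ^ p ≤ 1 + y := by
    rcases le_total y 1 with h1 | h1
    · exact (Real.rpow_le_one hy0.le h1 hp.1).trans (by linarith)
    · calc y ^ p ≤ y ^ (1 : ℝ) := Real.rpow_le_rpow_of_exponent_le h1 hp.2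
        _ ≤ 1 + y := by rw [Real.rpow_one]; linarith
  have h2 : y ^ (-p) = t ^ (-p) * 2 ^ (-(2 * p * j)) := by
    rw [hy, Real.mul_rpow ht0.le (by positivity)]
    congr 1
    rw [show (4 : ℝ) ^ j = 2 ^ (2 * j : ℝ) by
      rw [Real.rpow_mul zero_le_two, Real.rpow_natCast]; norm_num, ← Real.rpow_mul zero_le_two]
    congr 1; ring
  have h3 : (2 : ℝ) ^ (-(2 * p * j)) * 2 ^ (-(α * ((j : ℝ) - 1))) ≤
      2 ^ (-((α + 2 * p) * ((j : ℝ) - 1))) := by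
    rw [← Real.rpow_add zero_lt_two]
    refine Real.rpow_le_rpow_of_exponent_le one_le_two ?_
    linarith [hp.1]
  calc C / (1 + y) * (M * 2 ^ (-(α * ((j : ℝ) - 1))))
      ≤ C / y ^ p * (M * 2 ^ (-(α * ((j : ℝ) - 1)))) := by gcongr
    _ = C * t ^ (-p) * M * (2 ^ (-(2 * p * j)) * 2 ^ (-(α * ((j : ℝ) - 1)))) := by
        rw [div_eq_mul_inv, ← Real.rpow_neg hy0.le, h2]; ring
    _ ≤ _ := by gcongr

end

/-! ### Products -/

section

variable {P : DyadicPartition}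

/-- The frequencies `2^j`, `2^k`, `2^l` can occur in a product and its two factors. -/
def Resonant (j k l : ℕ) : Prop := k ≤ max j l + 2 ∧ l ≤ max j k + 2 ∧ j ≤ max k l + 2

theorem le_max_add_two_of_norm_le {i j k : ℕ} {ξ η ζ : EuclideanSpace ℝ (Fin 2)}
    (hi : P.cutoff i ξ ≠ 0) (hj : P.cutoff j η ≠ 0) (hk : P.cutoff k ζ ≠ 0)
    (h : ‖ξ‖ ≤ ‖η‖ + ‖ζ‖) : i ≤ max j k + 2 := by
  rcases eq_or_ne i 0 with rfl | h0
  · exact Nat.zero_le _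
  have h1 := P.le_norm_of_cutoff_ne_zero h0 hi
  have h2 := P.norm_le_of_cutoff_ne_zero hj
  have h3 := P.norm_le_of_cutoff_ne_zero hk
  have h4 : (2 : ℝ) ^ j ≤ 2 ^ max j k := pow_le_pow_right₀ one_le_two (le_max_left _ _)
  have h5 : (2 : ℝ) ^ k ≤ 2 ^ max j k := pow_le_pow_right₀ one_le_two (le_max_right _ _)
  have h6 : (2 : ℝ) ^ i < 2 ^ (max j k + 3) := by
    rw [pow_add]
    have : (0 : ℝ) < 2 ^ max j k := by positivity
    linarith
  have := (pow_lt_pow_iff_right₀ (one_lt_two (α := ℝ))).1 h6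
  omega

theorem resonant_of_cutoff_ne_zero {j k l : ℕ} {m n : Fin 2 → ℤ}
    (hj : P.cutoff j (freq m) ≠ 0) (hk : P.cutoff k (freq n) ≠ 0)
    (hl : P.cutoff l (freq (m - n)) ≠ 0) : Resonant j k l := by
  rw [freq_sub] at hl
  refine ⟨le_max_add_two_of_norm_le hk hj hl ?_, le_max_add_two_of_norm_le hl hj hk ?_,
    le_max_add_two_of_norm_le hj hk hl ?_⟩
  · calc ‖freq n‖ = ‖freq m - (freq m - freq n)‖ := by rw [sub_sub_cancel]
      _ ≤ _ := norm_sub_le _ _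
  · exact norm_sub_le _ _
  · calc ‖freq m‖ = ‖freq n + (freq m - freq n)‖ := by rw [add_sub_cancel]
      _ ≤ _ := norm_add_le _ _

/-- Cauchy-Schwarz and Parseval bound the convolution absolutely, as Fubini requires later on. -/
theorem sum_norm_mul_le {f g : FormalFourierSeries} (hf : f.support.Finite)
    (hg : g.support.Finite) {p q : ℝ} (hp : ∀ x, ‖trig f x‖ ≤ p) (hq : ∀ x, ‖trig g x‖ ≤ q)
    (m : Fin 2 → ℤ) : ∑ l ∈ hf.toFinset, ‖f l * g (m - l)‖ ≤ p * q := by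
  have hp0 : 0 ≤ p := (norm_nonneg _).trans (hp 0)
  have hq0 : 0 ≤ q := (norm_nonneg _).trans (hq 0)
  simp only [norm_mul]
  refine abs_le_of_sq_le_sq (?_ : _ ≤ (p * q) ^ 2) (mul_nonneg hp0 hq0) |> (le_abs_self _).trans
  refine (Finset.sum_mul_sq_le_sq_mul_sq _ _ _).trans ?_
  rw [mul_pow]
  refine mul_le_mul (sum_normSq_le_of_norm_trig_le (mem_toFinset_support hf) hp) ?_
    (by positivity) (by positivity)
  refine le_trans ?_ (sum_normSq_le_of_norm_trig_le
    (s := hg.toFinset ∪ hf.toFinset.image (fun l => m - l))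
    (fun l hl => Finset.mem_union_left _ (mem_toFinset_support hg l hl)) hq)
  rw [← Finset.sum_image (f := fun l => ‖g l‖ ^ 2) (g := fun l => m - l) (s := hf.toFinset)
    fun a _ b _ h => sub_right_injective h]
  exact Finset.sum_le_sum_of_subset_of_nonneg Finset.subset_union_right
    fun _ _ _ => sq_nonneg _

/-- The Fourier coefficients of the block `δ_j f`. -/
def blockCoeff (P : DyadicPartition) (j : ℕ) (f : FormalFourierSeries) : FormalFourierSeries :=
  fun m => (P.cutoff j (freq m) : ℂ) * f m

theorem mul_blockCoeff_eq_zero {j k l : ℕ} (h : ¬ Resonant j k l) (f g : FormalFourierSeries)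
    {m : Fin 2 → ℤ} (hm : P.cutoff j (freq m) ≠ 0) (n : Fin 2 → ℤ) :
    blockCoeff P k f n * blockCoeff P l g (m - n) = 0 := by
  by_contra hc
  refine h (resonant_of_cutoff_ne_zero (P := P) hm (m := m) (n := n) ?_ ?_)
  · exact Complex.ofReal_ne_zero.1 (left_ne_zero_of_mul (left_ne_zero_of_mul hc))
  · exact Complex.ofReal_ne_zero.1 (left_ne_zero_of_mul (right_ne_zero_of_mul hc))

section

variable {f g : FormalFourierSeries} {p q u v : ℕ → ℝ} {j : ℕ}

/-- The series over pairs of blocks and frequencies converges absolutely, non-resonant pairs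
contributing nothing at `m`. Summing blocks first shows that the convolution series converges;
summing frequencies first gives the decomposition of the product into blocks. -/
theorem hasSum_mul_blockCoeff (hp : ∀ k x, ‖block P k f x‖ ≤ p k)
    (hq : ∀ l x, ‖block P l g x‖ ≤ q l) (hu : Summable u) (hv : Summable v) (hu0 : ∀ k, 0 ≤ u k)
    (hv0 : ∀ l, 0 ≤ v l) (h : ∀ k l, Resonant j k l → p k * q l ≤ u k * v l)
    {m : Fin 2 → ℤ} (hm : P.cutoff j (freq m) ≠ 0) :
    (Summable fun n => f n * g (m - n)) ∧
      HasSum (fun i : ℕ × ℕ => mul (blockCoeff P i.1 f) (blockCoeff P i.2 g) m) (mul f g m) := by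
  set F : (ℕ × ℕ) × (Fin 2 → ℤ) → ℂ := fun i =>
    blockCoeff P i.1.1 f i.2 * blockCoeff P i.1.2 g (m - i.2) with hF
  have hfin : ∀ i : ℕ × ℕ, ∀ n ∉ (support_block_finite P i.1 f).toFinset, F (i, n) = 0 := by
    intro i n hn
    have : blockCoeff P i.1 f n = 0 := by
      by_contra hc; exact hn (mem_toFinset_support _ n hc)
    simp [hF, this]
  have hsum : Summable fun i => ‖F i‖ := by
    rw [summable_prod_of_nonneg fun _ => norm_nonneg _]
    refine ⟨fun i => summable_of_ne_finset_zero fun n hn => by rw [hfin i n hn, norm_zero],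
      Summable.of_nonneg_of_le (fun i => tsum_nonneg fun _ => norm_nonneg _) (fun i => ?_)
        (hu.mul_of_nonneg hv hu0 hv0)⟩
    by_cases hr : Resonant j i.1 i.2
    · rw [tsum_eq_sum fun n hn => by rw [hfin i n hn, norm_zero]]
      exact (sum_norm_mul_le (support_block_finite P i.1 f) (support_block_finite P i.2 g)
        (hp i.1) (hq i.2) m).trans (h _ _ hr)
    · have : ∀ n, F (i, n) = 0 := mul_blockCoeff_eq_zero hr f g hm
      simp only [this, norm_zero, tsum_zero]
      exact mul_nonneg (hu0 _) (hv0 _)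
  have htot := hsum.of_norm.hasSum
  have hcut : ∀ n, HasSum (fun i : ℕ × ℕ => F (i, n)) (f n * g (m - n)) := by
    intro n
    have h1 : HasSum (fun k => (P.cutoff k (freq n) : ℂ)) 1 := by
      rw [← Complex.ofReal_one]; exact Complex.hasSum_ofReal.2 (P.hasSum_cutoff (freq n))
    have h2 : HasSum (fun k => (P.cutoff k (freq (m - n)) : ℂ)) 1 := by
      rw [← Complex.ofReal_one]; exact Complex.hasSum_ofReal.2 (P.hasSum_cutoff (freq (m - n)))
    have h3 := (h1.mul_right (f n)).mul (h2.mul_right (g (m - n)))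
      (hsum.of_norm.prod_symm.prod_factor n)
    simpa [hF, blockCoeff] using! h3
  have h1 : HasSum (fun n => f n * g (m - n)) (∑' i, F i) :=
    ((Equiv.prodComm _ _).hasSum_iff.2 htot).prod_fiberwise hcut
  refine ⟨h1.summable, ?_⟩
  rw [mul, h1.tsum_eq]
  exact htot.prod_fiberwise fun i => (summable_of_ne_finset_zero (hfin i)).hasSum

end

/-- The product majorant `u k * v l`, which may depend on `j`, is required on resonant triples only;
this replaces the paraproduct decomposition. -/
theorem exists_norm_block_mul_le (P : DyadicPartition) :
    ∃ C : ℝ, 0 < C ∧ ∀ (f g : FormalFourierSeries) (p q u v : ℕ → ℝ) (j : ℕ),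
      (∀ k x, ‖block P k f x‖ ≤ p k) → (∀ l x, ‖block P l g x‖ ≤ q l) → Summable u → Summable v →
      (∀ k, 0 ≤ u k) → (∀ l, 0 ≤ v l) → (∀ k l, Resonant j k l → p k * q l ≤ u k * v l) →
      ∀ x, ‖block P j (mul f g) x‖ ≤ C * ((∑' k, u k) * ∑' l, v l) := by
  obtain ⟨C, hC, hblock⟩ := exists_norm_block_le_of_norm_trig_le P
  refine ⟨C, hC, fun f g p q u v j hp hq hu hv hu0 hv0 h x => ?_⟩
  have hs : HasSum (fun i : ℕ × ℕ =>
      block P j (mul (blockCoeff P i.1 f) (blockCoeff P i.2 g)) x) (block P j (mul f g) x) := by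
    simp only [block_eq_sum]
    refine hasSum_sum fun m _ => ?_
    by_cases hm : P.cutoff j (freq m) = 0
    · simp [hm, hasSum_zero]
    · exact ((hasSum_mul_blockCoeff hp hq hu hv hu0 hv0 h hm).2.mul_left _).mul_right _
  refine hs.norm_le_of_bounded ((hu.hasSum.mul hv.hasSum
    (hu.mul_of_nonneg hv hu0 hv0)).mul_left C) fun i => ?_
  by_cases hr : Resonant j i.1 i.2
  · have hfi := support_block_finite P i.1 f
    have hgi := support_block_finite P i.2 g
    refine (hblock j _ (p i.1 * q i.2) (support_mul_finite hfi hgi) (fun y => ?_) x).trans ?_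
    · refine (congrArg norm (trig_mul hfi hgi y)).trans_le ?_
      rw [norm_mul]
      exact mul_le_mul (hp _ _) (hq _ _) (norm_nonneg _) ((norm_nonneg _).trans (hp i.1 y))
    · exact mul_le_mul_of_nonneg_left (h _ _ hr) hC.le
  · rw [block_eq_sum, Finset.sum_eq_zero, norm_zero]
    · exact mul_nonneg hC.le (mul_nonneg (hu0 _) (hv0 _))
    · intro m _
      by_cases hm : P.cutoff j (freq m) = 0
      · simp [hm]
      · have : mul (blockCoeff P i.1 f) (blockCoeff P i.2 g) m = 0 := by
          simp only [mul, mul_blockCoeff_eq_zero hr f g hm, tsum_zero]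
        rw [this, mul_zero, zero_mul]

theorem summable_two_rpow {β : ℝ} (hβ : 0 < β) :
    Summable fun k : ℕ => (2 : ℝ) ^ (-(β * k)) := by
  have h : (fun k : ℕ => (2 : ℝ) ^ (-(β * k))) = fun k => ((2 : ℝ) ^ (-β)) ^ k := by
    ext k
    rw [← Real.rpow_natCast, ← Real.rpow_mul zero_le_two, neg_mul]
  rw [h]
  exact summable_geometric_of_lt_one (by positivity)
    (Real.rpow_lt_one_of_one_lt_of_neg one_lt_two (neg_lt_zero.2 hβ))

/-- Write `2^{βk} = 2^{-βk} 2^{2βk}` and use `k ≤ j + l + 2` in the second factor. Decay in `k` is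
bought with `2β` of the regularity in `l`, hence `2β < a` for summation, and with growth `2^{2βj}`
in the result. -/
theorem resonant_neg_exponent_le {a β G F : ℝ} (hβ : 0 < β) (hG : 0 ≤ G) (hF : 0 ≤ F) {j k l : ℕ}
    (h : Resonant j k l) :
    G * (2 : ℝ) ^ (-(-β * ((k : ℝ) - 1))) * (F * (2 : ℝ) ^ (-(a * ((l : ℝ) - 1)))) ≤
      2 ^ (-(β * k)) *
        (2 ^ (a + 5 * β) * (G * F) * 2 ^ (2 * β * ((j : ℝ) - 1)) * 2 ^ (-((a - 2 * β) * l))) := by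
  have hk : (k : ℝ) ≤ j + l + 2 := by
    have : k ≤ j + l + 2 := h.1.trans (by omega)
    exact_mod_cast this
  have e1 : G * (2 : ℝ) ^ (-(-β * ((k : ℝ) - 1))) * (F * (2 : ℝ) ^ (-(a * ((l : ℝ) - 1)))) =
      G * F * 2 ^ (-(-β * ((k : ℝ) - 1)) + -(a * ((l : ℝ) - 1))) := by
    rw [Real.rpow_add zero_lt_two]; ring
  have e2 : (2 : ℝ) ^ (-(β * k)) * (2 ^ (a + 5 * β) * (G * F) * 2 ^ (2 * β * ((j : ℝ) - 1)) *
      2 ^ (-((a - 2 * β) * l))) =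
      G * F * 2 ^ (-(β * k) + (a + 5 * β) + 2 * β * ((j : ℝ) - 1) + -((a - 2 * β) * l)) := by
    simp only [Real.rpow_add zero_lt_two]; ring
  rw [e1, e2]
  refine mul_le_mul_of_nonneg_left (Real.rpow_le_rpow_of_exponent_le one_le_two ?_) (by positivity)
  nlinarith

/-- Half of the decay is kept for summing over `k` and `l`; the other half becomes decay in `j`
because `j ≤ k + l + 2`. -/
theorem resonant_pos_exponent_le {a G F : ℝ} (ha : 0 < a) (hG : 0 ≤ G) (hF : 0 ≤ F) {j k l : ℕ}
    (h : Resonant j k l) :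
    G * (2 : ℝ) ^ (-(a * ((k : ℝ) - 1))) * (F * (2 : ℝ) ^ (-(a * ((l : ℝ) - 1)))) ≤
      2 ^ (-(a / 2 * k)) *
        (2 ^ (3 * a) * (G * F) * 2 ^ (-(a / 2 * ((j : ℝ) - 1))) * 2 ^ (-(a / 2 * l))) := by
  have hk : (j : ℝ) ≤ k + l + 2 := by
    have : j ≤ k + l + 2 := h.2.2.trans (by omega)
    exact_mod_cast this
  have e1 : G * (2 : ℝ) ^ (-(a * ((k : ℝ) - 1))) * (F * (2 : ℝ) ^ (-(a * ((l : ℝ) - 1)))) =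
      G * F * 2 ^ (-(a * ((k : ℝ) - 1)) + -(a * ((l : ℝ) - 1))) := by
    rw [Real.rpow_add zero_lt_two]; ring
  have e2 : (2 : ℝ) ^ (-(a / 2 * k)) * (2 ^ (3 * a) * (G * F) *
      2 ^ (-(a / 2 * ((j : ℝ) - 1))) * 2 ^ (-(a / 2 * l))) =
      G * F * 2 ^ (-(a / 2 * k) + 3 * a + -(a / 2 * ((j : ℝ) - 1)) + -(a / 2 * l)) := by
    simp only [Real.rpow_add zero_lt_two]; ring
  rw [e1, e2]
  refine mul_le_mul_of_nonneg_left (Real.rpow_le_rpow_of_exponent_le one_le_two ?_) (by positivity)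
  nlinarith

theorem exists_holderBound_mul_neg (P : DyadicPartition) {a β : ℝ} (hβ : 0 < β) (ha : 2 * β < a) :
    ∃ C : ℝ, 0 < C ∧ ∀ (g f : FormalFourierSeries) (G F : ℝ), HolderBound P (-β) G g →
      HolderBound P a F f → HolderBound P (-(2 * β)) (C * (G * F)) (mul g f) := by
  obtain ⟨C, hC, h⟩ := exists_norm_block_mul_le P
  have s1 := summable_two_rpow hβ
  have s2 := summable_two_rpow (sub_pos.2 ha)
  set U := ∑' k : ℕ, (2 : ℝ) ^ (-(β * k))
  set V := ∑' k : ℕ, (2 : ℝ) ^ (-((a - 2 * β) * k))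
  have hU : 0 < U := s1.tsum_pos (fun _ => by positivity) 0 (by positivity)
  have hV : 0 < V := s2.tsum_pos (fun _ => by positivity) 0 (by positivity)
  refine ⟨C * U * V * 2 ^ (a + 5 * β), by positivity, fun g f G F hg hf j x => ?_⟩
  have hG := hg.nonneg
  have hF := hf.nonneg
  refine (h g f _ _ _ _ j hg hf s1 (s2.mul_left _) (fun _ => by positivity)
    (fun _ => by positivity) (fun k l hr => resonant_neg_exponent_le hβ hG hF hr) x).trans_eq ?_
  rw [tsum_mul_left, show -(-(2 * β) * ((j : ℝ) - 1)) = 2 * β * ((j : ℝ) - 1) by ring]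
  ring

theorem exists_holderBound_mul_pos (P : DyadicPartition) {a : ℝ} (ha : 0 < a) :
    ∃ C : ℝ, 0 < C ∧ ∀ (g f : FormalFourierSeries) (G F : ℝ), HolderBound P a G g →
      HolderBound P a F f → HolderBound P (a / 2) (C * (G * F)) (mul g f) := by
  obtain ⟨C, hC, h⟩ := exists_norm_block_mul_le P
  have s1 := summable_two_rpow (half_pos ha)
  set U := ∑' k : ℕ, (2 : ℝ) ^ (-(a / 2 * k))
  have hU : 0 < U := s1.tsum_pos (fun _ => by positivity) 0 (by positivity)
  refine ⟨C * U * U * 2 ^ (3 * a), by positivity, fun g f G F hg hf j x => ?_⟩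
  have hG := hg.nonneg
  have hF := hf.nonneg
  refine (h g f _ _ _ _ j hg hf s1 (s1.mul_left _) (fun _ => by positivity)
    (fun _ => by positivity) (fun k l hr => resonant_pos_exponent_le ha hG hF hr) x).trans_eq ?_
  rw [tsum_mul_left]
  ring

/-- Bilinearity of the product rests on this, since `tsum` is additive only on summable families. -/
theorem HolderBound.summable_mul {a β G F : ℝ} {g f : FormalFourierSeries}
    (hg : HolderBound P (-β) G g) (hf : HolderBound P a F f) (hβ : 0 < β) (ha : 2 * β < a)
    (m : Fin 2 → ℤ) : Summable fun n => g n * f (m - n) := by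
  obtain ⟨j, hj⟩ := P.exists_cutoff_ne_zero (freq m)
  have hG := hg.nonneg
  have hF := hf.nonneg
  exact (hasSum_mul_blockCoeff hg hf (summable_two_rpow hβ)
    ((summable_two_rpow (sub_pos.2 ha)).mul_left _) (fun _ => by positivity)
    (fun _ => by positivity) (fun k l hr => resonant_neg_exponent_le hβ hG hF hr) hj).1

theorem mul_sub_of_summable {g f f' : FormalFourierSeries}
    (h : ∀ m, Summable fun n => g n * f (m - n)) (h' : ∀ m, Summable fun n => g n * f' (m - n)) :
    mul g (f - f') = mul g f - mul g f' := by
  ext m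
  simp only [mul, Pi.sub_apply, mul_sub]
  exact (h m).tsum_sub (h' m)

theorem sub_mul_of_summable {g g' f : FormalFourierSeries}
    (h : ∀ m, Summable fun n => g n * f (m - n)) (h' : ∀ m, Summable fun n => g' n * f (m - n)) :
    mul (g - g') f = mul g f - mul g' f := by
  ext m
  simp only [mul, Pi.sub_apply, sub_mul]
  exact (h m).tsum_sub (h' m)

theorem conj_sub (f g : FormalFourierSeries) : conj (f - g) = conj f - conj g := by
  ext m; simp [conj]

end

/-! ### The nonlinearity -/

section

variable {P : DyadicPartition}

theorem mul_zero_right (f : FormalFourierSeries) : mul f 0 = 0 := by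
  ext m; simp [mul]

theorem conj_zero : conj 0 = 0 := by
  ext m; simp [conj]

theorem HolderBound.zero_le {α M : ℝ} (hM : 0 ≤ M) : HolderBound P α M 0 :=
  (holderBound_zero α).mono hM

/-- Bounds for the driving data at time `t`, each according to its degree. -/
structure DriverBound (P : DyadicPartition) (β r : ℝ) (W : Quadruple) (t : ℝ) : Prop where
  Z : HolderBound P (-β) r (W.Z t)
  sq : HolderBound P (-β) (r ^ 2) (W.sq t)
  absSq : HolderBound P (-β) (r ^ 2) (W.absSq t)
  cub : HolderBound P (-β) (r ^ 3) (W.cub t)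

theorem exists_holderBound_mul_sub_mul (P : DyadicPartition) {a : ℝ} (ha : 0 < a) :
    ∃ C : ℝ, 0 < C ∧ ∀ (y y' w w' : FormalFourierSeries) (r D : ℝ), HolderBound P a r y →
      HolderBound P a r y' → HolderBound P a r w → HolderBound P a r w' →
      HolderBound P a D (y - y') → HolderBound P a D (w - w') →
      HolderBound P (a / 2) (C * (r * D)) (mul y w - mul y' w') := by
  obtain ⟨C, hC, h⟩ := exists_holderBound_mul_pos P ha
  refine ⟨2 * C, by positivity, fun y y' w w' r D hy hy' hw hw' hyD hwD => ?_⟩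
  -- The exponent `a/8` serves only to make the convolutions summable; any positive `β` with `2β <
  -- a` would do.
  have hβ : 0 < a / 8 := by positivity
  have hβa : 2 * (a / 8) < a := by linarith
  have hle : -(a / 8) ≤ a := by linarith
  have e : mul y w - mul y' w' = mul y (w - w') + mul (y - y') w' := by
    rw [mul_sub_of_summable ((hy.mono_exponent hle).summable_mul hw hβ hβa)
        ((hy.mono_exponent hle).summable_mul hw' hβ hβa),
      sub_mul_of_summable ((hy.mono_exponent hle).summable_mul hw' hβ hβa)
        ((hy'.mono_exponent hle).summable_mul hw' hβ hβa)]
    abel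
  rw [e]
  exact ((h _ _ _ _ hy hwD).add (h _ _ _ _ hyD hw')).mono (by linarith)

/-- Counting data by degree, every cubic term has total degree three, so its increment costs `r² D`;
the linear term joins them because `1 ≤ r`. Quadratic expressions in `y` lie in `𝒞^{a/2}`, and
multiplying by data in `𝒞^{-a/8}` leads to `𝒞^{-a/4}`. In `|y|² y` the factor `|y|²` is also
regarded as an element of `𝒞^{-a/8}`, so the same product estimate applies. -/
theorem exists_holderBound_nonlinearity_sub (P : DyadicPartition) (ν lam : ℂ) {a : ℝ}
    (ha : 0 < a) :
    ∃ C : ℝ, 0 < C ∧ ∀ (W : Quadruple) (t r D : ℝ) (y y' : FormalFourierSeries), 1 ≤ r →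
      DriverBound P (a / 8) r W t → HolderBound P a r y → HolderBound P a r y' →
      HolderBound P a D (y - y') →
      HolderBound P (-(a / 4)) (C * (r ^ 2 * D))
        (nonlinearity ν lam y W t - nonlinearity ν lam y' W t) := by
  have hβ : 0 < a / 8 := by positivity
  have hβa : 2 * (a / 8) < a := by linarith
  have hβa2 : 2 * (a / 8) < a / 2 := by linarith
  have hle : -(a / 8) ≤ a / 2 := by linarith
  have h2β : -(2 * (a / 8)) = -(a / 4) := by ring
  obtain ⟨C₁, hC₁, h₁⟩ := exists_holderBound_mul_neg P hβ hβa
  obtain ⟨C₂, hC₂, h₂⟩ := exists_holderBound_mul_neg P hβ hβa2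
  obtain ⟨C₃, hC₃, h₃⟩ := exists_holderBound_mul_pos P ha
  obtain ⟨C₄, hC₄, h₄⟩ := exists_holderBound_mul_sub_mul P ha
  rw [h2β] at h₁ h₂
  set E₁ : ℝ := 2 ^ (a - -(a / 4)) with hE₁
  set E₂ : ℝ := 2 ^ (a / 2 - -(a / 8)) with hE₂
  have hE₁0 : 0 < E₁ := by positivity
  have hE₂0 : 0 < E₂ := by positivity
  -- The summands belong to the linear term, `|Y|²Y`, `2Z|Y|²`, `Z̄Y²`, `2|Z|²Y` and `Z²Ȳ` in turn;
  -- the final 1 ensures positivity.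
  refine ⟨‖1 + lam‖ * E₁ + ‖ν‖ * (C₁ * E₂ * (C₃ + C₄) + 2 * (C₂ * C₄) + C₂ * C₄ + 2 * C₁ + C₁) + 1,
    by positivity, fun W t r D y y' hr hW hy hy' hD => ?_⟩
  have hD0 := hD.nonneg
  have hr0 : 0 ≤ r := by linarith
  have hcD : HolderBound P a D (conj y - conj y') := by rw [← conj_sub]; exact hD.conj
  have hA := h₄ _ _ _ _ r D hy hy' hy.conj hy'.conj hD hcD
  have hB := h₄ _ _ _ _ r D hy hy' hy hy' hD hD
  have hyy := h₃ _ _ _ _ hy hy.conj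
  have hyy' := h₃ _ _ _ _ hy' hy'.conj
  have hy2 := h₃ _ _ _ _ hy hy
  have hy2' := h₃ _ _ _ _ hy' hy'
  have hcub : HolderBound P (-(a / 4)) (C₁ * E₂ * (C₃ + C₄) * (r ^ 2 * D))
      (mul (mul y (conj y)) y - mul (mul y' (conj y')) y') := by
    have e : mul (mul y (conj y)) y - mul (mul y' (conj y')) y' =
        mul (mul y (conj y)) (y - y') + mul (mul y (conj y) - mul y' (conj y')) y' := by
      rw [mul_sub_of_summable ((hyy.mono_exponent hle).summable_mul hy hβ hβa)
          ((hyy.mono_exponent hle).summable_mul hy' hβ hβa),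
        sub_mul_of_summable ((hyy.mono_exponent hle).summable_mul hy' hβ hβa)
          ((hyy'.mono_exponent hle).summable_mul hy' hβ hβa)]
      abel
    rw [e]
    exact ((h₁ _ _ _ _ (hyy.mono_exponent hle) hD).add
      (h₁ _ _ _ _ (hA.mono_exponent hle) hy')).mono (le_of_eq (by ring))
  have e₁ : mul (W.Z t) (mul y (conj y)) - mul (W.Z t) (mul y' (conj y')) =
      mul (W.Z t) (mul y (conj y) - mul y' (conj y')) :=
    (mul_sub_of_summable (hW.Z.summable_mul hyy hβ hβa2) (hW.Z.summable_mul hyy' hβ hβa2)).symm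
  have e₂ : mul (conj (W.Z t)) (mul y y) - mul (conj (W.Z t)) (mul y' y') =
      mul (conj (W.Z t)) (mul y y - mul y' y') :=
    (mul_sub_of_summable (hW.Z.conj.summable_mul hy2 hβ hβa2)
      (hW.Z.conj.summable_mul hy2' hβ hβa2)).symm
  have e₃ : mul (W.absSq t) y - mul (W.absSq t) y' = mul (W.absSq t) (y - y') :=
    (mul_sub_of_summable (hW.absSq.summable_mul hy hβ hβa)
      (hW.absSq.summable_mul hy' hβ hβa)).symm
  have e₄ : mul (W.sq t) (conj y) - mul (W.sq t) (conj y') = mul (W.sq t) (conj y - conj y') :=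
    (mul_sub_of_summable (hW.sq.summable_mul hy.conj hβ hβa)
      (hW.sq.summable_mul hy'.conj hβ hβa)).symm
  have e : nonlinearity ν lam y W t - nonlinearity ν lam y' W t =
      (1 + lam) • (y - y') - ν • ((mul (mul y (conj y)) y - mul (mul y' (conj y')) y') +
        (2 : ℂ) • mul (W.Z t) (mul y (conj y) - mul y' (conj y')) +
        mul (conj (W.Z t)) (mul y y - mul y' y') + (2 : ℂ) • mul (W.absSq t) (y - y') +
        mul (W.sq t) (conj y - conj y')) := by
    rw [← e₁, ← e₂, ← e₃, ← e₄, nonlinearity, nonlinearity]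
    module
  rw [e]
  have hlin := (hD.mono_exponent (show -(a / 4) ≤ a by linarith)).smul (1 + lam)
  have hall := hlin.sub (((((hcub.add ((h₂ _ _ _ _ hW.Z hA).smul 2)).add
    (h₂ _ _ _ _ hW.Z.conj hB)).add ((h₁ _ _ _ _ hW.absSq hD).smul 2)).add
    (h₁ _ _ _ _ hW.sq hcD)).smul ν)
  refine hall.mono ?_
  rw [← hE₁, Complex.norm_ofNat]
  have hDr : D ≤ r ^ 2 * D := le_mul_of_one_le_left hD0 (one_le_pow₀ hr)
  have h5 : ‖1 + lam‖ * (E₁ * D) ≤ ‖1 + lam‖ * E₁ * (r ^ 2 * D) := by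
    rw [mul_assoc]; gcongr
  linarith

theorem exists_holderBound_nonlinearity (P : DyadicPartition) (ν lam : ℂ) {a : ℝ}
    (ha : 0 < a) :
    ∃ C : ℝ, 0 < C ∧ ∀ (W : Quadruple) (t r : ℝ) (y : FormalFourierSeries), 1 ≤ r →
      DriverBound P (a / 8) r W t → HolderBound P a r y →
      HolderBound P (-(a / 4)) (C * r ^ 3) (nonlinearity ν lam y W t) := by
  obtain ⟨C, hC, h⟩ := exists_holderBound_nonlinearity_sub P ν lam ha
  set E : ℝ := 2 ^ (-(a / 8) - -(a / 4)) with hE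
  have hE0 : 0 < E := by positivity
  refine ⟨C + E * (‖1 + lam‖ + ‖ν‖), by positivity, fun W t r y hr hW hy => ?_⟩
  have hr0 : 0 ≤ r := by linarith
  have e : nonlinearity ν lam 0 W t = (1 + lam) • W.Z t - ν • W.cub t := by
    simp only [nonlinearity, mul_zero_right, conj_zero, smul_zero, add_zero,
      zero_add]
  -- The size of `Ψ(y)` is that of the increment from `0` to `y`, with `D = r`, plus `Ψ(0)`, which
  -- involves only `Z` and `|Z|²Z`.
  have h1 := h W t r r y 0 hr hW hy (HolderBound.zero_le hr0) (by simpa using hy)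
  have h2 := (hW.Z.smul (1 + lam)).sub (hW.cub.smul ν)
  rw [← e] at h2
  have h3 := h1.add (h2.mono_exponent (show -(a / 4) ≤ -(a / 8) by linarith))
  rw [sub_add_cancel] at h3
  refine h3.mono ?_
  rw [← hE]
  have h4 : r ≤ r ^ 3 := le_self_pow₀ hr (by norm_num)
  have h5 : E * (‖1 + lam‖ * r) ≤ E * (‖1 + lam‖ * r ^ 3) := by gcongr
  linarith

end

/-! ### The Duhamel integral -/

/-- On either side of `t/2` only one factor is singular. Adding the two cases gives a majorant that
integrates by elementary means, so the Beta integral is not needed. -/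
theorem sub_rpow_mul_rpow_le {t s q η : ℝ} (hq : 0 ≤ q) (hη : 0 ≤ η) (hs : s ∈ Set.Ioo 0 t) :
    (t - s) ^ (-q) * s ^ (-η) ≤
      (t / 2) ^ (-q) * s ^ (-η) + (t / 2) ^ (-η) * (t - s) ^ (-q) := by
  have hs0 := hs.1
  have hts : 0 < t - s := sub_pos.2 hs.2
  have ht : 0 < t := hs.1.trans hs.2
  rcases le_total s (t / 2) with h | h
  · have h1 : (t - s) ^ (-q) ≤ (t / 2) ^ (-q) :=
      Real.rpow_le_rpow_of_nonpos (by positivity) (by linarith) (by linarith)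
    have h2 : 0 ≤ (t / 2) ^ (-η) * (t - s) ^ (-q) := by positivity
    have h3 := mul_le_mul_of_nonneg_right h1 (Real.rpow_nonneg hs0.le (-η))
    linarith
  · have h1 : s ^ (-η) ≤ (t / 2) ^ (-η) :=
      Real.rpow_le_rpow_of_nonpos (by positivity) h (by linarith)
    have h2 : 0 ≤ (t / 2) ^ (-q) * s ^ (-η) := by positivity
    have h3 := mul_le_mul_of_nonneg_right h1 (Real.rpow_nonneg hts.le (-q))
    linarith

theorem intervalIntegrable_sub_rpow {q : ℝ} (hq : q < 1) (t : ℝ) :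
    IntervalIntegrable (fun s => (t - s) ^ (-q)) volume 0 t := by
  have := (intervalIntegral.intervalIntegrable_rpow' (a := t) (b := 0)
    (show -1 < -q by linarith)).comp_sub_left t
  simpa using this

theorem exists_integral_sub_rpow_mul_rpow_le {q η : ℝ} (hq : q ∈ Set.Ico (0 : ℝ) 1)
    (hη : η ∈ Set.Ico (0 : ℝ) 1) :
    ∃ C : ℝ, 0 < C ∧ ∀ t : ℝ, 0 < t →
      IntervalIntegrable (fun s => (t - s) ^ (-q) * s ^ (-η)) volume 0 t ∧
      ∫ s in (0 : ℝ)..t, (t - s) ^ (-q) * s ^ (-η) ≤ C * t ^ (1 - q - η) := by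
  have hq1 : 0 < 1 - q := sub_pos.2 hq.2
  have hη1 : 0 < 1 - η := sub_pos.2 hη.2
  refine ⟨2 ^ q / (1 - η) + 2 ^ η / (1 - q), by positivity, fun t ht => ?_⟩
  have i1 : IntervalIntegrable (fun s : ℝ => (t / 2) ^ (-q) * s ^ (-η)) volume 0 t :=
    (intervalIntegral.intervalIntegrable_rpow' (by linarith)).const_mul _
  have i2 : IntervalIntegrable (fun s : ℝ => (t / 2) ^ (-η) * (t - s) ^ (-q)) volume 0 t :=
    (intervalIntegrable_sub_rpow hq.2 t).const_mul _
  have hle : ∀ᵐ s ∂volume.restrict (Set.Ioc 0 t), (t - s) ^ (-q) * s ^ (-η) ≤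
      (t / 2) ^ (-q) * s ^ (-η) + (t / 2) ^ (-η) * (t - s) ^ (-q) := by
    rw [← Measure.restrict_congr_set Ioo_ae_eq_Ioc]
    filter_upwards [ae_restrict_mem measurableSet_Ioo] with s hs
    exact sub_rpow_mul_rpow_le hq.1 hη.1 hs
  have hnn : ∀ᵐ s ∂volume.restrict (Set.Ioc 0 t), 0 ≤ (t - s) ^ (-q) * s ^ (-η) := by
    filter_upwards [ae_restrict_mem measurableSet_Ioc] with s hs
    exact mul_nonneg (Real.rpow_nonneg (sub_nonneg.2 hs.2) _) (Real.rpow_nonneg hs.1.le _)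
  have i3 : IntervalIntegrable (fun s => (t - s) ^ (-q) * s ^ (-η)) volume 0 t := by
    rw [intervalIntegrable_iff_integrableOn_Ioc_of_le ht.le]
    refine Integrable.mono' ((intervalIntegrable_iff_integrableOn_Ioc_of_le ht.le).1 (i1.add i2))
      (by fun_prop) ?_
    filter_upwards [hle, hnn] with s h1 h2
    rwa [Real.norm_of_nonneg h2]
  refine ⟨i3, ?_⟩
  have e1 : ∫ s in (0 : ℝ)..t, s ^ (-η) = t ^ (1 - η) / (1 - η) := by
    rw [integral_rpow (Or.inl (by linarith)), Real.zero_rpow (by linarith)]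
    rw [sub_zero, neg_add_eq_sub]
  have e2 : ∫ s in (0 : ℝ)..t, (t - s) ^ (-q) = t ^ (1 - q) / (1 - q) := by
    rw [intervalIntegral.integral_comp_sub_left (fun s => s ^ (-q)), sub_self, sub_zero,
      integral_rpow (Or.inl (by linarith)), Real.zero_rpow (by linarith)]
    rw [sub_zero, neg_add_eq_sub]
  have hsplit : ∀ x y : ℝ, (t / 2) ^ (-x) * t ^ (1 - y) = 2 ^ x * t ^ (1 - x - y) := by
    intro x y
    rw [Real.div_rpow ht.le zero_le_two, Real.rpow_neg zero_le_two, div_inv_eq_mul,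
      mul_right_comm, ← Real.rpow_add ht, mul_comm]
    congr 2; ring
  calc ∫ s in (0 : ℝ)..t, (t - s) ^ (-q) * s ^ (-η)
      ≤ ∫ s in (0 : ℝ)..t, ((t / 2) ^ (-q) * s ^ (-η) + (t / 2) ^ (-η) * (t - s) ^ (-q)) := by
        rw [intervalIntegral.integral_of_le ht.le, intervalIntegral.integral_of_le ht.le]
        exact integral_mono_ae ((intervalIntegrable_iff_integrableOn_Ioc_of_le ht.le).1 i3)
          ((intervalIntegrable_iff_integrableOn_Ioc_of_le ht.le).1 (i1.add i2)) hle
    _ = ((t / 2) ^ (-q) * t ^ (1 - η)) / (1 - η) + ((t / 2) ^ (-η) * t ^ (1 - q)) / (1 - q) := by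
        rw [intervalIntegral.integral_add i1 i2, intervalIntegral.integral_const_mul,
          intervalIntegral.integral_const_mul, e1, e2]
        ring
    _ = _ := by
        rw [hsplit, hsplit, show 1 - η - q = 1 - q - η by ring]; ring

/-- This is `y^ε ≤ e^y` at `y = λ(t - s)`. A slightly more singular kernel buys the small factor
`λ^{-ε}`. -/
theorem exp_mul_le {lam ε s t : ℝ} (hlam : 0 < lam) (hε : ε ∈ Set.Icc (0 : ℝ) 1) (h : s < t) :
    Real.exp (lam * s) ≤ Real.exp (lam * t) * lam ^ (-ε) * (t - s) ^ (-ε) := by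
  have hts : 0 < t - s := sub_pos.2 h
  set y := lam * (t - s) with hy
  have hy0 : 0 < y := by positivity
  have h1 : y ^ ε ≤ Real.exp y := by
    rcases le_total y 1 with h1 | h1
    · exact (Real.rpow_le_one hy0.le h1 hε.1).trans (Real.one_le_exp hy0.le)
    · calc y ^ ε ≤ y ^ (1 : ℝ) := Real.rpow_le_rpow_of_exponent_le h1 hε.2
        _ ≤ Real.exp y := by rw [Real.rpow_one]; linarith [Real.add_one_le_exp y]
  have h2 : Real.exp (lam * t) = Real.exp (lam * s) * Real.exp y := by
    rw [← Real.exp_add, hy]; ring_nf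
  rw [mul_assoc, ← Real.mul_rpow hlam.le hts.le, ← hy, Real.rpow_neg hy0.le, ← div_eq_mul_inv,
    le_div_iff₀ (by positivity), h2]
  gcongr

section

variable {P : DyadicPartition}

/-- The Duhamel integral `∫₀ᵗ e^{(t-s)A} F_s ds`. -/
def duhamel (μ : ℝ) (F : ℝ → FormalFourierSeries) (t : ℝ) : FormalFourierSeries :=
  fun m => ∫ s in (0 : ℝ)..t, semigroup μ (t - s) (F s) m

theorem block_duhamel {μ t : ℝ} {F : ℝ → FormalFourierSeries}
    (hF : ∀ m, IntervalIntegrable (fun s => semigroup μ (t - s) (F s) m) volume 0 t) (j : ℕ)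
    (x : UnitAddTorus (Fin 2)) :
    block P j (duhamel μ F t) x = ∫ s in (0 : ℝ)..t, block P j (semigroup μ (t - s) (F s)) x := by
  simp only [block_eq_sum, duhamel]
  rw [intervalIntegral.integral_finsetSum fun m _ => ((hF m).const_mul _).mul_const _]
  refine Finset.sum_congr rfl fun m _ => ?_
  rw [intervalIntegral.integral_mul_const, intervalIntegral.integral_const_mul]

/-- The parameter `ε` leaves room for the singularity created by an exponential weight: it is `1/8`
for uniqueness and `0` for existence. -/
theorem exists_holderBound_duhamel (P : DyadicPartition) {μ : ℝ} (hμ : 0 < μ) {p ε η : ℝ}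
    (hp : p ∈ Set.Icc (0 : ℝ) 1) (hε : 0 ≤ ε) (hpε : p + ε < 1) (hη : η ∈ Set.Ico (0 : ℝ) 1) :
    ∃ C : ℝ, 0 < C ∧ ∀ (α A t : ℝ) (F : ℝ → FormalFourierSeries), t ∈ Set.Ioc (0 : ℝ) 1 →
      (∀ m, IntervalIntegrable (fun s => semigroup μ (t - s) (F s) m) volume 0 t) →
      0 ≤ A →
      (∀ s ∈ Set.Ioo 0 t, HolderBound P α (A * ((t - s) ^ (-ε) * s ^ (-η))) (F s)) →
      HolderBound P (α + 2 * p) (C * (A * t ^ (1 - (p + ε) - η))) (duhamel μ F t) := by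
  obtain ⟨C₁, hC₁, h₁⟩ := exists_holderBound_semigroup P hμ
  obtain ⟨C₂, hC₂, h₂⟩ := exists_integral_sub_rpow_mul_rpow_le (q := p + ε)
    ⟨add_nonneg hp.1 hε, hpε⟩ hη
  refine ⟨C₁ * C₂, by positivity, fun α A t F ht hF hA hb j x => ?_⟩
  have ht0 := ht.1
  obtain ⟨hint, hle⟩ := h₂ t ht0
  set w : ℝ := (2 : ℝ) ^ (-((α + 2 * p) * ((j : ℝ) - 1))) with hw
  have hw0 : 0 < w := by positivity
  rw [block_duhamel hF]
  calc ‖∫ s in (0 : ℝ)..t, block P j (semigroup μ (t - s) (F s)) x‖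
      ≤ ∫ s in (0 : ℝ)..t, C₁ * A * w * ((t - s) ^ (-(p + ε)) * s ^ (-η)) := by
        refine intervalIntegral.norm_integral_le_of_norm_le ht0.le ?_ (hint.const_mul _)
        have hne : ∀ᵐ s : ℝ, s ≠ t := by simp [ae_iff]
        filter_upwards [hne] with s hst hs
        have hs' : s ∈ Set.Ioo 0 t := ⟨hs.1, lt_of_le_of_ne hs.2 hst⟩
        have hts : 0 < t - s := sub_pos.2 hs'.2
        refine (h₁ (t - s) ⟨hts, by linarith [ht.2, hs.1]⟩ p hp α _ _ (hb s hs') j x).trans_eq ?_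
        rw [neg_add, Real.rpow_add hts]
        ring
    _ = C₁ * A * w * ∫ s in (0 : ℝ)..t, (t - s) ^ (-(p + ε)) * s ^ (-η) :=
        intervalIntegral.integral_const_mul _ _
    _ ≤ C₁ * A * w * (C₂ * t ^ (1 - (p + ε) - η)) := by gcongr
    _ = _ := by ring

theorem semigroup_sub (μ t : ℝ) (f g : FormalFourierSeries) :
    semigroup μ t (f - g) = semigroup μ t f - semigroup μ t g := by
  ext m; simp only [semigroup, Pi.sub_apply, mul_sub]

theorem duhamel_sub {μ t : ℝ} {F G : ℝ → FormalFourierSeries}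
    (hF : ∀ m, IntervalIntegrable (fun s => semigroup μ (t - s) (F s) m) volume 0 t)
    (hG : ∀ m, IntervalIntegrable (fun s => semigroup μ (t - s) (G s) m) volume 0 t) :
    (∀ m, IntervalIntegrable (fun s => semigroup μ (t - s) ((F - G) s) m) volume 0 t) ∧
      duhamel μ (F - G) t = duhamel μ F t - duhamel μ G t := by
  have e : ∀ m, (fun s => semigroup μ (t - s) ((F - G) s) m) =
      fun s => semigroup μ (t - s) (F s) m - semigroup μ (t - s) (G s) m := by
    intro m; ext s
    rw [Pi.sub_apply, semigroup_sub, Pi.sub_apply]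
  refine ⟨fun m => by rw [e]; exact (hF m).sub (hG m), ?_⟩
  ext m
  exact (congrArg (fun h : ℝ → ℂ => ∫ s in (0 : ℝ)..t, h s) (e m)).trans
    (intervalIntegral.integral_sub (hF m) (hG m))

/-! ### Uniqueness -/

/-- Starting from the crude bound `2R t^{-g}`, each use of the mild equation halves the norm of the
difference weighted by `e^{-λt} t^g`. The halving comes from the size of `λ`, so `R` may be
arbitrarily large for the given `T`. -/
theorem eqOn_of_mild (P : DyadicPartition) {μ : ℝ} (hμ : 0 < μ) (ν lam : ℂ) {a g R T : ℝ}
    (ha : a ∈ Set.Ioc (0 : ℝ) (1 / 3)) (hg : g ∈ Set.Ioo (0 : ℝ) (1 / 3)) (hR : 1 ≤ R)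
    (hT : T ≤ 1) {W : Quadruple} {Y₀ : FormalFourierSeries} {Y Y' : ℝ → FormalFourierSeries}
    (hW : ∀ t ∈ Set.Ioc 0 T, DriverBound P (a / 8) (R * t ^ (-g)) W t)
    (hY : ∀ t ∈ Set.Ioc 0 T, HolderBound P a (R * t ^ (-g)) (Y t))
    (hY' : ∀ t ∈ Set.Ioc 0 T, HolderBound P a (R * t ^ (-g)) (Y' t))
    (hint : ∀ t ∈ Set.Ioc 0 T, ∀ m, IntervalIntegrable
      (fun s => semigroup μ (t - s) (nonlinearity ν lam (Y s) W s) m) volume 0 t)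
    (hint' : ∀ t ∈ Set.Ioc 0 T, ∀ m, IntervalIntegrable
      (fun s => semigroup μ (t - s) (nonlinearity ν lam (Y' s) W s) m) volume 0 t)
    (heq : ∀ t ∈ Set.Ioc 0 T,
      Y t = semigroup μ t Y₀ + duhamel μ (fun s => nonlinearity ν lam (Y s) W s) t)
    (heq' : ∀ t ∈ Set.Ioc 0 T,
      Y' t = semigroup μ t Y₀ + duhamel μ (fun s => nonlinearity ν lam (Y' s) W s) t) :
    Set.EqOn Y Y' (Set.Ioc 0 T) := by
  have ha0 := ha.1
  have ha1 := ha.2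
  have hg0 := hg.1
  have hg1 := hg.2
  have hR0 : 0 < R := by linarith
  obtain ⟨C₁, hC₁, h₁⟩ := exists_holderBound_nonlinearity_sub P ν lam ha0
  obtain ⟨C₂, hC₂, h₂⟩ := exists_holderBound_duhamel P hμ (p := 5 * a / 8) (ε := 1 / 8)
    (η := 3 * g) ⟨by positivity, by linarith⟩ (by norm_num) (by linarith)
    ⟨by positivity, by linarith⟩
  -- The eighth power undoes `λ^{-1/8}` and makes the contraction factor exactly `1/2`.
  set lm : ℝ := (2 * (C₂ * C₁ * R ^ 2)) ^ (8 : ℝ) with hlm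
  have hlm0 : 0 < lm := by positivity
  have hlmε : C₂ * C₁ * R ^ 2 * lm ^ (-(1 / 8) : ℝ) = 1 / 2 := by
    rw [hlm, ← Real.rpow_mul (by positivity)]
    norm_num
    rw [Real.rpow_neg_one]
    field_simp
  have key : ∀ n : ℕ, ∀ t ∈ Set.Ioc 0 T,
      HolderBound P a (2 * R * (1 / 2) ^ n * (Real.exp (lm * t) * t ^ (-g))) (Y t - Y' t) := by
    intro n
    induction n with
    | zero =>
      intro t ht
      refine ((hY t ht).sub (hY' t ht)).mono ?_
      have h1 : 1 ≤ Real.exp (lm * t) := Real.one_le_exp (mul_nonneg hlm0.le ht.1.le)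
      have h2 : 0 ≤ t ^ (-g) := Real.rpow_nonneg ht.1.le _
      have h3 := mul_le_mul_of_nonneg_right h1 h2
      rw [pow_zero]
      nlinarith
    | succ n ih =>
      intro t ht
      have ht0 := ht.1
      obtain ⟨hsi, hsd⟩ := duhamel_sub (hint t ht) (hint' t ht)
      set A : ℝ := C₁ * R ^ 2 * (2 * R * (1 / 2) ^ n) *
        (Real.exp (lm * t) * lm ^ (-(1 / 8) : ℝ)) with hA
      have hdu := h₂ (-(a / 4)) A t _ ⟨ht0, ht.2.trans hT⟩ hsi (by positivity) fun s hs => by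
        have hs0 := hs.1
        have hsT : s ∈ Set.Ioc 0 T := ⟨hs0, hs.2.le.trans ht.2⟩
        have hs1 : 1 ≤ s ^ (-g) :=
          Real.one_le_rpow_of_pos_of_le_one_of_nonpos hs0 (hsT.2.trans hT) (by linarith)
        refine (h₁ W s (R * s ^ (-g)) _ _ _ (one_le_mul_of_one_le_of_one_le hR hs1) (hW s hsT)
          (hY s hsT) (hY' s hsT) (ih s hsT)).mono ?_
        have hexp := exp_mul_le hlm0 (ε := 1 / 8) ⟨by norm_num, by norm_num⟩ hs.2
        have e3 : s ^ (-(3 * g)) = s ^ (-g) * s ^ (-g) * s ^ (-g) := by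
          rw [← Real.rpow_add hs0, ← Real.rpow_add hs0]; congr 1; ring
        calc C₁ * ((R * s ^ (-g)) ^ 2 *
              (2 * R * (1 / 2) ^ n * (Real.exp (lm * s) * s ^ (-g))))
            = C₁ * R ^ 2 * (2 * R * (1 / 2) ^ n) * s ^ (-(3 * g)) * Real.exp (lm * s) := by
              rw [e3]; ring
          _ ≤ C₁ * R ^ 2 * (2 * R * (1 / 2) ^ n) * s ^ (-(3 * g)) *
              (Real.exp (lm * t) * lm ^ (-(1 / 8) : ℝ) * (t - s) ^ (-(1 / 8) : ℝ)) := by gcongr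
          _ = A * ((t - s) ^ (-(1 / 8) : ℝ) * s ^ (-(3 * g))) := by rw [hA]; ring
      have hYY : Y t - Y' t = duhamel μ ((fun s => nonlinearity ν lam (Y s) W s) -
          fun s => nonlinearity ν lam (Y' s) W s) t := by
        rw [hsd, heq t ht, heq' t ht]; abel
      rw [hYY]
      rw [show -(a / 4) + 2 * (5 * a / 8) = a by ring] at hdu
      refine hdu.mono ?_
      -- From `5a/8 ≤ 5/24` and `2g < 2/3`, the number `1 - 5a/8 - 1/8 - 2g` is positive.
      have htle : t ^ (1 - (5 * a / 8 + 1 / 8) - 3 * g) ≤ t ^ (-g) :=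
        Real.rpow_le_rpow_of_exponent_ge ht0 (ht.2.trans hT) (by linarith)
      calc C₂ * (A * t ^ (1 - (5 * a / 8 + 1 / 8) - 3 * g)) ≤ C₂ * (A * t ^ (-g)) := by gcongr
        _ = (C₂ * C₁ * R ^ 2 * lm ^ (-(1 / 8) : ℝ)) * (2 * R * (1 / 2) ^ n) *
            (Real.exp (lm * t) * t ^ (-g)) := by rw [hA]; ring
        _ = _ := by rw [hlmε, pow_succ]; ring
  intro t ht
  rw [← sub_eq_zero]
  refine HolderBound.eq_zero (P := P) (α := a) fun j x => ?_
  have hlim : Filter.Tendsto (fun n : ℕ => 2 * R * (1 / 2 : ℝ) ^ n *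
      (Real.exp (lm * t) * t ^ (-g)) * 2 ^ (-(a * ((j : ℝ) - 1)))) Filter.atTop (𝓝 (0 *
        2 ^ (-(a * ((j : ℝ) - 1))))) := by
    refine Filter.Tendsto.mul_const _ ?_
    have := ((tendsto_pow_atTop_nhds_zero_of_lt_one (r := (1 / 2 : ℝ)) (by norm_num)
      (by norm_num)).const_mul (2 * R)).mul_const (Real.exp (lm * t) * t ^ (-g))
    simpa using this
  exact ge_of_tendsto' hlim fun n => key n t ht j x

end

/-! ### Continuity in time -/

section

variable {P : DyadicPartition}

theorem ContinuousInto.continuousOn_coeff {α : ℝ} {I : Set ℝ} {F : ℝ → FormalFourierSeries}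
    (h : ContinuousInto P α I F) (m : Fin 2 → ℤ) : ContinuousOn (fun s => F s m) I := by
  obtain ⟨C, N, hC, hcoeff⟩ := exists_norm_coeff_le P α
  intro t ht
  have hlim := (h t ht).2
  rw [ContinuousWithinAt, tendsto_iff_norm_sub_tendsto_zero]
  have hreal : Filter.Tendsto (fun s => C * (1 + ‖m‖) ^ N * (holderNorm P α (F s - F t)).toReal)
      (𝓝[I] t) (𝓝 0) := by
    have := ((ENNReal.tendsto_toReal ENNReal.zero_ne_top).comp hlim).const_mul
      (C * (1 + ‖m‖) ^ N)
    simpa using this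
  refine squeeze_zero' (Filter.Eventually.of_forall fun _ => norm_nonneg _) ?_ hreal
  filter_upwards [hlim.eventually_lt_const ENNReal.zero_lt_top] with s hs
  exact hcoeff _ _ ((holderNorm_le_ofReal_iff ENNReal.toReal_nonneg).1
    (ENNReal.ofReal_toReal hs.ne).ge) m

theorem tendsto_block {ι : Type*} {l : Filter ι} {F : ι → FormalFourierSeries}
    {f : FormalFourierSeries} (h : ∀ m, Filter.Tendsto (fun i => F i m) l (𝓝 (f m))) (j : ℕ)
    (x : UnitAddTorus (Fin 2)) :
    Filter.Tendsto (fun i => block P j (F i) x) l (𝓝 (block P j f x)) := by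
  simp only [block_eq_sum]
  exact tendsto_finsetSum _ fun m _ => ((h m).const_mul _).mul_const _

theorem HolderBound.of_tendsto {ι : Type*} {l : Filter ι} [l.NeBot] {α M : ℝ}
    {F : ι → FormalFourierSeries} {f : FormalFourierSeries}
    (h : ∀ m, Filter.Tendsto (fun i => F i m) l (𝓝 (f m)))
    (hb : ∀ᶠ i in l, HolderBound P α M (F i)) : HolderBound P α M f := fun j x =>
  le_of_tendsto (tendsto_block h j x).norm (hb.mono fun _ hi => hi j x)

/-- Coefficientwise continuous paths that are locally bounded in `𝒞^α` are continuous in `𝒞^β`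
for `β < α`. -/
theorem continuousInto_of_locally_bounded {α β : ℝ} (hβ : β < α) {I : Set ℝ}
    {F : ℝ → FormalFourierSeries} (hc : ∀ m, ContinuousOn (fun s => F s m) I)
    (hb : ∀ t ∈ I, ∃ M, ∀ᶠ s in 𝓝[I] t, HolderBound P α M (F s)) : ContinuousInto P β I F := by
  intro t ht
  obtain ⟨M, hM⟩ := hb t ht
  have hMt := hM.self_of_nhdsWithin ht
  have hM0 := hMt.nonneg
  refine ⟨(hMt.mono_exponent hβ.le).memHolder, ENNReal.tendsto_nhds_zero.2 fun e he => ?_⟩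
  obtain ⟨η, hη0, hηe⟩ : ∃ η : ℝ, 0 < η ∧ ENNReal.ofReal η ≤ e := by
    rcases eq_or_ne e ⊤ with rfl | htop
    · exact ⟨1, one_pos, le_top⟩
    · exact ⟨e.toReal, ENNReal.toReal_pos he.ne' htop, ENNReal.ofReal_toReal_le⟩
  -- The spare regularity `α - β` makes the blocks beyond some `J` uniformly small; the remaining
  -- ones involve finitely many coefficients, each continuous.
  have hlim : Filter.Tendsto (fun j : ℕ => 2 * M * 2 ^ (α - β) * (2 : ℝ) ^ (-((α - β) * j)))
      Filter.atTop (𝓝 0) := by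
    simpa using ((summable_two_rpow (sub_pos.2 hβ)).tendsto_atTop_zero).const_mul
      (2 * M * 2 ^ (α - β))
  obtain ⟨J, hJ⟩ := Filter.eventually_atTop.1 (hlim.eventually_le_const hη0)
  have hlow : ∀ᶠ s in 𝓝[I] t, ∀ j ∈ Finset.range J,
      ∑ m ∈ (support_cutoff_finite P j).toFinset, ‖F s m - F t m‖ ≤
        η * (2 : ℝ) ^ (-(β * ((j : ℝ) - 1))) := by
    rw [Filter.eventually_all_finset]
    intro j _
    have h0 : Filter.Tendsto (fun s => ∑ m ∈ (support_cutoff_finite P j).toFinset,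
        ‖F s m - F t m‖) (𝓝[I] t) (𝓝 (∑ _m ∈ (support_cutoff_finite P j).toFinset, 0)) :=
      tendsto_finsetSum _ fun m _ => tendsto_iff_norm_sub_tendsto_zero.1 (hc m t ht)
    rw [Finset.sum_const_zero] at h0
    exact h0.eventually_le_const (by positivity)
  filter_upwards [hM, hlow] with s hs hls
  refine le_trans ((holderNorm_le_ofReal_iff hη0.le).2 fun j x => ?_) hηe
  rcases lt_or_ge j J with hj | hj
  · refine le_trans ?_ (hls j (Finset.mem_range.2 hj))
    rw [block_eq_sum]
    refine norm_sum_le_of_le _ fun m _ => ?_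
    rw [norm_mul, norm_mul, norm_mFourier_apply, mul_one, Complex.norm_real,
      Real.norm_of_nonneg (P.cutoff_mem _ _).1]
    exact mul_le_of_le_one_left (norm_nonneg _) (P.cutoff_mem _ _).2
  · refine ((hs.sub hMt) j x).trans ?_
    have e1 : (2 : ℝ) ^ (-(α * ((j : ℝ) - 1))) =
        2 ^ (α - β) * 2 ^ (-((α - β) * j)) * 2 ^ (-(β * ((j : ℝ) - 1))) := by
      rw [← Real.rpow_add zero_lt_two, ← Real.rpow_add zero_lt_two]; congr 1; ring
    rw [e1, ← mul_assoc]
    refine mul_le_mul_of_nonneg_right ?_ (by positivity)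
    exact (hJ j hj).trans' (le_of_eq (by ring))

/-! ### Measurability in time -/

theorem aestronglyMeasurable_tsum {ι X : Type*} [Countable ι] [MeasurableSpace X] {m : Measure X}
    {F : ι → X → ℂ} (hF : ∀ i, AEStronglyMeasurable (F i) m)
    (hs : ∀ᵐ x ∂m, Summable fun i => F i x) :
    AEStronglyMeasurable (fun x => ∑' i, F i x) m := by
  refine aestronglyMeasurable_of_tendsto_ae (u := Filter.atTop)
    (f := fun (s : Finset ι) x => ∑ i ∈ s, F i x)
    (fun s => Finset.aestronglyMeasurable_fun_sum s fun i _ => hF i) ?_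
  filter_upwards [hs] with x hx
  exact hx.hasSum

/-- All Fourier coefficients of the path are measurable on `(0, T]`. -/
def CoeffMeasurable (T : ℝ) (F : ℝ → FormalFourierSeries) : Prop :=
  ∀ m, AEStronglyMeasurable (fun s => F s m) (volume.restrict (Set.Ioc 0 T))

theorem CoeffMeasurable.mul {T : ℝ} {F G : ℝ → FormalFourierSeries} (hF : CoeffMeasurable T F)
    (hG : CoeffMeasurable T G)
    (hs : ∀ s ∈ Set.Ioc 0 T, ∀ m, Summable fun n => F s n * G s (m - n)) :
    CoeffMeasurable T fun s => mul (F s) (G s) := fun m =>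
  aestronglyMeasurable_tsum (fun n => (hF n).mul (hG (m - n))) (by
    filter_upwards [ae_restrict_mem measurableSet_Ioc] with s h using hs s h m)

theorem CoeffMeasurable.conj {T : ℝ} {F : ℝ → FormalFourierSeries} (hF : CoeffMeasurable T F) :
    CoeffMeasurable T fun s => conj (F s) := fun m =>
  (Complex.continuous_conj.comp_aestronglyMeasurable (hF (-m)) :)

theorem coeffMeasurable_of_continuousOn {T : ℝ} {F : ℝ → FormalFourierSeries}
    (h : ∀ m, ContinuousOn (fun s => F s m) (Set.Ioc 0 T)) : CoeffMeasurable T F := fun m =>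
  (h m).aestronglyMeasurable measurableSet_Ioc

/-- The paths of the driving data are measurable on `(0, T]`. -/
structure DriverMeasurable (T : ℝ) (W : Quadruple) : Prop where
  Z : CoeffMeasurable T W.Z
  sq : CoeffMeasurable T W.sq
  absSq : CoeffMeasurable T W.absSq
  cub : CoeffMeasurable T W.cub

theorem driverMeasurable_of_mem_drivers {W : Quadruple} (hW : W ∈ drivers P) (T : ℝ) :
    DriverMeasurable T W := by
  obtain ⟨h1, h2, h3, h4, -⟩ := hW 1 one_pos
  have hsub : Set.Ioc 0 T ⊆ Set.Ioi (0 : ℝ) := fun s hs => hs.1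
  exact ⟨coeffMeasurable_of_continuousOn fun m => (h1.continuousOn_coeff m).mono fun s hs => hs.1.le,
    coeffMeasurable_of_continuousOn fun m => (h2.continuousOn_coeff m).mono hsub,
    coeffMeasurable_of_continuousOn fun m => (h3.continuousOn_coeff m).mono hsub,
    coeffMeasurable_of_continuousOn fun m => (h4.continuousOn_coeff m).mono hsub⟩

theorem coeffMeasurable_nonlinearity {a T : ℝ} (ha : 0 < a) (ν lam : ℂ) {r : ℝ → ℝ}
    {W : Quadruple} {Y : ℝ → FormalFourierSeries} (hWm : DriverMeasurable T W)
    (hYm : CoeffMeasurable T Y) (hW : ∀ s ∈ Set.Ioc 0 T, DriverBound P (a / 8) (r s) W s)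
    (hY : ∀ s ∈ Set.Ioc 0 T, HolderBound P a (r s) (Y s)) :
    CoeffMeasurable T fun s => nonlinearity ν lam (Y s) W s := by
  obtain ⟨C, -, hC⟩ := exists_holderBound_mul_pos P ha
  have hβ : 0 < a / 8 := by positivity
  have hβa : 2 * (a / 8) < a := by linarith
  have hβa2 : 2 * (a / 8) < a / 2 := by linarith
  have hle : -(a / 8) ≤ a := by linarith
  have hle2 : -(a / 8) ≤ a / 2 := by linarith
  have m1 : CoeffMeasurable T fun s => mul (Y s) (conj (Y s)) := hYm.mul hYm.conj fun s hs =>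
    ((hY s hs).mono_exponent hle).summable_mul (hY s hs).conj hβ hβa
  have m2 : CoeffMeasurable T fun s => mul (Y s) (Y s) := hYm.mul hYm fun s hs =>
    ((hY s hs).mono_exponent hle).summable_mul (hY s hs) hβ hβa
  have b1 := fun s hs => hC _ _ _ _ (hY s hs) (hY s hs).conj
  have b2 := fun s hs => hC _ _ _ _ (hY s hs) (hY s hs)
  have m3 := m1.mul hYm fun s hs =>
    ((b1 s hs).mono_exponent hle2).summable_mul (hY s hs) hβ hβa
  have m4 := hWm.Z.mul m1 fun s hs => (hW s hs).Z.summable_mul (b1 s hs) hβ hβa2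
  have m5 := hWm.Z.conj.mul m2 fun s hs => (hW s hs).Z.conj.summable_mul (b2 s hs) hβ hβa2
  have m6 := hWm.absSq.mul hYm fun s hs => (hW s hs).absSq.summable_mul (hY s hs) hβ hβa
  have m7 := hWm.sq.mul hYm.conj fun s hs => (hW s hs).sq.summable_mul (hY s hs).conj hβ hβa
  intro m
  have := (((hWm.Z m).add (hYm m)).const_mul (1 + lam)).sub
    ((((((m3 m).add ((m4 m).const_mul 2)).add (m5 m)).add ((m6 m).const_mul 2)).add
      (m7 m)).add (hWm.cub m) |>.const_mul ν)
  exact this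

/-! ### Continuity and integrability of the mild formula, coefficient by coefficient. -/

theorem continuous_heatSymbol (μ : ℝ) (m : Fin 2 → ℤ) : Continuous fun t => heatSymbol μ t m := by
  unfold heatSymbol; fun_prop

theorem heatSymbol_sub (μ t s : ℝ) (m : Fin 2 → ℤ) :
    heatSymbol μ (t - s) m = heatSymbol μ t m * heatSymbol μ (-s) m := by
  rw [heatSymbol, heatSymbol, heatSymbol, ← Complex.exp_add]
  congr 1; push_cast; ring

/-- At a fixed frequency the semigroup is a scalar exponential and can be run backwards. Taking the
factor at time `t` out of the integral leaves the primitive of an integrable function. -/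
theorem continuousOn_mild {μ T : ℝ} (hT : 0 < T) {Y₀ : FormalFourierSeries}
    {F : ℝ → FormalFourierSeries} {m : Fin 2 → ℤ}
    (hF : IntervalIntegrable (fun s => F s m) volume 0 T) :
    ContinuousOn (fun t => (semigroup μ t Y₀ + duhamel μ F t) m) (Set.Ioc 0 T) := by
  have h1 : IntervalIntegrable (fun s => heatSymbol μ (-s) m * F s m) volume 0 T :=
    hF.continuousOn_mul ((continuous_heatSymbol μ m).comp continuous_neg).continuousOn
  have h2 := intervalIntegral.continuousOn_primitive_interval' h1 Set.left_mem_uIcc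
  rw [Set.uIcc_of_le hT.le] at h2
  have e : (fun t => (semigroup μ t Y₀ + duhamel μ F t) m) = fun t =>
      heatSymbol μ t m * (Y₀ m + ∫ s in (0 : ℝ)..t, heatSymbol μ (-s) m * F s m) := by
    ext t
    rw [mul_add, ← intervalIntegral.integral_const_mul]
    change heatSymbol μ t m * Y₀ m + ∫ s in (0 : ℝ)..t, heatSymbol μ (t - s) m * F s m = _
    simp only [heatSymbol_sub, mul_assoc]
  rw [e]
  exact (continuous_heatSymbol μ m).continuousOn.mul
    (continuousOn_const.add (h2.mono Set.Ioc_subset_Icc_self))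

theorem intervalIntegrable_coeff {α η A T : ℝ} (hT : 0 < T) (hη : η < 1)
    {F : ℝ → FormalFourierSeries} (hm : CoeffMeasurable T F)
    (hb : ∀ s ∈ Set.Ioc 0 T, HolderBound P α (A * s ^ (-η)) (F s)) (m : Fin 2 → ℤ) :
    IntervalIntegrable (fun s => F s m) volume 0 T := by
  obtain ⟨C, N, hC, hcoeff⟩ := exists_norm_coeff_le P α
  rw [intervalIntegrable_iff_integrableOn_Ioc_of_le hT.le]
  have hi : IntervalIntegrable (fun s : ℝ => C * (1 + ‖m‖) ^ N * (A * s ^ (-η))) volume 0 T :=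
    ((intervalIntegral.intervalIntegrable_rpow' (by linarith)).const_mul A).const_mul _
  refine Integrable.mono' ((intervalIntegrable_iff_integrableOn_Ioc_of_le hT.le).1 hi) (hm m) ?_
  filter_upwards [ae_restrict_mem measurableSet_Ioc] with s hs
  exact hcoeff _ _ (hb s hs) m

theorem intervalIntegrable_semigroup {μ t T : ℝ} (ht : t ∈ Set.Ioc 0 T)
    {F : ℝ → FormalFourierSeries} {m : Fin 2 → ℤ}
    (hF : IntervalIntegrable (fun s => F s m) volume 0 T) :
    IntervalIntegrable (fun s => semigroup μ (t - s) (F s) m) volume 0 t := by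
  have h1 : IntervalIntegrable (fun s => F s m) volume 0 t := hF.mono_set (by
    rw [Set.uIcc_of_le ht.1.le, Set.uIcc_of_le (ht.1.le.trans ht.2)]
    exact Set.Icc_subset_Icc_right ht.2)
  exact h1.continuousOn_mul
    ((continuous_heatSymbol μ m).comp (continuous_const.sub continuous_id)).continuousOn

end

/-! ### Existence -/

section

variable {P : DyadicPartition}

/-- The right-hand side of the mild equation. -/
def mildMap (μ : ℝ) (ν lam : ℂ) (Y₀ : FormalFourierSeries) (W : Quadruple)
    (Y : ℝ → FormalFourierSeries) (t : ℝ) : FormalFourierSeries :=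
  semigroup μ t Y₀ + duhamel μ (fun s => nonlinearity ν lam (Y s) W s) t

/-- Measurable paths on `(0, T]` whose norm in `𝒞^a` at time `t` is at most `R t^{-g}`. -/
structure PathBound (P : DyadicPartition) (a g R T : ℝ) (Y : ℝ → FormalFourierSeries) : Prop where
  measurable : CoeffMeasurable T Y
  bound : ∀ t ∈ Set.Ioc 0 T, HolderBound P a (R * t ^ (-g)) (Y t)

theorem rpow_neg_three_mul {s : ℝ} (hs : 0 < s) (g : ℝ) : s ^ (-(3 * g)) = (s ^ (-g)) ^ 3 := by
  rw [← Real.rpow_natCast, ← Real.rpow_mul hs.le]; congr 1; push_cast; ring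

/-- Half of `R` is reserved for the free evolution and half for the Duhamel term. The single
condition on `R² T^{1/8}` serves both stability and contraction, and is why `T` has to scale like
`R^{-16}`. -/
theorem exists_mildMap_bounds (P : DyadicPartition) {μ : ℝ} (hμ : 0 < μ) (ν lam : ℂ) {a g : ℝ}
    (ha : a ∈ Set.Ioc (0 : ℝ) (1 / 3)) (hg : g ∈ Set.Ioo (0 : ℝ) (1 / 3)) :
    ∃ C : ℝ, 1 ≤ C ∧ ∀ (R T : ℝ) (W : Quadruple) (Y₀ : FormalFourierSeries), 1 ≤ R →
      T ∈ Set.Ioc (0 : ℝ) 1 → C * R ^ 2 * T ^ (1 / 8 : ℝ) ≤ 1 / 2 → DriverMeasurable T W →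
      (∀ t ∈ Set.Ioc 0 T, DriverBound P (a / 8) (R * t ^ (-g)) W t) →
      (∀ t ∈ Set.Ioc 0 T, HolderBound P a (R / 2 * t ^ (-g)) (semigroup μ t Y₀)) →
      (∀ Y, PathBound P a g R T Y →
        (∀ t ∈ Set.Ioc 0 T, ∀ m, IntervalIntegrable
          (fun s => semigroup μ (t - s) (nonlinearity ν lam (Y s) W s) m) volume 0 t) ∧
        (∀ m, ContinuousOn (fun t => mildMap μ ν lam Y₀ W Y t m) (Set.Ioc 0 T)) ∧
        PathBound P a g R T (mildMap μ ν lam Y₀ W Y)) ∧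
      ∀ Y Y' D, PathBound P a g R T Y → PathBound P a g R T Y' → 0 ≤ D →
        (∀ t ∈ Set.Ioc 0 T, HolderBound P a (D * t ^ (-g)) (Y t - Y' t)) →
        ∀ t ∈ Set.Ioc 0 T, HolderBound P a (D / 2 * t ^ (-g))
          (mildMap μ ν lam Y₀ W Y t - mildMap μ ν lam Y₀ W Y' t) := by
  have ha0 := ha.1
  have ha1 := ha.2
  have hg0 := hg.1
  have hg1 := hg.2
  obtain ⟨C₁, hC₁, h₁⟩ := exists_holderBound_nonlinearity P ν lam ha0
  obtain ⟨C₂, hC₂, h₂⟩ := exists_holderBound_nonlinearity_sub P ν lam ha0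
  obtain ⟨C₃, hC₃, h₃⟩ := exists_holderBound_duhamel P hμ (p := 5 * a / 8) (ε := 0)
    (η := 3 * g) ⟨by positivity, by linarith⟩ le_rfl (by linarith)
    ⟨by positivity, by linarith⟩
  refine ⟨C₃ * (C₁ + C₂) + 1, by linarith [mul_pos hC₃ (add_pos hC₁ hC₂)],
    fun R T W Y₀ hR hT hCR hWm hW hY₀ => ?_⟩
  have hR0 : 0 < R := by linarith
  have hT0 := hT.1
  have hT18 : 0 < T ^ (1 / 8 : ℝ) := Real.rpow_pos_of_pos hT0 _
  have hprod : 0 < R ^ 2 * T ^ (1 / 8 : ℝ) := by positivity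
  have hsmall₁ : C₃ * C₁ * R ^ 2 * T ^ (1 / 8 : ℝ) ≤ 1 / 2 := by
    nlinarith [mul_pos (mul_pos hC₃ hC₂) hprod]
  have hsmall₂ : C₃ * C₂ * R ^ 2 * T ^ (1 / 8 : ℝ) ≤ 1 / 2 := by
    nlinarith [mul_pos (mul_pos hC₃ hC₁) hprod]
  have hr : ∀ t ∈ Set.Ioc 0 T, 1 ≤ R * t ^ (-g) := fun t ht =>
    one_le_mul_of_one_le_of_one_le hR
      (Real.one_le_rpow_of_pos_of_le_one_of_nonpos ht.1 (ht.2.trans hT.2) (by linarith))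
  -- Here `1 - 5a/8 - 2g ≥ 1 - 5/24 - 2/3 = 1/8`, which is the origin of the exponent `1/8`.
  have hpow : ∀ t ∈ Set.Ioc 0 T,
      t ^ (1 - (5 * a / 8 + 0) - 3 * g) ≤ T ^ (1 / 8 : ℝ) * t ^ (-g) := by
    intro t ht
    calc t ^ (1 - (5 * a / 8 + 0) - 3 * g) ≤ t ^ (1 / 8 + -g) :=
          Real.rpow_le_rpow_of_exponent_ge ht.1 (ht.2.trans hT.2) (by linarith)
      _ = t ^ (1 / 8 : ℝ) * t ^ (-g) := Real.rpow_add ht.1 _ _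
      _ ≤ _ := mul_le_mul_of_nonneg_right (Real.rpow_le_rpow ht.1.le ht.2 (by norm_num))
          (Real.rpow_nonneg ht.1.le _)
  have hduh : ∀ (A : ℝ) (F : ℝ → FormalFourierSeries), ∀ t ∈ Set.Ioc 0 T, 0 ≤ A →
      (∀ m, IntervalIntegrable (fun s => semigroup μ (t - s) (F s) m) volume 0 t) →
      (∀ s ∈ Set.Ioc 0 T, HolderBound P (-(a / 4)) (A * s ^ (-(3 * g))) (F s)) →
      HolderBound P a (C₃ * (A * (T ^ (1 / 8 : ℝ) * t ^ (-g)))) (duhamel μ F t) := by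
    intro A F t ht hA hi hF
    have := h₃ (-(a / 4)) A t F ⟨ht.1, ht.2.trans hT.2⟩ hi hA fun s hs => by
      simpa using hF s ⟨hs.1, hs.2.le.trans ht.2⟩
    rw [show -(a / 4) + 2 * (5 * a / 8) = a by ring] at this
    refine this.mono ?_
    have := hpow t ht
    gcongr
  have hΨ : ∀ Y, PathBound P a g R T Y → ∀ s ∈ Set.Ioc 0 T,
      HolderBound P (-(a / 4)) (C₁ * R ^ 3 * s ^ (-(3 * g))) (nonlinearity ν lam (Y s) W s) := by
    intro Y hY s hs
    refine (h₁ W s _ (Y s) (hr s hs) (hW s hs) (hY.bound s hs)).mono ?_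
    rw [rpow_neg_three_mul hs.1]
    exact le_of_eq (by ring)
  have hcoeff : ∀ Y, PathBound P a g R T Y → ∀ m,
      IntervalIntegrable (fun s => nonlinearity ν lam (Y s) W s m) volume 0 T := fun Y hY =>
    intervalIntegrable_coeff hT0 (by linarith)
      (coeffMeasurable_nonlinearity ha0 ν lam hWm hY.measurable hW hY.bound) (hΨ Y hY)
  have hint : ∀ Y, PathBound P a g R T Y → ∀ t ∈ Set.Ioc 0 T, ∀ m, IntervalIntegrable
      (fun s => semigroup μ (t - s) (nonlinearity ν lam (Y s) W s) m) volume 0 t :=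
    fun Y hY t ht m => intervalIntegrable_semigroup ht (hcoeff Y hY m)
  refine ⟨fun Y hY => ⟨hint Y hY, fun m => continuousOn_mild hT0 (hcoeff Y hY m),
    coeffMeasurable_of_continuousOn fun m => continuousOn_mild hT0 (hcoeff Y hY m),
    fun t ht => ?_⟩, fun Y Y' D hY hY' hD hYY t ht => ?_⟩
  · refine ((hY₀ t ht).add (hduh (C₁ * R ^ 3) _ t ht (by positivity) (hint Y hY t ht)
      (hΨ Y hY))).mono ?_
    have h0 : 0 ≤ t ^ (-g) := Real.rpow_nonneg ht.1.le _
    have h5 : C₃ * C₁ * R ^ 2 * T ^ (1 / 8 : ℝ) * (R * t ^ (-g)) ≤ 1 / 2 * (R * t ^ (-g)) := by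
      gcongr
    linarith
  · obtain ⟨hsi, hsd⟩ := duhamel_sub (hint Y hY t ht) (hint Y' hY' t ht)
    have e : mildMap μ ν lam Y₀ W Y t - mildMap μ ν lam Y₀ W Y' t =
        duhamel μ ((fun s => nonlinearity ν lam (Y s) W s) -
          fun s => nonlinearity ν lam (Y' s) W s) t := by
      rw [hsd, mildMap, mildMap]; abel
    rw [e]
    refine (hduh (C₂ * R ^ 2 * D) _ t ht (by positivity) hsi fun s hs => ?_).mono ?_
    · refine (h₂ W s _ _ _ _ (hr s hs) (hW s hs) (hY.bound s hs) (hY'.bound s hs)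
        (hYY s hs)).mono ?_
      rw [rpow_neg_three_mul hs.1]
      exact le_of_eq (by ring)
    · have h0 : 0 ≤ t ^ (-g) := Real.rpow_nonneg ht.1.le _
      have h5 : C₃ * C₂ * R ^ 2 * T ^ (1 / 8 : ℝ) * (D * t ^ (-g)) ≤ 1 / 2 * (D * t ^ (-g)) := by
        gcongr
      linarith

theorem pathBound_zero {a g R T : ℝ} (hR : 0 ≤ R) : PathBound P a g R T 0 :=
  ⟨fun _ => aestronglyMeasurable_const, fun _ ht =>
    HolderBound.zero_le (mul_nonneg hR (Real.rpow_nonneg ht.1.le _))⟩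

/-- A map that halves distances has a fixed point among the paths bounded by `R t^{-g}`. -/
theorem exists_fixedPoint_of_halving {a g R T : ℝ} (hR : 0 ≤ R)
    {Φ : (ℝ → FormalFourierSeries) → ℝ → FormalFourierSeries}
    (hΦ : ∀ Y, PathBound P a g R T Y → PathBound P a g R T (Φ Y))
    (hΦ' : ∀ Y Y' D, PathBound P a g R T Y → PathBound P a g R T Y' → 0 ≤ D →
      (∀ t ∈ Set.Ioc 0 T, HolderBound P a (D * t ^ (-g)) (Y t - Y' t)) →
      ∀ t ∈ Set.Ioc 0 T, HolderBound P a (D / 2 * t ^ (-g)) (Φ Y t - Φ Y' t)) :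
    ∃ Y, PathBound P a g R T Y ∧ ∀ t ∈ Set.Ioc 0 T, Y t = Φ Y t := by
  set X : ℕ → ℝ → FormalFourierSeries := fun n => Φ^[n] 0 with hX
  have hXs : ∀ n, X (n + 1) = Φ (X n) := fun n => Function.iterate_succ_apply' Φ n 0
  have hXb : ∀ n, PathBound P a g R T (X n) := by
    intro n
    induction n with
    | zero => exact pathBound_zero hR
    | succ n ih => rw [hXs]; exact hΦ _ ih
  have hstep : ∀ n, ∀ t ∈ Set.Ioc 0 T,
      HolderBound P a (R * (1 / 2) ^ n * t ^ (-g)) (X (n + 1) t - X n t) := by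
    intro n
    induction n with
    | zero =>
      intro t ht
      have : X 0 t = 0 := rfl
      rw [this, sub_zero, pow_zero, mul_one]
      exact (hXb 1).bound t ht
    | succ n ih =>
      intro t ht
      have := hΦ' _ _ _ (hXb (n + 1)) (hXb n) (by positivity) ih t ht
      rw [← hXs, ← hXs] at this
      rw [pow_succ]
      exact this.mono (le_of_eq (by ring))
  -- The exact geometric sum, with its factor `1 - (1/2)^k`, lets the induction on `k` close.
  have hfar : ∀ n k, ∀ t ∈ Set.Ioc 0 T,
      HolderBound P a (2 * R * (1 / 2) ^ n * (1 - (1 / 2) ^ k) * t ^ (-g)) (X (n + k) t - X n t) := by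
    intro n k
    induction k with
    | zero => intro _ _; simpa using holderBound_zero (P := P) a
    | succ k ih =>
      intro t ht
      have := (hstep (n + k) t ht).add (ih t ht)
      rw [sub_add_sub_cancel] at this
      refine this.mono (le_of_eq ?_)
      rw [pow_succ, pow_add]; ring
  have hfar' : ∀ n k, ∀ t ∈ Set.Ioc 0 T,
      HolderBound P a (2 * R * (1 / 2) ^ n * t ^ (-g)) (X (n + k) t - X n t) := by
    intro n k t ht
    refine (hfar n k t ht).mono ?_
    have h0 : 0 ≤ t ^ (-g) := Real.rpow_nonneg ht.1.le _
    refine mul_le_mul_of_nonneg_right (mul_le_of_le_one_right (by positivity) ?_) h0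
    linarith [pow_nonneg (show (0 : ℝ) ≤ 1 / 2 by norm_num) k]
  obtain ⟨C, N, hC, hcoeff⟩ := exists_norm_coeff_le P a
  have hcau : ∀ t ∈ Set.Ioc 0 T, ∀ m, CauchySeq fun n => X n t m := by
    intro t ht m
    refine cauchySeq_of_le_geometric (1 / 2) (C * (1 + ‖m‖) ^ N * (R * t ^ (-g))) (by norm_num)
      fun n => ?_
    rw [dist_comm, dist_eq_norm]
    exact (hcoeff _ _ (hstep n t ht) m).trans_eq (by ring)
  -- The limit is taken in each coefficient; the values of `limUnder` off `(0, T]` play no role.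
  set Y : ℝ → FormalFourierSeries := fun t m =>
    Filter.limUnder Filter.atTop fun n => X n t m with hYdef
  have hlim : ∀ t ∈ Set.Ioc 0 T, ∀ m, Filter.Tendsto (fun n => X n t m) Filter.atTop (𝓝 (Y t m)) :=
    fun t ht m => (hcau t ht m).tendsto_limUnder
  have hY : PathBound P a g R T Y := by
    refine ⟨fun m => aestronglyMeasurable_of_tendsto_ae Filter.atTop
      (fun n => (hXb n).measurable m) ?_, fun t ht =>
      HolderBound.of_tendsto (hlim t ht) (Filter.Eventually.of_forall fun n => (hXb n).bound t ht)⟩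
    filter_upwards [ae_restrict_mem measurableSet_Ioc] with t ht using hlim t ht m
  have hYX : ∀ n, ∀ t ∈ Set.Ioc 0 T,
      HolderBound P a (2 * R * (1 / 2) ^ n * t ^ (-g)) (Y t - X n t) := by
    intro n t ht
    refine HolderBound.of_tendsto (l := Filter.atTop) (F := fun k => X (n + k) t - X n t)
      (fun m => ?_) (Filter.Eventually.of_forall fun k => hfar' n k t ht)
    have := (hlim t ht m).comp (Filter.tendsto_add_atTop_nat n)
    simp only [Function.comp_def, add_comm _ n] at this
    exact this.sub_const _
  refine ⟨Y, hY, fun t ht => ?_⟩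
  ext m
  -- The iterates `X (n + 1) = Φ (X n)` converge both to `Y` and to `Φ Y`.
  refine tendsto_nhds_unique ((hlim t ht m).comp (Filter.tendsto_add_atTop_nat 1)) ?_
  rw [tendsto_iff_norm_sub_tendsto_zero]
  have hz : Filter.Tendsto (fun n : ℕ => C * (1 + ‖m‖) ^ N *
      (2 * R * (1 / 2) ^ n / 2 * t ^ (-g))) Filter.atTop (𝓝 0) := by
    have := (tendsto_pow_atTop_nhds_zero_of_lt_one (r := (1 / 2 : ℝ)) (by norm_num)
      (by norm_num)).const_mul (C * (1 + ‖m‖) ^ N * R * t ^ (-g))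
    rw [mul_zero] at this
    exact this.congr fun n => by ring
  refine squeeze_zero (fun _ => norm_nonneg _) (fun n => ?_) hz
  rw [norm_sub_rev, Function.comp_apply, hXs]
  exact hcoeff _ _ (hΦ' Y (X n) _ hY (hXb n) (by positivity) (hYX n) t ht) m

/-! ### Solutions -/

/-- For `t ≤ 1` and `β ≤ 2g`, the blow-up `t^{-β}` of the higher data is at most `(t^{-g})²`, hence
within the growth allowed for degrees two and three. -/
theorem driverBound_of_norm_le {β g K R t : ℝ} {W : Quadruple} (ht : t ∈ Set.Ioc (0 : ℝ) 1)
    (hg : 0 ≤ g) (hβ : β ≤ 2 * g) (hK : 0 ≤ K) (hR : 1 ≤ R) (hKR : K ≤ R)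
    (h : W.norm P β t ≤ ENNReal.ofReal K) : DriverBound P β (R * t ^ (-g)) W t := by
  have ht0 := ht.1
  simp only [Quadruple.norm, max_le_iff] at h
  obtain ⟨h1, h2, h3, h4⟩ := h
  set w := t ^ (-g) with hw
  have hw1 : 1 ≤ w := Real.one_le_rpow_of_pos_of_le_one_of_nonpos ht0 ht.2 (by linarith)
  have hw2 : t ^ (-β) ≤ w ^ 2 := by
    rw [hw, ← Real.rpow_natCast, ← Real.rpow_mul ht0.le]
    refine Real.rpow_le_rpow_of_exponent_ge ht0 ht.2 ?_
    push_cast; linarith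
  have hweight : ∀ f, ENNReal.ofReal (t ^ β) * holderNorm P (-β) f ≤ ENNReal.ofReal K →
      HolderBound P (-β) (K * t ^ (-β)) f := by
    intro f hf
    rw [← holderNorm_le_ofReal_iff (by positivity)]
    have hpos : 0 < t ^ β := Real.rpow_pos_of_pos ht0 β
    rw [mul_comm, ← ENNReal.le_div_iff_mul_le (Or.inl (by simpa using hpos))
      (Or.inl ENNReal.ofReal_ne_top), ← ENNReal.ofReal_div_of_pos hpos] at hf
    rwa [Real.rpow_neg ht0.le, ← div_eq_mul_inv]
  have hR0 : 0 ≤ R := by linarith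
  have hle2 : K * t ^ (-β) ≤ (R * w) ^ 2 := by
    rw [mul_pow]
    exact mul_le_mul (hKR.trans (le_self_pow₀ hR (by norm_num))) hw2 (by positivity)
      (by positivity)
  have hle3 : K * t ^ (-β) ≤ (R * w) ^ 3 :=
    hle2.trans (pow_le_pow_right₀ (one_le_mul_of_one_le_of_one_le hR hw1) (by norm_num))
  refine ⟨((holderNorm_le_ofReal_iff hK).1 h1).mono ?_, (hweight _ h2).mono hle2,
    (hweight _ h3).mono hle2, (hweight _ h4).mono hle3⟩
  exact hKR.trans (le_mul_of_one_le_right hR0 hw1)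

theorem IsSolution.exists_bound {μ T : ℝ} {ν lam : ℂ} {Y₀ : FormalFourierSeries} {W : Quadruple}
    {Y : ℝ → FormalFourierSeries} (h : IsSolution P μ ν lam Y₀ W T Y) :
    ∃ a g M : ℝ, 0 < a ∧ g ∈ Set.Ioo (0 : ℝ) (1 / 3) ∧ 0 ≤ M ∧
      ∀ t ∈ Set.Ioc 0 T, HolderBound P a (M * t ^ (-g)) (Y t) := by
  obtain ⟨⟨a, g, ha, hg0, hg1, -, hsup⟩, -⟩ := h
  set S := ⨆ t ∈ Set.Ioc 0 T, ENNReal.ofReal (t ^ g) * holderNorm P a (Y t) with hS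
  refine ⟨a, g, S.toReal, ha, ⟨hg0, hg1⟩, ENNReal.toReal_nonneg, fun t ht => ?_⟩
  have ht0 := ht.1
  have hpos : 0 < t ^ g := Real.rpow_pos_of_pos ht0 g
  have hle : ENNReal.ofReal (t ^ g) * holderNorm P a (Y t) ≤ ENNReal.ofReal S.toReal := by
    rw [ENNReal.ofReal_toReal hsup.ne]
    exact le_iSup₂ (f := fun t (_ : t ∈ Set.Ioc 0 T) =>
      ENNReal.ofReal (t ^ g) * holderNorm P a (Y t)) t ht
  rw [← holderNorm_le_ofReal_iff (by positivity)]
  rw [mul_comm, ← ENNReal.le_div_iff_mul_le (Or.inl (by simpa using hpos))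
    (Or.inl ENNReal.ofReal_ne_top), ← ENNReal.ofReal_div_of_pos hpos] at hle
  rwa [Real.rpow_neg ht0.le, ← div_eq_mul_inv]

theorem IsSolution.eq_mildMap {μ T : ℝ} {ν lam : ℂ} {Y₀ : FormalFourierSeries} {W : Quadruple}
    {Y : ℝ → FormalFourierSeries} (h : IsSolution P μ ν lam Y₀ W T Y) :
    ∀ t ∈ Set.Ioc 0 T,
      Y t = semigroup μ t Y₀ + duhamel μ (fun s => nonlinearity ν lam (Y s) W s) t :=
  fun t ht => funext fun m => (h.2 t ht m).2

/-- Since `T ≤ 1`, lowering the regularity and raising the blow-up exponent puts two solutions with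
different exponents into one class. The data are bounded at the new exponent because `drivers` asks
for every positive exponent. -/
theorem IsSolution.eqOn {μ T : ℝ} (hμ : 0 < μ) (hT : T ∈ Set.Ioc (0 : ℝ) 1) {ν lam : ℂ}
    {Y₀ : FormalFourierSeries} {W : Quadruple} (hW : W ∈ drivers P)
    {Y Y' : ℝ → FormalFourierSeries} (h : IsSolution P μ ν lam Y₀ W T Y)
    (h' : IsSolution P μ ν lam Y₀ W T Y') : Set.EqOn Y Y' (Set.Ioc 0 T) := by
  obtain ⟨a₁, g₁, M₁, ha₁, hg₁, hM₁, hb₁⟩ := h.exists_bound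
  obtain ⟨a₂, g₂, M₂, ha₂, hg₂, hM₂, hb₂⟩ := h'.exists_bound
  set g := max g₁ g₂ with hg
  have hg0 : 0 < g := hg₁.1.trans_le (le_max_left _ _)
  have hg1 : g < 1 / 3 := max_lt hg₁.2 hg₂.2
  -- The minimum with `g` secures both `a ≤ 1/3` and `a/8 ≤ 2g`.
  set a := min (min a₁ a₂) g with ha
  have ha0 : 0 < a := lt_min (lt_min ha₁ ha₂) hg0
  have hag : a ≤ g := min_le_right _ _
  have haa₁ : a ≤ a₁ := (min_le_left _ _).trans (min_le_left _ _)
  have haa₂ : a ≤ a₂ := (min_le_left _ _).trans (min_le_right _ _)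
  set S := ⨆ t ∈ Set.Ioc 0 T, W.norm P (a / 8) t with hS
  have hStop : S < ⊤ := (hW (a / 8) (by positivity)).2.2.2.2 T hT.1
  set R := 1 + S.toReal + 2 ^ (a₁ - a) * M₁ + 2 ^ (a₂ - a) * M₂ with hR
  have hS0 : 0 ≤ S.toReal := ENNReal.toReal_nonneg
  have hR₁ : 0 ≤ 2 ^ (a₁ - a) * M₁ := by positivity
  have hR₂ : 0 ≤ 2 ^ (a₂ - a) * M₂ := by positivity
  have hconv : ∀ {b k M : ℝ} {f : FormalFourierSeries} {t : ℝ}, t ∈ Set.Ioc 0 T → a ≤ b → k ≤ g →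
      0 ≤ M → 2 ^ (b - a) * M ≤ R → HolderBound P b (M * t ^ (-k)) f →
      HolderBound P a (R * t ^ (-g)) f := by
    intro b k M f t ht hb hk hM hMR hf
    refine (hf.mono_exponent hb).mono ?_
    rw [← mul_assoc]
    have ht0 := ht.1
    have := Real.rpow_le_rpow_of_exponent_ge ht0 (ht.2.trans hT.2) (neg_le_neg hk)
    exact mul_le_mul hMR this (by positivity) (by linarith)
  refine eqOn_of_mild P hμ ν lam (a := a) (g := g) (R := R) ⟨ha0, by linarith⟩ ⟨hg0, hg1⟩
    (by linarith) hT.2 (W := W) (Y₀ := Y₀) (fun t ht => ?_)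
    (fun t ht => hconv ht haa₁ (le_max_left _ _) hM₁ (by linarith) (hb₁ t ht))
    (fun t ht => hconv ht haa₂ (le_max_right _ _) hM₂ (by linarith) (hb₂ t ht))
    (fun t ht m => (h.2 t ht m).1) (fun t ht m => (h'.2 t ht m).1) h.eq_mildMap h'.eq_mildMap
  refine driverBound_of_norm_le ⟨ht.1, ht.2.trans hT.2⟩ hg0.le (by linarith) hS0 (by linarith)
    (by linarith) ?_
  rw [ENNReal.ofReal_toReal hStop.ne]
  exact le_iSup₂ (f := fun t (_ : t ∈ Set.Ioc 0 T) => W.norm P (a / 8) t) t ht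

/-- The exponent drops from `a` to `a/2` because boundedness in `𝒞^a` with continuous coefficients
gives norm continuity only below `a`; a solution may have any positive regularity. -/
theorem isSolution_of_fixedPoint {μ T a g R : ℝ} {ν lam : ℂ} {Y₀ : FormalFourierSeries}
    {W : Quadruple} {Y : ℝ → FormalFourierSeries} (ha : 0 < a) (hg : g ∈ Set.Ioo (0 : ℝ) (1 / 3))
    (hR : 0 ≤ R) (hY : PathBound P a g R T Y)
    (hint : ∀ t ∈ Set.Ioc 0 T, ∀ m, IntervalIntegrable
      (fun s => semigroup μ (t - s) (nonlinearity ν lam (Y s) W s) m) volume 0 t)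
    (hc : ∀ m, ContinuousOn (fun t => mildMap μ ν lam Y₀ W Y t m) (Set.Ioc 0 T))
    (heq : ∀ t ∈ Set.Ioc 0 T, Y t = mildMap μ ν lam Y₀ W Y t) :
    IsSolution P μ ν lam Y₀ W T Y := by
  refine ⟨⟨a / 2, g, half_pos ha, hg.1, hg.2,
    continuousInto_of_locally_bounded (half_lt_self ha) (fun m => (hc m).congr fun t ht => ?_)
      fun t ht => ⟨R * (t / 2) ^ (-g), ?_⟩, ?_⟩,
    fun t ht m => ⟨hint t ht m, congrFun (heq t ht) m⟩⟩
  · exact congrFun (heq t ht) m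
  · have ht0 := ht.1
    filter_upwards [self_mem_nhdsWithin,
      mem_nhdsWithin_of_mem_nhds (Ioi_mem_nhds (half_lt_self ht0))] with s hs hst
    refine (hY.bound s hs).mono (mul_le_mul_of_nonneg_left ?_ hR)
    exact Real.rpow_le_rpow_of_nonpos (by positivity) (Set.mem_Ioi.1 hst).le (by linarith [hg.1])
  · refine lt_of_le_of_lt (iSup₂_le fun t ht => ?_)
      (ENNReal.ofReal_lt_top (r := 2 ^ (a - a / 2) * R))
    have ht0 := ht.1
    have hb := (hY.bound t ht).mono_exponent (half_le_self ha.le)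
    have hw : 0 ≤ t ^ g := Real.rpow_nonneg ht0.le g
    calc ENNReal.ofReal (t ^ g) * holderNorm P (a / 2) (Y t)
        ≤ ENNReal.ofReal (t ^ g) * ENNReal.ofReal (2 ^ (a - a / 2) * (R * t ^ (-g))) := by
          gcongr
          exact (holderNorm_le_ofReal_iff hb.nonneg).2 hb
      _ = ENNReal.ofReal (2 ^ (a - a / 2) * R) := by
          rw [← ENNReal.ofReal_mul hw]
          congr 1
          have : t ^ g * t ^ (-g) = 1 := by rw [← Real.rpow_add ht0]; simp
          linear_combination (2 ^ (a - a / 2) * R) * this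

end

end CGL

end

/-! ### Choice of parameters and conclusion. -/

theorem mainTheorem2 (α₀ : ℝ) (hα₀ : α₀ ∈ Set.Ioo (0 : ℝ) (2 / 3)) :
    ∃ α θ : ℝ, 0 < α ∧ 0 < θ ∧
      ∀ (P : CGL.DyadicPartition) (μ : ℝ) (ν lam : ℂ), 0 < μ →
        ∃ C : ℝ, 0 < C ∧ ∀ K Tstar : ℝ, 1 ≤ K → Tstar = C * K ^ (-θ) →
          ∀ (Y₀ : CGL.FormalFourierSeries) (W : CGL.Quadruple),
            CGL.MemHolder P (-α₀) Y₀ → W ∈ CGL.drivers P →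
            CGL.holderNorm P (-α₀) Y₀ + (⨆ t ∈ Set.Ioc 0 Tstar, W.norm P α t) ≤
              ENNReal.ofReal K →
            ∃ Y, CGL.solutionSet P μ ν lam Y₀ W Tstar = {Y} := by
  obtain ⟨hα0, hα1⟩ := hα₀
  -- Half of the room below `2/3` goes to `a`. Then `g`, the exact smoothing cost from `𝒞^{-α₀}` to
  -- `𝒞^a`, equals `α₀/4 + 1/6 < 1/3`.
  set a : ℝ := (2 / 3 - α₀) / 2 with ha
  set g : ℝ := (α₀ + a) / 2 with hg
  have ha0 : 0 < a := by rw [ha]; linarith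
  have ha1 : a ≤ 1 / 3 := by rw [ha]; linarith
  have hg0 : 0 < g := by positivity
  have hg1 : g < 1 / 3 := by rw [hg, ha]; linarith
  refine ⟨a / 8, 16, by positivity, by norm_num, fun P μ ν lam hμ => ?_⟩
  obtain ⟨C₁, hC₁, h₁⟩ := CGL.exists_holderBound_semigroup P hμ
  obtain ⟨C₂, hC₂, h₂⟩ := CGL.exists_mildMap_bounds P hμ ν lam ⟨ha0, ha1⟩ ⟨hg0, hg1⟩
  -- With `T = B^{-8} K^{-16}` and `R = 2(1 + C₁)K`, the quantity `C₂ R² T^{1/8}` is exactly `1/2`;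
  -- moreover `B ≥ 1` keeps `T ≤ 1`.
  set B : ℝ := 8 * C₂ * (1 + C₁) ^ 2 with hB
  have hB1 : 1 ≤ B := by rw [hB]; nlinarith
  have hB0 : 0 < B := by linarith
  refine ⟨B ^ (-8 : ℝ), by positivity, fun K T hK hTdef Y₀ W _ hW hle => ?_⟩
  have hK0 : 0 < K := by linarith
  have hT : T ∈ Set.Ioc (0 : ℝ) 1 := by
    rw [hTdef]
    exact ⟨by positivity, mul_le_one₀ (Real.rpow_le_one_of_one_le_of_nonpos hB1 (by norm_num))
      (by positivity) (Real.rpow_le_one_of_one_le_of_nonpos hK (by norm_num))⟩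
  have hT8 : T ^ (1 / 8 : ℝ) = B⁻¹ * (K ^ 2)⁻¹ := by
    rw [hTdef, Real.mul_rpow (by positivity) (by positivity), ← Real.rpow_mul hB0.le,
      ← Real.rpow_mul hK0.le]
    rw [show (-8 : ℝ) * (1 / 8) = -1 by norm_num, show (-16 : ℝ) * (1 / 8) = -2 by norm_num,
      Real.rpow_neg_one, Real.rpow_neg hK0.le, Real.rpow_two]
  -- Half of `R` dominates the bound `C₁ K` of the free evolution, and `R ≥ K` dominates the data.
  set R : ℝ := 2 * (1 + C₁) * K with hR
  have hKR : K ≤ R := by rw [hR]; nlinarith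
  have hR1 : 1 ≤ R := hK.trans hKR
  have hsmall : C₂ * R ^ 2 * T ^ (1 / 8 : ℝ) ≤ 1 / 2 := by
    rw [hT8, hR, hB]
    exact le_of_eq (by field_simp; ring)
  have hdrv : ∀ t ∈ Set.Ioc 0 T, CGL.DriverBound P (a / 8) (R * t ^ (-g)) W t := fun t ht =>
    CGL.driverBound_of_norm_le ⟨ht.1, ht.2.trans hT.2⟩ hg0.le (by rw [hg]; linarith) hK0.le hR1 hKR
      ((le_iSup₂ (f := fun t (_ : t ∈ Set.Ioc 0 T) => W.norm P (a / 8) t) t ht).trans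
        (le_add_self.trans hle))
  have hY₀ : CGL.HolderBound P (-α₀) K Y₀ :=
    (CGL.holderNorm_le_ofReal_iff hK0.le).1 (le_self_add.trans hle)
  have hfree : ∀ t ∈ Set.Ioc 0 T,
      CGL.HolderBound P a (R / 2 * t ^ (-g)) (CGL.semigroup μ t Y₀) := by
    intro t ht
    have h := h₁ t ⟨ht.1, ht.2.trans hT.2⟩ g ⟨hg0.le, by linarith⟩ (-α₀) K Y₀ hY₀
    rw [show -α₀ + 2 * g = a by rw [hg]; ring] at h
    refine h.mono ?_
    have h0 : 0 ≤ K * t ^ (-g) := mul_nonneg hK0.le (Real.rpow_nonneg ht.1.le _)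
    rw [hR]
    linarith
  obtain ⟨hmap, hcontr⟩ :=
    h₂ R T W Y₀ hR1 hT hsmall (CGL.driverMeasurable_of_mem_drivers hW T) hdrv hfree
  obtain ⟨Y, hY, hfix⟩ := CGL.exists_fixedPoint_of_halving (by linarith)
    (fun Y hY => (hmap Y hY).2.2) hcontr
  have hsol : CGL.IsSolution P μ ν lam Y₀ W T Y := CGL.isSolution_of_fixedPoint ha0 ⟨hg0, hg1⟩
    (by linarith) hY (hmap Y hY).1 (hmap Y hY).2.1 hfix
  refine ⟨fun t => Y t, Set.eq_singleton_iff_unique_mem.2 ⟨⟨Y, hsol, fun _ => rfl⟩, ?_⟩⟩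
  rintro y ⟨Y', hsol', hy⟩
  ext1 t
  rw [← hy t]
  exact hsol'.eqOn hμ hT hW hsol t.2
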